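/- Let $n\ge 2$ and let $a_0,\dots,a_{n-1}$ be positive integers. Put $k=a_0+\dots+a_{n-1}$, $b_i=a_1+\dots+a_i$ for $1\le i\le n-1$ and $b_i=k$ for $i\ge n$. On the space of finitely supported real sequences $x=(x_i)_{i\ge1}$ let $\psi_i(x)=x_1+\dots+x_i$ for $i<n$ and $\psi_i(x)=x_{i-n+1}+\dots+x_i$ for $i\ge n$, and let $\Pi$ be the set of those $x$ with $x_i\ge 0$ and $\psi_i(x)\le b_i$ for all $i\ge 1$. Its facets are $\Gamma_i=\Pi\cap\{\psi_i(x)=b_i\}$ and $\Delta_i=\Pi\cap\{x_i=0\}$, $i\ge1$. A vertex of $\Pi$ is a point of $\Pi$ for which the set of facets containing it is maximal. An edge is a subset with more than one point for which the set of facets containing it is maximal among such subsets, and which consists of all points of $\Pi$ in these facets. For a vertex $u$, a direction vector at $u$ is a primitive integral vector $\varepsilon$ such that $u+\varepsilon\in e$ for some edge $e\ni u$. The vertex $u$ is simple if the direction vectors at $u$ are linearly independent. Let $C_u=\{u+\sum_i\alpha_i\varepsilon_i\}$ (finite sums, all $\alpha_i\ge0$, $\varepsilon_i$ direction vectors at $u$),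 let $C_u^m=C_u\cap\{x_i=0 \text{ for all } i>m\}$, and let $l_u$ be the largest $i$ with $u\in\Gamma_i$ ($l_u=0$ if there is none). For a finite-dimensional rational cone $C$ in this space, $S(C)=\sum_{x}t^x$ is the formal sum over the integer points $x$ of $C$, and $\sigma(C)=f/\theta$ is the rational function given by Laurent polynomials $\theta\neq0$ and $f$ with $\theta S(C)=f$. If the substitution $t_{j(n-1)+r}=z_rq^j$ ($j\ge0$, $1\le r\le n-1$) is applicable to $\sigma(C)$, then $\sigma^*(C)\in\mathbb C(z_1,\dots,z_{n-1},q)$ denotes its result. Let $\alpha_0,\dots,\alpha_{n-1}$ be the simple roots of $\widehat{\mathfrak{sl}_n}(\mathbb C)$ and $\delta=\alpha_0+\dots+\alpha_{n-1}$. Identify Laurent monomials in the $z_r$ and $q$ with exponents of elements of the root lattice by $z_r=\exp(\alpha_1+\dots+\alpha_r)$, $q=\exp(-\delta)$. Let $R$ be the ring of formal series over $\mathbb{C}$ in these exponents with support contained in a finite union of sets $\{\beta\le\mu\}$, where $\beta\le\mu$ means that $\mu-\beta$ is a nonnegative integral combination of simple roots. A quotient of a Laurent polynomial by a finite product of factors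 $1-\exp\alpha$, with $\alpha$ roots of $\widehat{\mathfrak{sl}_n}$, is regarded as an element of $R$, these factors being invertible in $R$. For $m\ge l_u$ let $\tau_u^m\in R$ be the image of $\sigma^*(C_u^m)$, and let $\tau_u\in R$ be the coefficientwise limit of $\tau_u^m$ as $m\to\infty$, i.e. each coefficient of $\tau_u^m$ is eventually equal to that of $\tau_u$. Theorem. For every non-simple vertex $u$ of $\Pi$ the contribution $\tau_u$ is well defined (all $\sigma^*(C_u^m)$ with $m\ge l_u$ exist and are quotients of the above kind, and the limit exists and is unique) and $\tau_u=0$. -/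

import Mathlib

/-!
Conventions. Sequences are indexed from `0`: the term with Lean index `i` is the term with index
`i + 1` in one-based numbering, and likewise for the functionals, the bounds, the facets and the
weights `γ`. The dominant weight has coordinates `a 0, …, a (n - 1)`.
-/

noncomputable section

namespace FSPolytope

/-! ### Laurent polynomials, formal Laurent series, rational functions -/

/-- Laurent polynomials over `ℂ` with exponents in the lattice `G`; `exp x` is `single x 1`. -/
abbrev LaurentPoly (G : Type) [AddCommGroup G] : Type := AddMonoidAlgebra ℂ G

/-- The monomial `exp x`. -/
def expo {G : Type} [AddCommGroup G] (x : G) : LaurentPoly G := AddMonoidAlgebra.single x 1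

/-- The field of rational functions attached to the lattice `G`. -/
abbrev RatFun (G : Type) [AddCommGroup G] : Type := FractionRing (LaurentPoly G)

/-- The action of Laurent polynomials on arbitrary formal Laurent series `s : G → ℂ`
(the value `s x` is the coefficient of `exp x`). -/
def laurentMul {G : Type} [AddCommGroup G] (p : LaurentPoly G) (s : G → ℂ) : G → ℂ :=
  fun x => ∑ y ∈ p.coeff.support, p.coeff y * s (x - y)

/-- The coefficients of a Laurent polynomial as a formal Laurent series. -/
def toSeries {G : Type} [AddCommGroup G] (p : LaurentPoly G) : G → ℂ := fun x => p.coeff x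

/-! ### Generating functions in the space of finitely supported sequences -/

/-- Finitely supported real sequences. -/
abbrev RSeq : Type := ℕ →₀ ℝ

/-- Finitely supported integer sequences, the integer points of `RSeq`. -/
abbrev ZSeq : Type := ℕ →₀ ℤ

/-- An integer sequence as a real sequence. -/
def toReal (x : ZSeq) : RSeq := x.mapRange (fun k : ℤ => (k : ℝ)) Int.cast_zero

open Classical in
/-- The generating function of a set: the sum of `exp x` over its integer points `x`. -/
def genFun (C : Set RSeq) : ZSeq → ℂ := fun x => if toReal x ∈ C then 1 else 0

/-- `r = σ(C)`: for some nonzero Laurent polynomial `θ` the product of `θ` and the generating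
function of `C` is a Laurent polynomial `f`, and `r = f / θ`. -/
def IsSigma (C : Set RSeq) (r : RatFun ZSeq) : Prop :=
  ∃ θ f : LaurentPoly ZSeq, θ ≠ 0 ∧ laurentMul θ (genFun C) = toSeries f ∧
    r * algebraMap (LaurentPoly ZSeq) (RatFun ZSeq) θ =
      algebraMap (LaurentPoly ZSeq) (RatFun ZSeq) f

/-! ### Weights of affine `sl_n` and the substitution -/

/-- The root lattice of affine `sl_n`: the function `β` is the weight `∑ i, β i • α_i`, where
`α_0, …, α_{n-1}` are the simple roots. The pointwise order is the usual order on weights. -/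
abbrev RootLattice (n : ℕ) : Type := Fin n → ℤ

/-- The imaginary root `δ = α_0 + ⋯ + α_{n-1}`. -/
def delta (n : ℕ) : RootLattice n := fun _ => 1

/-- The sum `α_i + ⋯ + α_j`, which for `1 ≤ i ≤ j` is a positive root of `sl_n`. -/
def finRoot (n : ℕ) (i j : Fin n) : RootLattice n := fun l => if i ≤ l ∧ l ≤ j then 1 else 0

/-- The roots of affine `sl_n`: the imaginary roots `k δ` with `k ≠ 0`, and the real roots
`k δ ± (α_i + ⋯ + α_j)` with `1 ≤ i ≤ j ≤ n - 1`. -/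
def IsRoot (n : ℕ) (β : RootLattice n) : Prop :=
  (∃ k : ℤ, k ≠ 0 ∧ β = k • delta n) ∨
    ∃ (k : ℤ) (i j : Fin n), 1 ≤ i.val ∧ i ≤ j ∧
      (β = k • delta n + finRoot n i j ∨ β = k • delta n - finRoot n i j)

/-- In one-based numbering `γ_{j (n - 1) + r} = α_1 + ⋯ + α_r - j δ` for `j ≥ 0` and
`1 ≤ r ≤ n - 1`; the Lean index `i` is `j (n - 1) + r - 1`. -/
def gamma (n i : ℕ) : RootLattice n := fun l =>
  (if 1 ≤ l.val ∧ l.val ≤ i % (n - 1) + 1 then 1 else 0) - ((i / (n - 1) : ℕ) : ℤ)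

/-- The weight `∑ i, x_i γ_i` of an integer sequence. -/
def weight (n : ℕ) : ZSeq →+ RootLattice n where
  toFun x := x.sum fun i c => c • gamma n i
  map_zero' := Finsupp.sum_zero_index
  map_add' _ _ := Finsupp.sum_add_index' (fun i => zero_smul ℤ (gamma n i))
    (fun i b c => add_smul b c (gamma n i))

/-- The substitution `t_{j (n - 1) + r} = z_r q ^ j` on Laurent polynomials. The monomials in
`z_1, …, z_{n-1}, q` are written as exponents of weights through `z_r = exp γ_r` and
`q = exp (-δ)`, so that `t_i` is sent to `exp γ_i`. -/
def subst (n : ℕ) : LaurentPoly ZSeq →+* LaurentPoly (RootLattice n) :=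
  AddMonoidAlgebra.mapDomainRingHom ℂ (weight n)

/-- The substitution is applicable to the rational function `r`, with result `s`: one can write
`r = p / d` where `d` does not vanish under the substitution. -/
def IsSubst (n : ℕ) (r : RatFun ZSeq) (s : RatFun (RootLattice n)) : Prop :=
  ∃ p d : LaurentPoly ZSeq, subst n d ≠ 0 ∧
    r * algebraMap (LaurentPoly ZSeq) (RatFun ZSeq) d =
      algebraMap (LaurentPoly ZSeq) (RatFun ZSeq) p ∧
    s * algebraMap (LaurentPoly (RootLattice n)) (RatFun (RootLattice n)) (subst n d) =
      algebraMap (LaurentPoly (RootLattice n)) (RatFun (RootLattice n)) (subst n p)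

/-- `s = σ*(C)`. -/
def IsSigmaStar (n : ℕ) (C : Set RSeq) (s : RatFun (RootLattice n)) : Prop :=
  ∃ r : RatFun ZSeq, IsSigma C r ∧ IsSubst n r s

/-- The characters: formal series whose support is contained in the union of finitely many lower
sets `{β | β ≤ μ}` of the poset of weights. -/
def IsCharacter (n : ℕ) (τ : RootLattice n → ℂ) : Prop :=
  ∃ M : Finset (RootLattice n), ∀ β, τ β ≠ 0 → ∃ μ ∈ M, β ≤ μ

/-- `s` is a quotient `f / ∏ (1 - exp α)` with a Laurent polynomial `f` and finitely many (possibly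
repeated) roots `α`, and the character `τ` is its expansion, i.e. the character with
`∏ (1 - exp α) * τ = f`. -/
def IsExpansion (n : ℕ) (s : RatFun (RootLattice n)) (τ : RootLattice n → ℂ) : Prop :=
  IsCharacter n τ ∧
    ∃ (A : Multiset (RootLattice n)) (f : LaurentPoly (RootLattice n)),
      (∀ α ∈ A, IsRoot n α) ∧
      s * algebraMap (LaurentPoly (RootLattice n)) (RatFun (RootLattice n))
          (A.map fun α => 1 - expo α).prod =
        algebraMap (LaurentPoly (RootLattice n)) (RatFun (RootLattice n)) f ∧
      laurentMul (A.map fun α => 1 - expo α).prod τ = toSeries f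

/-! ### The polytope -/

/-- In one-based numbering: the sum of the terms with index at most `i` if `i < n`, and of the `n`
terms with indices `i - n + 1, …, i` if `i ≥ n`. -/
def psi (n i : ℕ) (x : RSeq) : ℝ := ∑ j ∈ Finset.Icc (i + 1 - n) i, x j

/-- In one-based numbering: `b_i = a_1 + ⋯ + a_i` for `i ≤ n - 1`, and
`b_i = a_0 + ⋯ + a_{n-1}` for `i ≥ n`. -/
def bound (n : ℕ) (a : Fin n → ℕ) (i : ℕ) : ℕ :=
  if i + 1 < n then ∑ j : Fin n with 1 ≤ j.val ∧ j.val ≤ i + 1, a j else ∑ j : Fin n, a j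

/-- The polytope `Π`. -/
def polytope (n : ℕ) (a : Fin n → ℕ) : Set RSeq :=
  {x | (∀ i, 0 ≤ x i) ∧ ∀ i, psi n i x ≤ bound n a i}

/-- Names for the facets `Γ_i` and `Δ_i`. -/
inductive FacetName : Type
  | Gam (i : ℕ) : FacetName
  | Del (i : ℕ) : FacetName

/-- `Γ_i` is cut out of the polytope by `ψ_i = b_i`, and `Δ_i` by the vanishing of the `i`-th
coordinate. -/
def facet (n : ℕ) (a : Fin n → ℕ) : FacetName → Set RSeq
  | FacetName.Gam i => {x | x ∈ polytope n a ∧ psi n i x = bound n a i}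
  | FacetName.Del i => {x | x ∈ polytope n a ∧ x i = 0}

/-- The set of facets containing a given set of points. -/
def facetsOf (n : ℕ) (a : Fin n → ℕ) (e : Set RSeq) : Set FacetName := {F | e ⊆ facet n a F}

/-- Vertices: points of the polytope for which the set of facets containing it is maximal. -/
def IsVertex (n : ℕ) (a : Fin n → ℕ) (u : RSeq) : Prop :=
  u ∈ polytope n a ∧
    ∀ v ∈ polytope n a, facetsOf n a {u} ⊆ facetsOf n a {v} → facetsOf n a {v} ⊆ facetsOf n a {u}

/-- Edges: subsets of more than one point for which the set of facets containing it is maximal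
among such subsets; an edge comprises all points of the polytope lying in those facets. -/
def IsEdge (n : ℕ) (a : Fin n → ℕ) (e : Set RSeq) : Prop :=
  e.Nontrivial ∧ e = {x | x ∈ polytope n a ∧ ∀ F ∈ facetsOf n a e, x ∈ facet n a F} ∧
    ∀ e' : Set RSeq, e' ⊆ polytope n a → e'.Nontrivial →
      facetsOf n a e ⊆ facetsOf n a e' → facetsOf n a e' ⊆ facetsOf n a e

/-- The direction vectors at the vertex `u`: the minimal (i.e. primitive) integral vectors `ε` such
that `u + ε` lies on an edge containing `u`. -/
def directions (n : ℕ) (a : Fin n → ℕ) (u : RSeq) : Set ZSeq :=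
  {ε | (∀ (d : ℕ) (ε' : ZSeq), ε = d • ε' → d = 1) ∧
    ∃ e, IsEdge n a e ∧ u ∈ e ∧ u + toReal ε ∈ e}

/-- A vertex is simple if the direction vectors of the edges at it are linearly independent. -/
def IsSimpleVertex (n : ℕ) (a : Fin n → ℕ) (u : RSeq) : Prop :=
  LinearIndependent ℝ fun ε : directions n a u => toReal (ε : ZSeq)

/-- The vertex cone `C_u`: the points `u + ∑ c_ε ε` with finitely many nonzero `c_ε ≥ 0`. -/
def vertexCone (n : ℕ) (a : Fin n → ℕ) (u : RSeq) : Set RSeq :=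
  {x | ∃ c : directions n a u →₀ ℝ, (∀ ε, 0 ≤ c ε) ∧
    x = u + c.sum fun ε r => r • toReal (ε : ZSeq)}

/-- The section `C_u^m` of the vertex cone by the space of sequences all of whose terms after the
first `m` vanish. -/
def coneSection (n : ℕ) (a : Fin n → ℕ) (u : RSeq) (m : ℕ) : Set RSeq :=
  {x | x ∈ vertexCone n a u ∧ ∀ i, m ≤ i → x i = 0}

/-- `l_u`: the largest one-based index of a facet of type `Γ` containing `u` (`0` if there is
none). -/
def lastGamma (n : ℕ) (a : Fin n → ℕ) (u : RSeq) : ℕ :=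
  sSup {l | ∃ i, u ∈ facet n a (FacetName.Gam i) ∧ l = i + 1}

/-- `τ = τ_u`: for every `m ≥ l_u` the rational function `σ*(C_u^m)` exists and has an expansion
`τ_u^m` as a character, and the coefficients of `τ_u^m` stabilize, as `m` grows, to those of the
character `τ`. -/
def IsContribution (n : ℕ) (a : Fin n → ℕ) (u : RSeq) (τ : RootLattice n → ℂ) : Prop :=
  IsCharacter n τ ∧
    ∃ t : ℕ → RootLattice n → ℂ,
      (∀ m, lastGamma n a u ≤ m →
        ∃ s, IsSigmaStar n (coneSection n a u m) s ∧ IsExpansion n s (t m)) ∧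
      ∀ β, ∀ᶠ m in Filter.atTop, t m β = τ β

end FSPolytope

end

/-! Work in the partial sums $T_j=x_1+\dots+x_j$, continued to $j\le 0$ by the quasi-periodic
sequence `bseq`. Every facet inequality then compares two of them: $T_i\le T_{i+1}$ for `Del`, and
$T_{i+1}\le T_{i+1-n}+k$ for `Gam`. Let the grid point $(j,q)$ carry the value $T_j+kq$ and lie in
the row $j+(n-1)q$. Every inequality then joins neighbouring rows, and together they say that
consecutive rows interlace, as in a Gelfand–Tsetlin pattern.

At a vertex all partial sums are values of `bseq` (`IsVertex.exists_psum_eq_bseq`), so the grid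
points fall into levels indexed by $-n<c\le 0$. A tight inequality joins points of one level
(`atLevel_leftEnd_iff`). The vertex cone is cut out by the tight inequalities
(`IsVertex.mem_vertexCone_iff`), so its conditions split into independent conditions on the levels.
If no row contained two entries of positive index and equal level, the tight functionals would have
a dual system and the vertex would be simple. Hence at a non-simple vertex some level has two such
entries in one row (`IsVertex.exists_same_row`).

Fix this level. After the substitution the coordinates $T_j$ in one row have equal weights
(`stepWeight_eq`), so symmetrizing over permutations within rows only multiplies the result by a
nonzero integer. The symmetrized indicator of interlacing is a product of determinants of comparison
matrices (`sum_interlace_eq_prod_det`): only the sorted order can interlace, and the signs cancel.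
In the expansion of the determinants each term imposes comparisons only along disjoint paths. One
path starts at the constant entry of row 0; all variables off that path can be translated together.
Two variables in one row guarantee that there are some, so every term is periodic and contributes
zero (`RowSystem.numerator_interlaced_eq_zero`).

Individual terms are indicators of sets that may contain lines, so all series are multiplied by
`universalDenom`. This makes every tame function finitely supported (`Tame.admissible`), kills
periodic functions, is invariant under permutations, and stays nonzero under the substitution
(`weight_chi_ne_zero`). Thus every $\sigma^*(C_u^m)$ with $m\ge l_u$ is zero; the only character
expanding zero is zero, and so is the limit. -/

noncomputable section

namespace FSPolytope

/-! ### The action of Laurent polynomials on formal series -/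

section LaurentAction

variable {G : Type} [AddCommGroup G]

lemma laurentMul_eq_sum (p : LaurentPoly G) (s : G → ℂ) (x : G) :
    laurentMul p s x = p.coeff.sum fun y c => c * s (x - y) := rfl

@[simp] lemma laurentMul_zero_left (s : G → ℂ) : laurentMul 0 s = 0 := by
  funext x; simp [laurentMul_eq_sum]

lemma laurentMul_add_left (p q : LaurentPoly G) (s : G → ℂ) :
    laurentMul (p + q) s = laurentMul p s + laurentMul q s := by
  funext x
  simp only [laurentMul_eq_sum, Pi.add_apply, AddMonoidAlgebra.coeff_add]
  exact Finsupp.sum_add_index' (by simp) (by intros; ring)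

lemma laurentMul_single (y : G) (c : ℂ) (s : G → ℂ) (x : G) :
    laurentMul (AddMonoidAlgebra.single y c) s x = c * s (x - y) := by
  rw [laurentMul_eq_sum, AddMonoidAlgebra.coeff_single, Finsupp.sum_single_index (by simp)]

@[simp] lemma laurentMul_zero_right (p : LaurentPoly G) : laurentMul p 0 = 0 := by
  funext x; simp [laurentMul]

lemma laurentMul_add_right (p : LaurentPoly G) (s t : G → ℂ) :
    laurentMul p (s + t) = laurentMul p s + laurentMul p t := by
  funext x
  simp [laurentMul, mul_add, Finset.sum_add_distrib]

lemma laurentMul_mul (p q : LaurentPoly G) (s : G → ℂ) :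
    laurentMul (p * q) s = laurentMul p (laurentMul q s) := by
  induction p using AddMonoidAlgebra.induction_linear with
  | zero => simp
  | add p₁ p₂ h₁ h₂ => rw [add_mul, laurentMul_add_left, h₁, h₂, laurentMul_add_left]
  | single x c =>
    induction q using AddMonoidAlgebra.induction_linear with
    | zero => simp
    | add q₁ q₂ h₁ h₂ =>
      rw [mul_add, laurentMul_add_left, h₁, h₂, laurentMul_add_left, laurentMul_add_right]
    | single y d =>
      funext z
      rw [AddMonoidAlgebra.single_mul_single, laurentMul_single, laurentMul_single,
        laurentMul_single, sub_add_eq_sub_sub, mul_assoc]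

lemma laurentMul_one (s : G → ℂ) : laurentMul 1 s = s := by
  funext x
  rw [AddMonoidAlgebra.one_def, laurentMul_single]; simp

lemma laurentMul_toSeries (p q : LaurentPoly G) :
    laurentMul p (toSeries q) = toSeries (p * q) := by
  classical
  induction p using AddMonoidAlgebra.induction_linear with
  | zero => funext x; simp [toSeries]
  | add p₁ p₂ h₁ h₂ =>
    rw [add_mul, laurentMul_add_left, h₁, h₂]
    funext x; simp [toSeries]
  | single x c =>
    funext z
    rw [laurentMul_single]
    simp only [toSeries]
    rw [AddMonoidAlgebra.coeff_single_mul_eq_mul_coeff (z - x)]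
    intro m' _
    exact ⟨fun h => by rw [← h]; abel, fun h => by rw [h]; abel⟩

lemma toSeries_injective : Function.Injective (toSeries : LaurentPoly G → G → ℂ) := by
  intro p q h
  ext x
  exact congrFun h x

lemma laurentMul_one_sub_expo (α : G) (s : G → ℂ) (x : G) :
    laurentMul (1 - expo α) s x = s x - s (x - α) := by
  have h : (1 - expo α : LaurentPoly G) =
      AddMonoidAlgebra.single 0 1 + AddMonoidAlgebra.single α (-1) := by
    rw [expo, AddMonoidAlgebra.one_def, sub_eq_add_neg, ← AddMonoidAlgebra.single_neg]
  rw [h, laurentMul_add_left, Pi.add_apply, laurentMul_single, laurentMul_single]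
  simp [sub_eq_add_neg]

end LaurentAction

/-! ### Uniqueness of the substituted generating function -/

/-- Two annihilating pairs for the same series are proportional by commutativity of the action, so
the rational function does not depend on the chosen denominator. -/
lemma isSigma_cross {C : Set RSeq} {r : RatFun ZSeq} (hr : IsSigma C r) {θ f : LaurentPoly ZSeq}
    (h : laurentMul θ (genFun C) = toSeries f) :
    r * algebraMap _ (RatFun ZSeq) θ = algebraMap _ (RatFun ZSeq) f := by
  obtain ⟨θ', f', hθ', h', hr⟩ := hr
  have hcross : θ * f' = θ' * f := by
    apply toSeries_injective
    rw [← laurentMul_toSeries, ← laurentMul_toSeries, ← h, ← h', ← laurentMul_mul,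
      ← laurentMul_mul, mul_comm]
  have hne : algebraMap _ (RatFun ZSeq) θ' ≠ 0 := by
    simpa using hθ'
  apply mul_right_cancel₀ hne
  calc r * algebraMap _ (RatFun ZSeq) θ * algebraMap _ (RatFun ZSeq) θ'
      = (r * algebraMap _ (RatFun ZSeq) θ') * algebraMap _ (RatFun ZSeq) θ := by ring
    _ = algebraMap _ (RatFun ZSeq) (θ * f') := by rw [hr, map_mul, mul_comm]
    _ = algebraMap _ (RatFun ZSeq) f * algebraMap _ (RatFun ZSeq) θ' := by
        rw [hcross, map_mul, mul_comm]

/-- Cross-multiplication with the representation whose denominator survives. The given `d` may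
itself be sent to zero; the relation then merely becomes trivial or forces the image of `p` to
vanish. -/
lemma isSubst_cross {n : ℕ} {r : RatFun ZSeq} {s : RatFun (RootLattice n)} (hs : IsSubst n r s)
    {p d : LaurentPoly ZSeq}
    (h : r * algebraMap _ (RatFun ZSeq) d = algebraMap _ (RatFun ZSeq) p) :
    s * algebraMap _ (RatFun (RootLattice n)) (subst n d) =
      algebraMap _ (RatFun (RootLattice n)) (subst n p) := by
  obtain ⟨p', d', hd', hr, hs⟩ := hs
  have hcross : p * d' = p' * d := by
    apply IsFractionRing.injective (LaurentPoly ZSeq) (RatFun ZSeq)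
    rw [map_mul, map_mul, ← h, ← hr]; ring
  have hne : algebraMap _ (RatFun (RootLattice n)) (subst n d') ≠ 0 := by simpa using hd'
  apply mul_right_cancel₀ hne
  calc s * algebraMap _ (RatFun (RootLattice n)) (subst n d) *
        algebraMap _ (RatFun (RootLattice n)) (subst n d')
      = (s * algebraMap _ (RatFun (RootLattice n)) (subst n d')) *
        algebraMap _ (RatFun (RootLattice n)) (subst n d) := by ring
    _ = algebraMap _ (RatFun (RootLattice n)) (subst n (p' * d)) := by
        rw [hs, map_mul, map_mul]
    _ = _ := by rw [← hcross, map_mul, map_mul]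

/-- The generating function `f / θ` is sent to zero by the substitution as soon as `f` is and
`θ` is not. -/
lemma isSigmaStar_zero {n : ℕ} {C : Set RSeq} {θ f : LaurentPoly ZSeq}
    (h : laurentMul θ (genFun C) = toSeries f) (hθ : subst n θ ≠ 0) (hf : subst n f = 0) :
    IsSigmaStar n C 0 := by
  have hθ0 : θ ≠ 0 := by rintro rfl; simp at hθ
  have hne : algebraMap _ (RatFun ZSeq) θ ≠ 0 := by simpa using hθ0
  have hr : algebraMap _ (RatFun ZSeq) f / algebraMap _ (RatFun ZSeq) θ *
      algebraMap _ (RatFun ZSeq) θ = algebraMap _ (RatFun ZSeq) f := div_mul_cancel₀ _ hne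
  exact ⟨_, ⟨θ, f, hθ0, h, hr⟩, f, θ, hθ, hr, by simp [hf]⟩

lemma isSigmaStar_unique {n : ℕ} {C : Set RSeq} {s s' : RatFun (RootLattice n)}
    (hs : IsSigmaStar n C s) (hs' : IsSigmaStar n C s') : s = s' := by
  obtain ⟨r, hr, hs⟩ := hs
  obtain ⟨r', hr', hs'⟩ := hs'
  have hrr : r = r' := by
    obtain ⟨θ, f, hθ, h, h1⟩ := hr
    have hne : algebraMap _ (RatFun ZSeq) θ ≠ 0 := by simpa using hθ
    exact mul_right_cancel₀ hne (h1.trans (isSigma_cross hr' h).symm)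
  subst hrr
  obtain ⟨p, d, hd, h, h1⟩ := hs
  have hne : algebraMap _ (RatFun (RootLattice n)) (FSPolytope.subst n d) ≠ 0 := by simpa using hd
  exact mul_right_cancel₀ hne (h1.trans (isSubst_cross hs' h).symm)

/-! ### Expansions of zero -/

lemma IsRoot.ne_zero {n : ℕ} {β : RootLattice n} (hn : 2 ≤ n) (h : IsRoot n β) : β ≠ 0 := by
  rintro rfl
  rcases h with ⟨k, hk, h⟩ | ⟨k, i, j, hi, hij, h⟩
  · have := congrFun h ⟨0, by omega⟩
    simp [delta] at this
    exact hk this.symm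
  · have h0 : finRoot n i j ⟨0, by omega⟩ = 0 := by
      have : ¬ (i ≤ (⟨0, by omega⟩ : Fin n)) := by
        rw [Fin.le_def]; simp; omega
      simp [finRoot, this]
    have h1 : finRoot n i j i = 1 := by simp [finRoot, hij]
    rcases h with h | h <;>
    · have e0 := congrFun h ⟨0, by omega⟩
      have e1 := congrFun h i
      simp [delta, h0] at e0
      simp [h1, ← e0] at e1

lemma IsCharacter.laurentMul_one_sub_expo {n : ℕ} {τ : RootLattice n → ℂ} (h : IsCharacter n τ)
    (α : RootLattice n) : IsCharacter n (laurentMul (1 - expo α) τ) := by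
  classical
  obtain ⟨M, hM⟩ := h
  refine ⟨M ∪ M.image (· + α), fun β hβ => ?_⟩
  rw [FSPolytope.laurentMul_one_sub_expo] at hβ
  by_cases h1 : τ β = 0
  · have h2 : τ (β - α) ≠ 0 := by
      intro h2; simp [h1, h2] at hβ
    obtain ⟨μ, hμ, hle⟩ := hM _ h2
    exact ⟨μ + α, by simp [hμ], sub_le_iff_le_add.mp hle⟩
  · obtain ⟨μ, hμ, hle⟩ := hM _ h1
    exact ⟨μ, by simp [hμ], hle⟩

/-- Annihilation by `1 - expo α` means periodicity along `α`. From a point of the support one can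
move by multiples of `α` or of `-α` so that some coordinate grows without bound, leaving every
finite union of lower sets. -/
lemma IsCharacter.eq_zero_of_one_sub_expo {n : ℕ} {τ : RootLattice n → ℂ} (h : IsCharacter n τ)
    {α : RootLattice n} (hα : α ≠ 0) (h0 : laurentMul (1 - expo α) τ = 0) : τ = 0 := by
  obtain ⟨M, hM⟩ := h
  have hper : ∀ β, τ β = τ (β - α) := fun β => by
    have := congrFun h0 β
    rw [FSPolytope.laurentMul_one_sub_expo] at this
    exact sub_eq_zero.mp this
  have hper' : ∀ (k : ℕ) β, τ (β + k • α) = τ β := by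
    intro k
    induction k with
    | zero => simp
    | succ k ih =>
      intro β
      rw [hper, succ_nsmul, ← add_assoc, add_sub_cancel_right, ih]
  have hper'' : ∀ (k : ℕ) β, τ (β - k • α) = τ β := by
    intro k β
    rw [← hper' k (β - k • α)]; simp
  funext β
  by_contra hβ
  obtain ⟨l, hl⟩ : ∃ l, α l ≠ 0 := by
    by_contra hcon
    push Not at hcon
    exact hα (funext hcon)
  obtain ⟨c, hc⟩ : ∃ c : ℤ, ∀ μ ∈ M, μ l ≤ c := by
    obtain ⟨c, hc⟩ := (M.image fun μ => μ l).bddAbove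
    exact ⟨c, fun μ hμ => hc (by simpa using ⟨μ, hμ, rfl⟩)⟩
  have key : ∀ γ, τ γ ≠ 0 → γ l ≤ c := fun γ hγ => by
    obtain ⟨μ, hμ, hle⟩ := hM γ hγ
    exact (hle l).trans (hc μ hμ)
  set k : ℕ := (c - β l).toNat + 1 with hk
  have hk' : c - β l < k := by
    have := Int.self_le_toNat (c - β l)
    push_cast [hk]; omega
  rcases lt_or_gt_of_ne hl with h | h
  · have := key (β - k • α) (by rw [hper'']; exact hβ)
    simp at this
    nlinarith
  · have := key (β + k • α) (by rw [hper']; exact hβ)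
    simp at this
    nlinarith

lemma IsCharacter.eq_zero_of_prod {n : ℕ} {τ : RootLattice n → ℂ} (h : IsCharacter n τ)
    (A : Multiset (RootLattice n)) (hA : ∀ α ∈ A, α ≠ 0)
    (h0 : laurentMul (A.map fun α => 1 - expo α).prod τ = 0) : τ = 0 := by
  induction A using Multiset.induction_on generalizing τ with
  | empty => simpa [laurentMul_one] using h0
  | cons α A ih =>
    rw [Multiset.map_cons, Multiset.prod_cons, mul_comm, laurentMul_mul] at h0
    exact h.eq_zero_of_one_sub_expo (hA α (by simp))
      (ih (h.laurentMul_one_sub_expo α) (fun β hβ => hA β (by simp [hβ])) h0)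

lemma IsExpansion.eq_zero {n : ℕ} (hn : 2 ≤ n) {τ : RootLattice n → ℂ}
    (h : IsExpansion n 0 τ) : τ = 0 := by
  obtain ⟨hτ, A, f, hA, h1, h2⟩ := h
  have hf : f = 0 := by simpa using h1.symm
  apply hτ.eq_zero_of_prod A fun α hα => (hA α hα).ne_zero hn
  rw [h2, hf]; rfl

lemma isExpansion_zero (n : ℕ) : IsExpansion n 0 0 :=
  ⟨⟨∅, fun β hβ => absurd rfl hβ⟩, 0, 0, by simp, by simp, by rw [laurentMul_zero_right]; rfl⟩

/-- If all sections of the vertex cone have vanishing `σ*`, then the contribution is zero. -/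
lemma isContribution_iff_of_isSigmaStar_zero {n : ℕ} (hn : 2 ≤ n) {a : Fin n → ℕ} {u : RSeq}
    (h : ∀ m, lastGamma n a u ≤ m → IsSigmaStar n (coneSection n a u m) 0)
    (τ : RootLattice n → ℂ) : IsContribution n a u τ ↔ τ = 0 := by
  constructor
  · rintro ⟨-, t, ht, hlim⟩
    funext β
    obtain ⟨m, hm, hm'⟩ :=
      ((hlim β).and (Filter.eventually_ge_atTop (lastGamma n a u))).exists
    obtain ⟨s, hs, he⟩ := ht m hm'
    rw [isSigmaStar_unique hs (h m hm')] at he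
    rw [← hm, he.eq_zero hn]
  · rintro rfl
    exact ⟨⟨∅, fun β hβ => absurd rfl hβ⟩, fun _ => 0, fun m hm => ⟨0, h m hm, isExpansion_zero n⟩,
      fun β => Filter.Eventually.of_forall fun _ => rfl⟩

/-! ### A functional on tame functions of lattice points -/

section LaurentMap

variable {G H : Type} [AddCommGroup G] [AddCommGroup H]

lemma laurentMul_mapDomain (φ : G →+ H) (p : LaurentPoly G) (s : H → ℂ) (x : G) :
    laurentMul (AddMonoidAlgebra.mapDomainRingHom ℂ φ p) s (φ x) =
      laurentMul p (fun y => s (φ y)) x := by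
  induction p using AddMonoidAlgebra.induction_linear with
  | zero => simp
  | add p q hp hq =>
    rw [map_add, laurentMul_add_left, laurentMul_add_left, Pi.add_apply, Pi.add_apply, hp, hq]
  | single y c =>
    rw [AddMonoidAlgebra.mapDomainRingHom_apply, AddMonoidAlgebra.mapDomain_single,
      laurentMul_single, laurentMul_single, map_sub]

lemma laurentMul_mapDomain_of_notMem (φ : G →+ H) (p : LaurentPoly G) {s : H → ℂ}
    (hs : ∀ y, y ∉ Set.range φ → s y = 0) {x : H} (hx : x ∉ Set.range φ) :
    laurentMul (AddMonoidAlgebra.mapDomainRingHom ℂ φ p) s x = 0 := by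
  induction p using AddMonoidAlgebra.induction_linear with
  | zero => simp
  | add p q hp hq =>
    rw [map_add, laurentMul_add_left, Pi.add_apply, hp, hq, add_zero]
  | single y c =>
    rw [AddMonoidAlgebra.mapDomainRingHom_apply, AddMonoidAlgebra.mapDomain_single,
      laurentMul_single, hs, mul_zero]
    rintro ⟨z, hz⟩
    exact hx ⟨z + y, by rw [map_add, hz]; abel⟩

lemma laurentMul_sub_const (p : LaurentPoly G) (s : G → ℂ) (c x : G) :
    laurentMul p (fun y => s (y - c)) x = laurentMul p s (x - c) := by
  simp only [laurentMul_eq_sum, sub_right_comm]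

end LaurentMap

section Chi

variable {J : Type} [DecidableEq J]

/-- The indicator vector of a set of indices. -/
def chi (A : Finset J) : J → ℤ := fun j => if j ∈ A then 1 else 0

end Chi

/-! ### Numerators over the universal denominator. -/

section Numerator

variable {J : Type} [Fintype J] [DecidableEq J]

variable (J) in
/-- The product of the factors `1 - exp (chi A)` over all nonempty `A`. -/
def universalDenom : LaurentPoly (J → ℤ) :=
  ∏ A ∈ (Finset.univ : Finset (Finset J)) with A.Nonempty, (1 - expo (chi A))

/-- `s` is admissible if its product with the universal denominator is a Laurent polynomial. -/
def Admissible (s : (J → ℤ) → ℂ) : Prop :=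
  (Function.support (laurentMul (universalDenom J) s)).Finite

/-- The image under `w` of the product of `s` with the universal denominator. -/
def numerator {X : Type} [AddCommGroup X] (w : (J → ℤ) →+ X) (s : (J → ℤ) → ℂ) : LaurentPoly X :=
  ∑ᶠ T, AddMonoidAlgebra.single (w T) (laurentMul (universalDenom J) s T)

variable {X : Type} [AddCommGroup X] {w : (J → ℤ) →+ X}

lemma Admissible.finite_support {s : (J → ℤ) → ℂ} (hs : Admissible s) (w : (J → ℤ) →+ X) :
    (Function.support fun T =>
      AddMonoidAlgebra.single (w T) (laurentMul (universalDenom J) s T)).Finite := by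
  refine hs.subset fun T hT h => hT ?_
  simp [h]

lemma admissible_zero : Admissible (0 : (J → ℤ) → ℂ) := by
  simp [Admissible]

lemma numerator_zero : numerator w 0 = 0 := by
  simp [numerator]

lemma Admissible.add {s t : (J → ℤ) → ℂ} (hs : Admissible s) (ht : Admissible t) :
    Admissible (s + t) := by
  rw [Admissible, laurentMul_add_right]
  exact (hs.union ht).subset (Function.support_add _ _)

lemma numerator_add {s t : (J → ℤ) → ℂ} (hs : Admissible s) (ht : Admissible t) :
    numerator w (s + t) = numerator w s + numerator w t := by
  rw [numerator, numerator, numerator,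
    ← finsum_add_distrib (hs.finite_support w) (ht.finite_support w)]
  refine finsum_congr fun T => ?_
  rw [laurentMul_add_right, Pi.add_apply, AddMonoidAlgebra.single_add]

lemma admissible_sum {ι : Type*} (B : Finset ι) {s : ι → (J → ℤ) → ℂ}
    (hs : ∀ i ∈ B, Admissible (s i)) : Admissible (∑ i ∈ B, s i) :=
  Finset.sum_induction _ _ (fun _ _ => Admissible.add) admissible_zero hs

lemma numerator_sum {ι : Type*} (B : Finset ι) {s : ι → (J → ℤ) → ℂ}
    (hs : ∀ i ∈ B, Admissible (s i)) :
    numerator w (∑ i ∈ B, s i) = ∑ i ∈ B, numerator w (s i) := by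
  classical
  induction B using Finset.induction_on with
  | empty => simp [numerator_zero]
  | insert i B hi ih =>
    rw [Finset.sum_insert hi, Finset.sum_insert hi, numerator_add (hs i (by simp))
      (admissible_sum _ fun j hj => hs j (by simp [hj])), ih fun j hj => hs j (by simp [hj])]

/-- One factor of the universal denominator is the difference operator along `chi A`, which kills a
function with period `chi A`. -/
lemma laurentMul_universalDenom_eq_zero {s : (J → ℤ) → ℂ} {A : Finset J} (hA : A.Nonempty)
    (h : ∀ T, s (T - chi A) = s T) : laurentMul (universalDenom J) s = 0 := by
  rw [universalDenom, ← Finset.prod_erase_mul _ _ (show A ∈ _ by simp [hA]), laurentMul_mul]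
  have : laurentMul (1 - expo (chi A)) s = 0 := by
    funext T
    rw [laurentMul_one_sub_expo, h, sub_self]; rfl
  rw [this, laurentMul_zero_right]

lemma numerator_eq_zero_of_periodic {s : (J → ℤ) → ℂ} {A : Finset J} (hA : A.Nonempty)
    (h : ∀ T, s (T - chi A) = s T) : numerator w s = 0 := by
  simp [numerator, laurentMul_universalDenom_eq_zero hA h]

/-- Precomposition with a permutation of the indices. -/
def permHom (π : Equiv.Perm J) : (J → ℤ) →+ (J → ℤ) where
  toFun T := T ∘ π
  map_zero' := rfl
  map_add' _ _ := rfl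

/-- A permutation of the indices permutes the nonempty subsets, hence the factors. -/
lemma mapDomain_permHom_universalDenom (π : Equiv.Perm J) :
    AddMonoidAlgebra.mapDomainRingHom ℂ (permHom π) (universalDenom J) = universalDenom J := by
  rw [universalDenom, map_prod]
  refine Finset.prod_equiv (Equiv.finsetCongr π.symm) (by simp) fun A _ => ?_
  rw [map_sub, map_one, expo, AddMonoidAlgebra.mapDomainRingHom_apply,
    AddMonoidAlgebra.mapDomain_single, expo]
  congr 3
  funext j
  simp [permHom, chi]

lemma laurentMul_universalDenom_perm (π : Equiv.Perm J) (s : (J → ℤ) → ℂ) (T : J → ℤ) :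
    laurentMul (universalDenom J) (fun T => s (T ∘ π)) T =
      laurentMul (universalDenom J) s (T ∘ π) := by
  have := laurentMul_mapDomain (permHom π) (universalDenom J) s T
  rw [mapDomain_permHom_universalDenom] at this
  exact this.symm

/-- Precomposition with a permutation of the indices as a bijection. -/
def permEquiv (π : Equiv.Perm J) : (J → ℤ) ≃ (J → ℤ) where
  toFun T := T ∘ π
  invFun T := T ∘ π.symm
  left_inv T := by funext j; simp
  right_inv T := by funext j; simp

lemma Admissible.perm {s : (J → ℤ) → ℂ} (hs : Admissible s) (π : Equiv.Perm J) :
    Admissible fun T => s (T ∘ π) := by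
  have := hs.preimage (f := permEquiv π) (permEquiv π).injective.injOn
  refine this.subset fun T hT => ?_
  rw [Function.mem_support, laurentMul_universalDenom_perm] at hT
  exact hT

lemma numerator_perm {π : Equiv.Perm J} (hπ : ∀ T, w (T ∘ π) = w T) (s : (J → ℤ) → ℂ) :
    numerator w (fun T => s (T ∘ π)) = numerator w s := by
  refine Eq.trans (finsum_congr fun T => ?_) (finsum_comp_equiv (permEquiv π))
  rw [laurentMul_universalDenom_perm]
  simp [permEquiv, hπ]

lemma Admissible.sub_const {s : (J → ℤ) → ℂ} (hs : Admissible s) (c : J → ℤ) :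
    Admissible fun T => s (T - c) := by
  have := hs.preimage (f := fun T => T - c) (sub_left_injective.injOn)
  refine this.subset fun T hT => ?_
  rw [Function.mem_support, laurentMul_sub_const] at hT
  exact hT

lemma numerator_sub_const {s : (J → ℤ) → ℂ} (hs : Admissible s) (c : J → ℤ) :
    numerator w (fun T => s (T - c)) = expo (w c) * numerator w s := by
  rw [numerator, numerator]
  refine ((finsum_comp_equiv (Equiv.addRight c)).symm.trans (finsum_congr fun T => ?_)).trans
    ((AddMonoidHom.mulLeft (expo (w c))).map_finsum (hs.finite_support w)).symm
  rw [laurentMul_sub_const, AddMonoidHom.coe_mulLeft, expo, AddMonoidAlgebra.single_mul_single]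
  simp [add_comm]

/-- The bridge from numerators to `σ*`: the generating function is `f / θ` with `θ` the universal
denominator carried along `ι` and `f` the numerator. By `hw` each factor of `θ` goes to `1 - exp` of
a nonzero weight, so `θ` survives the substitution, while `h0` says that `f` does not. -/
lemma isSigmaStar_zero_of_numerator {n : ℕ} {C : Set RSeq} (ι : (J → ℤ) →+ ZSeq)
    (hι : Function.Injective ι) (hC : ∀ x, toReal x ∈ C → x ∈ Set.range ι)
    (hadm : Admissible fun T => genFun C (ι T))
    (hw : ∀ A : Finset J, A.Nonempty → weight n (ι (chi A)) ≠ 0)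
    (h0 : numerator ((weight n).comp ι) (fun T => genFun C (ι T)) = 0) :
    IsSigmaStar n C 0 := by
  refine isSigmaStar_zero (θ := AddMonoidAlgebra.mapDomainRingHom ℂ ι (universalDenom J))
    (f := numerator ι fun T => genFun C (ι T)) ?_ ?_ ?_
  · have hgen : ∀ y, y ∉ Set.range ι → genFun C y = 0 := fun y hy => by
      rw [genFun, if_neg fun h => hy (hC y h)]
    have hcoeff : ∀ x, (numerator ι fun T => genFun C (ι T)).coeff x =
        ∑ᶠ T, (Finsupp.single (ι T)
          (laurentMul (universalDenom J) (fun T => genFun C (ι T)) T)) x := fun x => by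
      let ev : LaurentPoly ZSeq →+ ℂ :=
        (Finsupp.applyAddHom x).comp (AddMonoidAlgebra.coeffAddEquiv.toAddMonoidHom)
      exact ev.map_finsum (hadm.finite_support ι)
    funext x
    rw [toSeries, hcoeff]
    by_cases hx : x ∈ Set.range ι
    · obtain ⟨T, rfl⟩ := hx
      rw [laurentMul_mapDomain, finsum_eq_single _ T]
      · simp
      · intro T' hT'
        exact Finsupp.single_eq_of_ne fun h => hT' (hι h.symm)
    · rw [laurentMul_mapDomain_of_notMem ι _ hgen hx, eq_comm]
      refine finsum_eq_zero_of_forall_eq_zero fun T => ?_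
      exact Finsupp.single_eq_of_ne fun h => hx ⟨T, h.symm⟩
  · rw [universalDenom, map_prod, map_prod, Finset.prod_ne_zero_iff]
    intro A hA
    rw [map_sub, map_one, map_sub, map_one, sub_ne_zero]
    intro h
    have := congrArg (fun p => p.coeff 0) h
    simp only [AddMonoidAlgebra.mapDomainRingHom_apply, expo, AddMonoidAlgebra.mapDomain_single,
      subst, AddMonoidAlgebra.one_def, AddMonoidAlgebra.coeff_single, Finsupp.single_eq_same] at this
    rw [Finsupp.single_eq_of_ne (hw A (by simpa using hA)).symm] at this
    exact one_ne_zero this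
  · rw [← h0, numerator, numerator]
    refine ((subst n).toAddMonoidHom.map_finsum (hadm.finite_support ι)).trans
      (finsum_congr fun T => ?_)
    simp [subst]

end Numerator

/-! ### Tame functions are admissible -/

section Tame

variable {J : Type}

/-- The entries of `f` with index in `A` exceed zero and all other entries by at least `K`. -/
def GapAbove (K : ℤ) (A : Finset J) (f : J → ℤ) : Prop :=
  ∀ i ∈ A, K ≤ f i ∧ ∀ j, j ∉ A → K ≤ f i - f j

/-- The entries with index in `A` are separated by at least `K` from zero and from the others. -/
def Gap (K : ℤ) (A : Finset J) (f : J → ℤ) : Prop := GapAbove K A f ∨ GapAbove K A (-f)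

lemma Gap.mono {K K' : ℤ} (h : K ≤ K') {A : Finset J} {f : J → ℤ} (hf : Gap K' A f) : Gap K A f :=
  hf.imp (fun hf i hi => ⟨h.trans (hf i hi).1, fun j hj => h.trans ((hf i hi).2 j hj)⟩)
    (fun hf i hi => ⟨h.trans (hf i hi).1, fun j hj => h.trans ((hf i hi).2 j hj)⟩)

variable [DecidableEq J]

/-- Functions that do not change under shifts of far separated groups of entries. -/
def Tame {α : Type*} (f : (J → ℤ) → α) : Prop :=
  ∃ K, ∀ A T, Gap K A T → f (T - chi A) = f T

lemma tame_const {α : Type*} (c : α) : Tame fun _ : J → ℤ => c := ⟨0, fun _ _ _ => rfl⟩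

lemma Tame.comp {α β : Type*} {f : (J → ℤ) → α} (hf : Tame f) (g : α → β) :
    Tame fun T => g (f T) := by
  obtain ⟨K, hK⟩ := hf
  exact ⟨K, fun A T h => congrArg g (hK A T h)⟩

lemma tame_pi {ι : Type*} [Finite ι] {α : ι → Type*} {f : ∀ i, (J → ℤ) → α i}
    (hf : ∀ i, Tame (f i)) : Tame fun T i => f i T := by
  choose K hK using hf
  obtain ⟨M, hM⟩ := Set.finite_range K |>.bddAbove
  exact ⟨M, fun A T h => funext fun i => hK i A T (h.mono (hM ⟨i, rfl⟩))⟩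

lemma Tame.comp₂ {α β γ : Type*} {f : (J → ℤ) → α} {g : (J → ℤ) → β} (hf : Tame f)
    (hg : Tame g) (h : α → β → γ) : Tame fun T => h (f T) (g T) := by
  obtain ⟨K, hK⟩ := hf
  obtain ⟨K', hK'⟩ := hg
  exact ⟨max K K', fun A T hT => by
    simp only [hK A T (hT.mono (le_max_left _ _)), hK' A T (hT.mono (le_max_right _ _))]⟩

lemma tame_le_const (i : J) (c : ℤ) : Tame fun T : J → ℤ => T i ≤ c := by
  -- Shifting by one alters the comparison only at `T i = c + 1`; the margin keeps `T i` away from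
  -- this value on either side.
  refine ⟨|c| + 2, fun A T h => propext ?_⟩
  have := abs_le.mp (le_refl |c|)
  by_cases hi : i ∈ A
  · rcases h with h | h
    · have := (h i hi).1
      simp [chi, hi]; omega
    · have := (h i hi).1
      simp [chi, hi] at this ⊢; omega
  · simp [chi, hi]

lemma tame_const_le (i : J) (c : ℤ) : Tame fun T : J → ℤ => c ≤ T i := by
  have := (tame_le_const i (c - 1)).comp Not
  refine (congrArg Tame ?_).mp this
  funext T
  exact propext ⟨fun h => by omega, fun h => by omega⟩

lemma tame_sub_le (i j : J) (c : ℤ) : Tame fun T : J → ℤ => T i - T j ≤ c := by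
  refine ⟨|c| + 2, fun A T h => propext ?_⟩
  have := abs_le.mp (le_refl |c|)
  by_cases hi : i ∈ A <;> by_cases hj : j ∈ A
  · simp [chi, hi, hj]
  · rcases h with h | h
    · have := (h i hi).2 j hj
      simp [chi, hi, hj]; omega
    · have := (h i hi).2 j hj
      simp [chi, hi, hj] at this ⊢; omega
  · rcases h with h | h
    · have := (h j hj).2 i hi
      simp [chi, hi, hj]; omega
    · have := (h j hj).2 i hi
      simp [chi, hi, hj] at this ⊢; omega
  · simp [chi, hi, hj]

end Tame

/-! ### Far separated groups of entries and finiteness of supports. -/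

section Finite

variable {J : Type} [Fintype J]

/-- Pigeonhole: there are more intervals `(t K, (t + 1) K)` than entries, so one of them is free of
entries, and the entries above it form the group. The large entry `f i` makes the group nonempty. -/
lemma exists_gapAbove {K : ℤ} (hK : 0 < K) {f : J → ℤ} {i : J}
    (hi : (Fintype.card J + 1) * K ≤ f i) : ∃ A : Finset J, A.Nonempty ∧ GapAbove K A f := by
  by_contra hcon
  push Not at hcon
  have key : ∀ t : Fin (Fintype.card J + 1), ∃ j, t * K < f j ∧ f j < (t + 1) * K := by
    intro t
    by_contra ht
    push Not at ht
    have htc : (t : ℤ) ≤ Fintype.card J := by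
      have := t.2
      omega
    have ht0 : (0 : ℤ) ≤ t := by positivity
    have htK : 0 ≤ t * K := by positivity
    refine hcon (Finset.univ.filter fun j => t * K < f j) ⟨i, ?_⟩ fun j hj => ?_
    · simp only [Finset.mem_filter, Finset.mem_univ, true_and]
      nlinarith
    · simp only [Finset.mem_filter, Finset.mem_univ, true_and] at hj ⊢
      have h1 := ht j hj
      exact ⟨by nlinarith, fun l hl => by nlinarith⟩
  choose g hg using key
  have hinj : Function.Injective g := by
    intro t t' h
    have h1 := hg t
    have h2 := hg t'
    rw [h] at h1
    have h3 : (t : ℤ) * K < (t' + 1) * K := h1.1.trans h2.2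
    have h4 : (t' : ℤ) * K < (t + 1) * K := h2.1.trans h1.2
    have h5 := lt_of_mul_lt_mul_right h3 hK.le
    have h6 := lt_of_mul_lt_mul_right h4 hK.le
    apply Fin.ext
    omega
  have := Fintype.card_le_of_injective g hinj
  simp at this

lemma finite_setOf_forall_not_gap (K : ℤ) :
    {T : J → ℤ | ∀ A : Finset J, A.Nonempty → ¬ Gap K A T}.Finite := by
  set K' : ℤ := |K| + 1
  have hK' : 0 < K' := by positivity
  have hKK : K ≤ K' := (le_abs_self K).trans (by simp [K'])
  set c : ℤ := (Fintype.card J + 1) * K'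
  refine (Set.Finite.pi' fun _ : J => Set.finite_Icc (-c) c).subset fun T hT i => ?_
  constructor
  · by_contra h
    obtain ⟨A, hA, hg⟩ := exists_gapAbove hK' (f := -T) (i := i) (by
      simp only [Pi.neg_apply]; change c ≤ _; omega)
    exact hT A hA (Gap.mono hKK (Or.inr hg))
  · by_contra h
    obtain ⟨A, hA, hg⟩ := exists_gapAbove hK' (f := T) (i := i) (by
      change c ≤ _; omega)
    exact hT A hA (Gap.mono hKK (Or.inl hg))

variable [DecidableEq J]

/-- Away from a finite set some group `A` is far separated. There the factor of `A` already kills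
`s`, even after the bounded displacements caused by the other factors. -/
lemma Tame.admissible {s : (J → ℤ) → ℂ} (hs : Tame s) : Admissible s := by
  obtain ⟨K, hK⟩ := hs
  let D : Finset J → LaurentPoly (J → ℤ) := fun A =>
    ∏ B ∈ (Finset.univ.filter fun A : Finset J => A.Nonempty).erase A, (1 - expo (chi B))
  obtain ⟨N, hN⟩ : ∃ N : ℤ, ∀ A, ∀ y ∈ (D A).coeff.support, ∀ j, |y j| ≤ N := by
    obtain ⟨N, hN⟩ := ((Finset.univ : Finset (Finset J)).biUnion fun A =>
      (D A).coeff.support.biUnion fun y => Finset.univ.image fun j => |y j|).bddAbove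
    refine ⟨N, fun A y hy j => hN ?_⟩
    simp only [Finset.coe_biUnion, Set.mem_iUnion, Finset.mem_coe, Finset.mem_image]
    exact ⟨A, by simp, y, hy, j, by simp⟩
  -- The remaining factors displace each entry by at most `N`, so differences of entries change by
  -- at most `2 * N`.
  refine (finite_setOf_forall_not_gap (J := J) (K + 2 * N)).subset fun T hT A hA hgap => hT ?_
  rw [universalDenom, ← Finset.prod_erase_mul _ _ (show A ∈ _ by simp [hA]), laurentMul_mul]
  refine Finset.sum_eq_zero fun y hy => ?_
  rw [laurentMul_one_sub_expo, hK A, sub_self, mul_zero]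
  have hy' : ∀ j, -N ≤ y j ∧ y j ≤ N := fun j => abs_le.mp (hN A y hy j)
  refine hgap.imp (fun h i hi => ?_) (fun h i hi => ?_)
  · have h0 := hy' i
    refine ⟨?_, fun j hj => ?_⟩
    · have := (h i hi).1
      simp only [Pi.sub_apply]; omega
    · have := (h i hi).2 j hj
      have h1 := hy' j
      simp only [Pi.sub_apply]; omega
  · have h0 := hy' i
    refine ⟨?_, fun j hj => ?_⟩
    · have := (h i hi).1
      simp only [Pi.sub_apply, Pi.neg_apply] at this ⊢; omega
    · have := (h i hi).2 j hj
      have h1 := hy' j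
      simp only [Pi.sub_apply, Pi.neg_apply] at this ⊢; omega

end Finite

/-! ### Determinants counting interlacing sequences -/

section StepMatrix

variable {K : Type*} [LinearOrder K] {N : ℕ}

open Classical in
/-- The matrix of comparisons of two sequences. -/
def stepMatrix (x y : Fin N → K) : Matrix (Fin N) (Fin N) ℂ :=
  Matrix.of fun i j => if x i ≤ y j then 1 else 0

/-- The chain `x 0 ≤ y 0 < x 1 ≤ y 1 < ⋯`. -/
def Interlace (x y : Fin N → K) : Prop := (∀ i, x i ≤ y i) ∧ ∀ i j, i < j → y i < x j

lemma Interlace.strictMono_left {x y : Fin N → K} (h : Interlace x y) : StrictMono x :=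
  fun i j hij => (h.1 i).trans_lt (h.2 i j hij)

lemma Interlace.strictMono_right {x y : Fin N → K} (h : Interlace x y) : StrictMono y :=
  fun i j hij => (h.2 i j hij).trans_le (h.1 j)

lemma det_stepMatrix_comp (x y : Fin N → K) (σ τ : Equiv.Perm (Fin N)) :
    (stepMatrix (x ∘ σ) (y ∘ τ)).det =
      ((Equiv.Perm.sign σ : ℤ) : ℂ) * ((Equiv.Perm.sign τ : ℤ) : ℂ) * (stepMatrix x y).det := by
  have h : stepMatrix (x ∘ σ) (y ∘ τ) = ((stepMatrix x y).submatrix σ id).submatrix id τ := rfl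
  rw [h, Matrix.det_permute', Matrix.det_permute]
  ring

lemma injective_left_of_det_stepMatrix_ne_zero {x y : Fin N → K}
    (h : (stepMatrix x y).det ≠ 0) : Function.Injective x := by
  intro i j hij
  by_contra hne
  exact h (Matrix.det_zero_of_row_eq hne (by funext l; simp [stepMatrix, hij]))

lemma injective_right_of_det_stepMatrix_ne_zero {x y : Fin N → K}
    (h : (stepMatrix x y).det ≠ 0) : Function.Injective y := by
  intro i j hij
  by_contra hne
  exact h (Matrix.det_zero_of_column_eq hne (by intro l; simp [stepMatrix, hij]))

/-- Frobenius–König: a permutation avoiding the block would inject `Q` into the complement of `P`,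
which is too small. So every term of the Leibniz expansion vanishes. -/
lemma det_eq_zero_of_zero_block {M : Matrix (Fin N) (Fin N) ℂ} {P Q : Finset (Fin N)}
    (h : ∀ i ∈ P, ∀ j ∈ Q, M i j = 0) (hPQ : N < P.card + Q.card) : M.det = 0 := by
  rw [Matrix.det_apply]
  refine Finset.sum_eq_zero fun σ _ => ?_
  obtain ⟨j, hj, hσ⟩ : ∃ j ∈ Q, σ j ∈ P := by
    by_contra hcon
    push Not at hcon
    have hsub : Q.map σ.toEmbedding ⊆ Pᶜ := by
      intro i hi
      obtain ⟨j, hj, rfl⟩ := Finset.mem_map.mp hi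
      exact Finset.mem_compl.mpr (hcon j hj)
    have := Finset.card_le_card hsub
    rw [Finset.card_map, Finset.card_compl, Fintype.card_fin] at this
    have := P.card_le_univ
    rw [Fintype.card_fin] at this
    omega
  have h0 : ∏ i, M (σ i) i = 0 := Finset.prod_eq_zero (Finset.mem_univ j) (h _ hσ _ hj)
  exact (congrArg _ h0).trans (smul_zero _)

open Classical in
-- For interlacing sequences the matrix is upper triangular with unit diagonal. Otherwise one
-- violated inequality spreads by monotonicity to a block too large for a nonzero determinant: a
-- block of zeros if `y i < x i`, and a block of ones if `x j ≤ y i` with `i < j`, which turns into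
-- zeros on subtracting the column `i` from the later ones.
lemma det_stepMatrix_of_strictMono {x y : Fin N → K} (hx : StrictMono x) (hy : StrictMono y) :
    (stepMatrix x y).det = if Interlace x y then 1 else 0 := by
  split_ifs with h
  · rw [Matrix.det_of_isUpperTriangular]
    · exact Finset.prod_eq_one fun i _ => by simp [stepMatrix, h.1 i]
    · intro i j hij
      simp [stepMatrix, h.2 j i hij]
  · rw [Interlace, not_and_or] at h
    push Not at h
    rcases h with ⟨i, hi⟩ | ⟨i, j, hij, hle⟩
    · refine det_eq_zero_of_zero_block (P := Finset.Ici i) (Q := Finset.Iic i) ?_ ?_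
      · intro i' hi' j' hj'
        have h1 := hx.monotone (Finset.mem_Ici.mp hi')
        have h2 := hy.monotone (Finset.mem_Iic.mp hj')
        simp [stepMatrix, h2.trans_lt (hi.trans_le h1)]
      · rw [Fin.card_Ici, Fin.card_Iic]; omega
    · let B : Matrix (Fin N) (Fin N) ℂ := Matrix.of fun i' j' =>
        if i < j' then stepMatrix x y i' j' - stepMatrix x y i' i else stepMatrix x y i' j'
      have hB : (stepMatrix x y).det = B.det := by
        rw [← Matrix.det_transpose, ← Matrix.det_transpose B]
        refine Matrix.det_eq_of_forall_row_eq_smul_add_const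
          (fun j' => if i < j' then 1 else 0) i (by simp) fun j' i' => ?_
        by_cases h : i < j' <;> simp [B, h]
      rw [hB]
      refine det_eq_zero_of_zero_block (P := Finset.Iic j) (Q := Finset.Ioi i) ?_ ?_
      · intro i' hi' j' hj'
        have h1 := hx.monotone (Finset.mem_Iic.mp hi')
        have h2 := hy (Finset.mem_Ioi.mp hj')
        have h3 := h1.trans hle
        simp [B, stepMatrix, Finset.mem_Ioi.mp hj', h3, h3.trans h2.le]
      · rw [Fin.card_Iic, Fin.card_Ioi]
        have : (i : ℕ) < j := hij
        omega

lemma interlace_of_succ {x y : ℕ → K} (h1 : ∀ i < N, x i ≤ y i)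
    (h2 : ∀ i, i + 1 < N → y i < x (i + 1)) :
    Interlace (fun i : Fin N => x i) (fun i : Fin N => y i) := by
  refine ⟨fun i => h1 i i.2, fun i j hij => ?_⟩
  have key : ∀ d : ℕ, i + 1 + d < N → y i < x (i + 1 + d) := by
    intro d
    induction d with
    | zero => exact h2 i
    | succ d ih =>
      intro hd
      exact (ih (by omega)).trans_le ((h1 _ (by omega)).trans (h2 (i + 1 + d) (by omega)).le)
  have hij' : (i : ℕ) < j := hij
  have := key (j - i - 1) (by omega)
  rwa [show (i : ℕ) + 1 + (j - i - 1) = j by omega] at this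

/-- Sorting a sequence with monotone first components does not move the entries in places where
the second component is known to be increasing. -/
lemma sort_apply_eq_self {lev v : Fin N → ℤ} (hlev : Monotone lev) {σ : Equiv.Perm (Fin N)}
    (hσ : StrictMono fun i => toLex (lev (σ i), v (σ i))) {c : ℤ}
    (hv : ∀ i, lev i = c → v i = (i : ℕ)) {i : Fin N} (hi : lev i = c) : σ i = i := by
  have hlevσ : ∀ i, lev (σ i) = lev i := by
    have hmono : Monotone (lev ∘ σ) := fun i j hij => by
      have := hσ.monotone hij
      rw [Prod.Lex.toLex_le_toLex] at this
      rcases this with h | h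
      · exact h.le
      · exact h.1.le
    exact congrFun (Tuple.unique_monotone (f := lev) (σ := σ) (τ := 1) hmono hlev)
  -- The sorting permutation on the level `c`, continued by the identity, is a strictly increasing
  -- self-map of `Fin N`, and the only such map is the identity.
  have hf : StrictMono fun i => if lev i = c then σ i else i := by
    intro i j hij
    have hσij := hσ hij
    have hle := hlev hij.le
    by_cases hi : lev i = c <;> by_cases hj : lev j = c
    · simp only [hi, hj, if_true]
      simp only [Prod.Lex.toLex_lt_toLex, hlevσ, hi, hj, lt_irrefl, true_and, false_or] at hσij
      rw [hv _ ((hlevσ i).trans hi), hv _ ((hlevσ j).trans hj)] at hσij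
      exact_mod_cast hσij
    · simp only [hi, hj, if_true, if_false]
      by_contra hcon
      have := hlev (not_lt.mp hcon)
      rw [hlevσ] at this
      omega
    · simp only [hi, hj, if_true, if_false]
      by_contra hcon
      have := hlev (not_lt.mp hcon)
      rw [hlevσ] at this
      omega
    · simpa only [hi, hj, if_false] using hij
  have := congrFun (hf.eq_id) i
  simpa [hi] using this

/-- The sign of each intermediate row occurs in two consecutive factors, and the two end rows carry
the identity. -/
lemma prod_sign_eq_one {R : ℕ} {g : ℕ → Equiv.Perm (Fin N)} (h0 : g 0 = 1) (hR : g R = 1) :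
    ∏ r ∈ Finset.range R, (((Equiv.Perm.sign (g r) : ℤ) : ℂ) *
      ((Equiv.Perm.sign (g (r + 1)) : ℤ) : ℂ)) = 1 := by
  have key : ∀ R, ∏ r ∈ Finset.range R, (((Equiv.Perm.sign (g r) : ℤ) : ℂ) *
      ((Equiv.Perm.sign (g (r + 1)) : ℤ) : ℂ)) = ((Equiv.Perm.sign (g R) : ℤ) : ℂ) := by
    intro R
    induction R with
    | zero => simp [h0]
    | succ R ih =>
      rw [Finset.prod_range_succ, ih, ← mul_assoc]
      rcases Int.units_eq_one_or (Equiv.Perm.sign (g R)) with h | h <;> simp [h]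
  rw [key, hR]; simp

open Classical in
/-- Summing the indicator of interlacing over the permutations of the rows gives a product of
determinants. -/
lemma sum_interlace_eq_prod_det {R : ℕ} (hR : 1 ≤ R) {lev v : ℕ → Fin N → ℤ}
    (hlev : ∀ r, Monotone (lev r)) (hv : ∀ r i, lev r i ≠ 0 → v r i = (i : ℕ))
    (hone : ∀ r, r = 0 ∨ R ≤ r → ∀ i j, lev r i = 0 → lev r j = 0 → i = j)
    (Γ : Finset (ℕ → Equiv.Perm (Fin N)))
    (hΓ : ∀ g, g ∈ Γ ↔ (∀ r, R < r → g r = 1) ∧ ∀ r i, lev r i ≠ 0 → g r i = i) :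
    ∑ g ∈ Γ, (if ∀ r < R, Interlace (fun i => toLex (lev r (g r i), v r (g r i)))
        (fun i => toLex (lev (r + 1) (g (r + 1) i), v (r + 1) (g (r + 1) i))) then (1 : ℂ) else 0) =
      ∏ r ∈ Finset.range R, (stepMatrix (fun i => toLex (lev r i, v r i))
        (fun i => toLex (lev (r + 1) i, v (r + 1) i))).det := by
  set X : ℕ → Fin N → ℤ ×ₗ ℤ := fun r i => toLex (lev r i, v r i) with hX
  -- A row with at most one movable slot admits only the identity. This applies to the end rows,
  -- whose signs would not cancel otherwise.
  have hmem_one : ∀ g ∈ Γ, ∀ r, r = 0 ∨ R ≤ r → g r = 1 := by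
    intro g hg r hr
    ext1 i
    have hfix := ((hΓ g).mp hg).2 r
    by_cases hi : lev r i = 0
    · by_cases hgi : lev r (g r i) = 0
      · exact hone r hr _ _ hgi hi
      · have := hfix _ hgi
        exact absurd ((g r).injective this) fun h => hgi (by rw [h, hi])
    · exact hfix i hi
  have hmono : ∀ g : ℕ → Equiv.Perm (Fin N), (∀ r < R, Interlace (X r ∘ g r)
      (X (r + 1) ∘ g (r + 1))) → ∀ r ≤ R, StrictMono (X r ∘ g r) := by
    intro g hg r hr
    rcases Nat.lt_or_ge r R with h | h
    · exact (hg r h).strictMono_left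
    · obtain rfl : r = (R - 1) + 1 := by omega
      exact (hg (R - 1) (by omega)).strictMono_right
  change ∑ g ∈ Γ, (if ∀ r < R, Interlace (X r ∘ g r) (X (r + 1) ∘ g (r + 1)) then (1 : ℂ) else 0) =
    ∏ r ∈ Finset.range R, (stepMatrix (X r) (X (r + 1))).det
  by_cases hinj : ∀ r ≤ R, Function.Injective (X r)
  -- Interlacing rows are strictly increasing, so with distinct entries in each row only the family
  -- that sorts all rows can contribute.
  · set g₀ : ℕ → Equiv.Perm (Fin N) := fun r => if r ≤ R then Tuple.sort (X r) else 1 with hg₀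
    have hg₀mono : ∀ r ≤ R, StrictMono (X r ∘ g₀ r) := fun r hr => by
      simp only [hg₀, if_pos hr]
      exact (Tuple.monotone_sort (X r)).strictMono_of_injective
        ((hinj r hr).comp (Equiv.injective _))
    have hg₀Γ : g₀ ∈ Γ := by
      refine (hΓ _).mpr ⟨fun r hr => by simp [hg₀, hr], fun r i hi => ?_⟩
      by_cases hr : r ≤ R
      · exact sort_apply_eq_self (hlev r) (v := v r) (σ := g₀ r) (hg₀mono r hr) (c := lev r i)
          (fun j hj => hv r j (hj ▸ hi)) rfl
      · simp [hg₀, hr]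
    rw [Finset.sum_eq_single_of_mem g₀ hg₀Γ]
    · have hdet : ∀ r ∈ Finset.range R, (if Interlace (X r ∘ g₀ r) (X (r + 1) ∘ g₀ (r + 1))
          then (1 : ℂ) else 0) = ((Equiv.Perm.sign (g₀ r) : ℤ) : ℂ) *
          ((Equiv.Perm.sign (g₀ (r + 1)) : ℤ) : ℂ) * (stepMatrix (X r) (X (r + 1))).det := by
        intro r hr
        have hr' := Finset.mem_range.mp hr
        rw [← det_stepMatrix_comp,
          det_stepMatrix_of_strictMono (hg₀mono r hr'.le) (hg₀mono (r + 1) hr')]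
      have hprod := Finset.prod_congr rfl hdet
      rw [Finset.prod_mul_distrib, prod_sign_eq_one (hmem_one g₀ hg₀Γ 0 (Or.inl rfl))
        (hmem_one g₀ hg₀Γ R (Or.inr le_rfl)), one_mul] at hprod
      rw [← hprod, Finset.prod_ite_zero]
      simp
    · intro g hg hne
      rw [if_neg]
      intro hil
      apply hne
      funext r
      by_cases hr : r ≤ R
      · have h1 := Tuple.unique_monotone (hmono g hil r hr).monotone (hg₀mono r hr).monotone
        ext1 i
        exact hinj r hr (congrFun h1 i)
      · rw [((hΓ g).mp hg).1 r (by omega)]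
        simp [hg₀, hr]
  -- A repeated entry gives a comparison matrix with two equal rows or columns, and it also prevents
  -- every arrangement from interlacing: both sides vanish.
  · have hR0 : ∏ r ∈ Finset.range R, (stepMatrix (X r) (X (r + 1))).det = 0 := by
      by_contra hcon
      rw [← ne_eq, Finset.prod_ne_zero_iff] at hcon
      apply hinj
      intro r hr
      rcases Nat.lt_or_ge r R with h | h
      · exact injective_left_of_det_stepMatrix_ne_zero (hcon r (by simpa using h))
      · obtain rfl : r = (R - 1) + 1 := by omega
        exact injective_right_of_det_stepMatrix_ne_zero
          (hcon (R - 1) (Finset.mem_range.mpr (by omega)))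
    rw [hR0]
    refine Finset.sum_eq_zero fun g hg => if_neg fun hil => hinj fun r hr => ?_
    have := (hmono g hil r hr).injective
    rwa [Function.Injective.of_comp_iff' _ (g r).bijective] at this

end StepMatrix

/-! ### Cyclic arrays of rows -/

/-- Some of the indices in `J` are arranged in rows `1, …, R` with slots `0, …, N - 1`. The array
`lev` increases along interlacing rows `0, …, R`, and it vanishes precisely in the slots that are
occupied, besides the slot `base` of the row `0`, which carries the constant value `const`. -/
structure RowSystem (J : Type) where
  N : ℕ
  R : ℕ
  lev : ℕ → ℕ → ℤ
  inLev : J → Prop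
  row : J → ℕ
  slot : J → ℕ
  base : ℕ
  const : ℤ
  R_pos : 1 ≤ R
  lev_le : ∀ r i, lev r i ≤ lev (r + 1) i
  lev_le_succ : ∀ r i, lev (r + 1) i ≤ lev r (i + 1)
  lev_elem : ∀ j, inLev j → lev (row j) (slot j) = 0
  row_pos : ∀ j, inLev j → 1 ≤ row j
  row_le : ∀ j, inLev j → row j ≤ R
  slot_lt : ∀ j, inLev j → slot j < N
  inj : ∀ j j', inLev j → inLev j' → row j = row j' → slot j = slot j' → j = j'
  base_lt : base < N
  lev_base : lev 0 base = 0
  base_unique : ∀ i < N, lev 0 i = 0 → i = base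
  surj : ∀ r i, 1 ≤ r → r ≤ R → i < N → lev r i = 0 → ∃ j, inLev j ∧ row j = r ∧ slot j = i
  last_unique : ∀ i i', i < N → i' < N → lev R i = 0 → lev R i' = 0 → i = i'

namespace RowSystem

variable {J : Type} (D : RowSystem J)

lemma monotone_lev (r : ℕ) : Monotone (D.lev r) :=
  monotone_nat_of_le_succ fun i => (D.lev_le r i).trans (D.lev_le_succ r i)

open Classical in
/-- The value in a slot. -/
def val (U : J → ℤ) (r i : ℕ) : ℤ :=
  if h : ∃ j, D.inLev j ∧ D.row j = r ∧ D.slot j = i then U h.choose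
  -- Outside the level zero the slot number serves as value, so that comparisons between equal
  -- nonzero levels hold automatically and sorting does not move these slots.
  else if D.lev r i = 0 then D.const else i

/-- The entries of the rows, which are compared lexicographically. -/
def key (U : J → ℤ) (r i : ℕ) : ℤ ×ₗ ℤ := toLex (D.lev r i, D.val U r i)

lemma val_elem {j : J} (hj : D.inLev j) (U : J → ℤ) : D.val U (D.row j) (D.slot j) = U j := by
  have h : ∃ j', D.inLev j' ∧ D.row j' = D.row j ∧ D.slot j' = D.slot j := ⟨j, hj, rfl, rfl⟩
  rw [val, dif_pos h]
  congr 1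
  exact D.inj _ _ h.choose_spec.1 hj h.choose_spec.2.1 h.choose_spec.2.2

lemma val_base (U : J → ℤ) : D.val U 0 D.base = D.const := by
  rw [val, dif_neg, if_pos D.lev_base]
  rintro ⟨j, hj, h, -⟩
  have := D.row_pos j hj
  omega

lemma val_of_lev_ne {r i : ℕ} (h : D.lev r i ≠ 0) (U : J → ℤ) : D.val U r i = i := by
  rw [val, dif_neg, if_neg h]
  rintro ⟨j, hj, rfl, rfl⟩
  exact h (D.lev_elem j hj)

lemma val_cases (r i : ℕ) : (∃ j, ∀ U, D.val U r i = U j) ∨ ∃ c, ∀ U, D.val U r i = c := by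
  by_cases h : ∃ j, D.inLev j ∧ D.row j = r ∧ D.slot j = i
  · obtain ⟨j, hj, rfl, rfl⟩ := h
    exact Or.inl ⟨j, D.val_elem hj⟩
  · right
    simp only [val, dif_neg h]
    exact ⟨_, fun _ => rfl⟩

lemma key_le_iff (U : J → ℤ) (r i r' i' : ℕ) : D.key U r i ≤ D.key U r' i' ↔
    D.lev r i < D.lev r' i' ∨ D.lev r i = D.lev r' i' ∧ D.val U r i ≤ D.val U r' i' :=
  Prod.Lex.toLex_le_toLex

lemma key_lt_iff (U : J → ℤ) (r i r' i' : ℕ) : D.key U r i < D.key U r' i' ↔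
    D.lev r i < D.lev r' i' ∨ D.lev r i = D.lev r' i' ∧ D.val U r i < D.val U r' i' :=
  Prod.Lex.toLex_lt_toLex

lemma tame_key_le [DecidableEq J] (r i r' i' : ℕ) :
    Tame fun U => D.key U r i ≤ D.key U r' i' := by
  have hval : Tame fun U => D.val U r i ≤ D.val U r' i' := by
    rcases D.val_cases r i with ⟨j, hj⟩ | ⟨c, hc⟩ <;> rcases D.val_cases r' i' with ⟨j', hj'⟩ | ⟨c', hc'⟩
    · simp only [hj, hj']
      simpa only [sub_nonpos] using tame_sub_le j j' 0
    · simp only [hj, hc']; exact tame_le_const j c'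
    · simp only [hc, hj']; exact tame_const_le j' c
    · simp only [hc, hc']; exact tame_const _
  simp only [key_le_iff]
  exact hval.comp fun p => D.lev r i < D.lev r' i' ∨ D.lev r i = D.lev r' i' ∧ p

/-- Consecutive rows interlace. -/
def Interlaced (U : J → ℤ) : Prop :=
  ∀ r < D.R, Interlace (fun i : Fin D.N => D.key U r i) (fun i : Fin D.N => D.key U (r + 1) i)

lemma tame_interlaced [DecidableEq J] : Tame D.Interlaced := by
  have h1 : Tame fun U => fun p : Fin D.R × Fin D.N => D.key U p.1 p.2 ≤ D.key U (p.1 + 1) p.2 :=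
    tame_pi fun p => D.tame_key_le _ _ _ _
  have h2 : Tame fun U => fun p : Fin D.R × Fin D.N × Fin D.N =>
      D.key U p.1 p.2.2 ≤ D.key U (p.1 + 1) p.2.1 :=
    tame_pi fun p => D.tame_key_le _ _ _ _
  have := h1.comp₂ h2 fun p q => (∀ r i, p (r, i)) ∧ ∀ r i j, i < j → ¬ q (r, i, j)
  refine (congrArg Tame ?_).mp this
  funext U
  apply propext
  simp only [Interlaced, Interlace, not_le]
  exact ⟨fun h r hr => ⟨h.1 ⟨r, hr⟩, h.2 ⟨r, hr⟩⟩,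
    fun h => ⟨fun r => (h r r.2).1, fun r => (h r r.2).2⟩⟩

/-- The permutations of the slots of each row that fix the slots of nonzero level. -/
def IsRowPerm (g : ℕ → Equiv.Perm (Fin D.N)) : Prop :=
  (∀ r, D.R < r → g r = 1) ∧ ∀ r (i : Fin D.N), D.lev r i ≠ 0 → g r i = i

lemma finite_isRowPerm : {g | D.IsRowPerm g}.Finite := by
  refine Set.Finite.of_finite_image (f := fun g => fun r : Fin (D.R + 1) => g r)
    (Set.toFinite _) fun g hg g' hg' h => funext fun r => ?_
  by_cases hr : r ≤ D.R
  · exact congrFun h ⟨r, by omega⟩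
  · rw [hg.1 r (by omega), hg'.1 r (by omega)]

variable {D} in
lemma IsRowPerm.lev_apply {g : ℕ → Equiv.Perm (Fin D.N)} (hg : D.IsRowPerm g) {r : ℕ}
    {i : Fin D.N} (hi : D.lev r i = 0) : D.lev r (g r i) = 0 := by
  by_contra h
  have := (g r).injective (hg.2 r _ h)
  rw [this] at h
  exact h hi

variable {D} in
/-- The permutation of the indices induced by a permutation of the slots. -/
lemma IsRowPerm.exists_perm [Finite J] {g : ℕ → Equiv.Perm (Fin D.N)} (hg : D.IsRowPerm g) :
    ∃ π : Equiv.Perm J, (∀ j, ¬ D.inLev j → π j = j) ∧ ∀ j (hj : D.inLev j), D.inLev (π j) ∧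
      D.row (π j) = D.row j ∧ D.slot (π j) = g (D.row j) ⟨D.slot j, D.slot_lt j hj⟩ := by
  have key : ∀ j, ∃ j', (¬ D.inLev j → j' = j) ∧ ∀ (hj : D.inLev j), D.inLev j' ∧
      D.row j' = D.row j ∧ D.slot j' = g (D.row j) ⟨D.slot j, D.slot_lt j hj⟩ := by
    intro j
    by_cases hj : D.inLev j
    · obtain ⟨j', hj'⟩ := D.surj (D.row j) (g (D.row j) ⟨D.slot j, D.slot_lt j hj⟩)
        (D.row_pos j hj) (D.row_le j hj) (Fin.is_lt _) (hg.lev_apply (D.lev_elem j hj))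
      exact ⟨j', fun h => absurd hj h, fun _ => hj'⟩
    · exact ⟨j, fun _ => rfl, fun h => absurd h hj⟩
  choose f hf using key
  have hinj : Function.Injective f := by
    intro j j' h
    by_cases hj : D.inLev j <;> by_cases hj' : D.inLev j'
    · obtain ⟨h1, h2, h3⟩ := (hf j).2 hj
      obtain ⟨h1', h2', h3'⟩ := (hf j').2 hj'
      have hrow : D.row j = D.row j' := by rw [← h2, ← h2', h]
      refine D.inj _ _ hj hj' hrow ?_
      rw [h, h3'] at h3
      have h4 := Fin.ext h3
      rw [hrow] at h4
      exact (congrArg Fin.val ((g _).injective h4)).symm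
    · rw [(hf j').1 hj'] at h
      exact absurd (h ▸ ((hf j).2 hj).1) hj'
    · rw [(hf j).1 hj] at h
      exact absurd (h ▸ ((hf j').2 hj').1) hj
    · rwa [(hf j).1 hj, (hf j').1 hj'] at h
  exact ⟨Equiv.ofBijective f ⟨hinj, Finite.injective_iff_surjective.mp hinj⟩,
    fun j => (hf j).1, fun j => (hf j).2⟩

/-- In the row 0 only the slot `base` has level zero, so the constant entry stays in place and the
permutation of slots is realized by one of the variables. -/
lemma key_perm {g : ℕ → Equiv.Perm (Fin D.N)} (hg : D.IsRowPerm g) {π : Equiv.Perm J}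
    (hπ : ∀ j (hj : D.inLev j), D.inLev (π j) ∧
      D.row (π j) = D.row j ∧ D.slot (π j) = g (D.row j) ⟨D.slot j, D.slot_lt j hj⟩)
    (U : J → ℤ) {r : ℕ} (hr : r ≤ D.R) (i : Fin D.N) :
    D.key (U ∘ π) r i = D.key U r (g r i) := by
  by_cases hi : D.lev r i = 0
  · have hgi := hg.lev_apply hi
    rw [key, key, hi, hgi]
    congr 2
    rcases Nat.eq_zero_or_pos r with rfl | hr0
    · rw [D.base_unique _ i.2 hi, D.base_unique _ (g 0 i).2 hgi, val_base, val_base]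
    · obtain ⟨j, hj, rfl, hji⟩ := D.surj r i hr0 hr i.2 hi
      obtain ⟨h1, h2, h3⟩ := hπ j hj
      have h4 := D.val_elem h1 U
      obtain rfl : i = ⟨D.slot j, D.slot_lt j hj⟩ := Fin.ext hji.symm
      rw [h2, h3] at h4
      rw [h4]
      exact D.val_elem hj _
  · rw [hg.2 r i hi, key, key, D.val_of_lev_ne hi, D.val_of_lev_ne hi]

/-- The product of the determinants of the comparison matrices of consecutive rows. -/
def detProd (U : J → ℤ) : ℂ :=
  ∏ r ∈ Finset.range D.R,
    (stepMatrix (fun i : Fin D.N => D.key U r i) (fun i : Fin D.N => D.key U (r + 1) i)).det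

open Classical in
lemma sum_interlaced_perm (U : J → ℤ) (π : (ℕ → Equiv.Perm (Fin D.N)) → Equiv.Perm J)
    (hπ : ∀ g, D.IsRowPerm g → ∀ j (hj : D.inLev j), D.inLev (π g j) ∧
      D.row (π g j) = D.row j ∧ D.slot (π g j) = g (D.row j) ⟨D.slot j, D.slot_lt j hj⟩) :
    ∑ g ∈ D.finite_isRowPerm.toFinset, (if D.Interlaced (U ∘ π g) then (1 : ℂ) else 0) =
      D.detProd U := by
  -- The levels are frozen from the row `D.R` on, so that the uniqueness of the movable slot holds
  -- in all later rows too.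
  have h := sum_interlace_eq_prod_det (N := D.N) D.R_pos (lev := fun r i => D.lev (min r D.R) i)
    (v := fun r i => D.val U (min r D.R) i)
    (fun r i j hij => D.monotone_lev _ hij) (fun r i hi => D.val_of_lev_ne hi U)
    (fun r hr i j hi hj => by
      apply Fin.ext
      rcases hr with rfl | hr
      · simp only [Nat.zero_min] at hi hj
        rw [D.base_unique _ i.2 hi, D.base_unique _ j.2 hj]
      · simp only [min_eq_right hr] at hi hj
        exact D.last_unique _ _ i.2 j.2 hi hj)
    D.finite_isRowPerm.toFinset (fun g => by
      simp only [Set.Finite.mem_toFinset, Set.mem_ofPred_eq, IsRowPerm]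
      refine and_congr_right fun h => ⟨fun h' r i hi => ?_, fun h' r i hi => ?_⟩
      · rcases le_or_gt r D.R with hr | hr
        · rw [min_eq_left hr] at hi; exact h' r i hi
        · rw [h r hr]; rfl
      · rcases le_or_gt r D.R with hr | hr
        · exact h' r i (by rwa [min_eq_left hr])
        · rw [h r hr]; rfl)
  rw [detProd]
  refine Eq.trans (Finset.sum_congr rfl fun g hg => ?_) (h.trans (Finset.prod_congr rfl ?_))
  · have hg' : D.IsRowPerm g := by simpa using hg
    refine if_congr (forall₂_congr fun r hr => ?_) rfl rfl
    have h1 : (fun i : Fin D.N => D.key (U ∘ π g) r i) = fun i : Fin D.N =>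
        toLex (D.lev (min r D.R) (g r i), D.val U (min r D.R) (g r i)) := by
      funext i
      rw [D.key_perm hg' (hπ g hg') U hr.le, min_eq_left hr.le]; rfl
    have h2 : (fun i : Fin D.N => D.key (U ∘ π g) (r + 1) i) = fun i : Fin D.N =>
        toLex (D.lev (min (r + 1) D.R) (g (r + 1) i), D.val U (min (r + 1) D.R) (g (r + 1) i)) := by
      funext i
      rw [D.key_perm hg' (hπ g hg') U hr, min_eq_left (Nat.succ_le_of_lt hr)]; rfl
    rw [h1, h2]
  · intro r hr
    have hr' := Finset.mem_range.mp hr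
    rw [min_eq_left hr'.le, min_eq_left (Nat.succ_le_of_lt hr')]; rfl

open Classical in
/-- A term in the expansion of `detProd`. -/
def detTerm (σ : Fin D.R → Equiv.Perm (Fin D.N)) (U : J → ℤ) : ℂ :=
  ∏ r : Fin D.R, (((Equiv.Perm.sign (σ r) : ℤ) : ℂ) *
    ∏ i : Fin D.N, if D.key U r (σ r i) ≤ D.key U (r + 1) i then (1 : ℂ) else 0)

lemma detProd_eq_sum (U : J → ℤ) : D.detProd U = ∑ σ, D.detTerm σ U := by
  classical
  rw [detProd, Finset.prod_range fun r => (stepMatrix (fun i : Fin D.N => D.key U r i)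
    (fun i : Fin D.N => D.key U (r + 1) i)).det]
  simp only [Matrix.det_apply', detTerm]
  rw [Finset.prod_univ_sum, Fintype.piFinset_univ]
  rfl

lemma tame_detTerm [DecidableEq J] (σ : Fin D.R → Equiv.Perm (Fin D.N)) :
    Tame (D.detTerm σ) := by
  classical
  have h : Tame fun U => fun p : Fin D.R × Fin D.N =>
      D.key U p.1 (σ p.1 p.2) ≤ D.key U (p.1 + 1) p.2 := tame_pi fun p => D.tame_key_le _ _ _ _
  have := h.comp fun q => ∏ r : Fin D.R, (((Equiv.Perm.sign (σ r) : ℤ) : ℂ) *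
    ∏ i : Fin D.N, if q (r, i) then (1 : ℂ) else 0)
  refine (congrArg Tame ?_).mp this
  funext U
  rw [detTerm]
  congr! 4

/-- The slots in the path that starts in the slot `base`. -/
def path (σ : ℕ → Equiv.Perm (Fin D.N)) : ℕ → Fin D.N
  | 0 => ⟨D.base, D.base_lt⟩
  -- The term of `σ` compares slot `i` of the row `r + 1` with slot `σ r i` of the row `r`, so a
  -- path moves upwards by the inverse permutation.
  | r + 1 => (σ r).symm (path σ r)

open Classical in
/-- The indices outside of the path through the slot `base`. -/
def offPath [Fintype J] (σ : ℕ → Equiv.Perm (Fin D.N)) : Finset J :=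
  Finset.univ.filter fun j => D.inLev j ∧ D.slot j ≠ D.path σ (D.row j)

lemma mem_offPath [Fintype J] (σ : ℕ → Equiv.Perm (Fin D.N)) (j : J) :
    j ∈ D.offPath σ ↔ D.inLev j ∧ D.slot j ≠ D.path σ (D.row j) := by
  simp [offPath]

/-- A path meets each row in a single slot, so of two indices in one row at least one lies off it.
-/
lemma offPath_nonempty [Fintype J] (σ : ℕ → Equiv.Perm (Fin D.N)) {j j' : J} (hj : D.inLev j)
    (hj' : D.inLev j') (hne : j ≠ j') (hrow : D.row j = D.row j') : (D.offPath σ).Nonempty := by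
  by_contra hcon
  rw [Finset.not_nonempty_iff_eq_empty, Finset.eq_empty_iff_forall_notMem] at hcon
  have h1 := hcon j
  have h2 := hcon j'
  rw [mem_offPath] at h1 h2
  push Not at h1 h2
  exact hne (D.inj _ _ hj hj' hrow (by rw [h1 hj, h2 hj', hrow]))

/-- A comparison joins consecutive slots of one path. Between two entries of level zero it therefore
involves either two shifted values or two unshifted ones. The constant entry lies on the excluded
path, and all other comparisons do not involve the variables' values. -/
lemma detTerm_sub_chi [Fintype J] [DecidableEq J] (σ : Fin D.R → Equiv.Perm (Fin D.N))
    (σ' : ℕ → Equiv.Perm (Fin D.N)) (hσ : ∀ r : Fin D.R, σ' r = σ r) (U : J → ℤ) :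
    D.detTerm σ (U - chi (D.offPath σ')) = D.detTerm σ U := by
  have hval : ∀ r ≤ D.R, ∀ i : Fin D.N, D.lev r i = 0 →
      D.val (U - chi (D.offPath σ')) r i =
        D.val U r i - if i = D.path σ' r then 0 else 1 := by
    intro r hr i hi
    rcases Nat.eq_zero_or_pos r with rfl | hr0
    · have hib := D.base_unique _ i.2 hi
      rw [hib, val_base, val_base, if_pos (Fin.ext hib), sub_zero]
    · obtain ⟨j, hj, rfl, hji⟩ := D.surj r i hr0 hr i.2 hi
      rw [← hji, D.val_elem hj, D.val_elem hj, Pi.sub_apply, chi]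
      simp only [mem_offPath, true_and, hj, Fin.ext_iff, ← hji]
      split_ifs <;> first | rfl | contradiction
  rw [detTerm, detTerm]
  refine Finset.prod_congr rfl fun r _ => congrArg _ (Finset.prod_congr rfl fun i _ => ?_)
  refine if_congr ?_ rfl rfl
  rw [key_le_iff, key_le_iff]
  refine or_congr_right (and_congr_right fun hlev => ?_)
  by_cases h0 : D.lev r (σ r i) = 0
  · rw [hval r r.2.le _ h0, hval (r + 1) r.2 _ (hlev ▸ h0)]
    have : i = D.path σ' (r + 1) ↔ σ r i = D.path σ' r := by
      rw [path, hσ, Equiv.eq_symm_apply]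
    rw [if_congr this rfl rfl]
    omega
  · rw [D.val_of_lev_ne h0, D.val_of_lev_ne h0, D.val_of_lev_ne (hlev ▸ h0),
      D.val_of_lev_ne (hlev ▸ h0)]

open Classical in
/-- If some row has two occupied slots, then the numerator of the indicator of interlacing
arrays vanishes. -/
theorem numerator_interlaced_eq_zero [Fintype J] [DecidableEq J] {X : Type} [AddCommGroup X]
    {w : (J → ℤ) →+ X} (hw : ∀ π : Equiv.Perm J, (∀ j, ¬ D.inLev j → π j = j) →
      (∀ j, D.inLev j → D.inLev (π j) ∧ D.row (π j) = D.row j) → ∀ T, w (T ∘ π) = w T)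
    {rest : (J → ℤ) → ℂ} (htame : Tame rest)
    (hrest : ∀ U U', (∀ j, ¬ D.inLev j → U j = U' j) → rest U = rest U')
    {j j' : J} (hj : D.inLev j) (hj' : D.inLev j') (hne : j ≠ j') (hrow : D.row j = D.row j') :
    Admissible (fun U => (if D.Interlaced U then 1 else 0) * rest U) ∧
      numerator w (fun U => (if D.Interlaced U then 1 else 0) * rest U) = 0 := by
  set S : (J → ℤ) → ℂ := fun U => (if D.Interlaced U then 1 else 0) * rest U with hS
  have hadm : Admissible S :=
    (D.tame_interlaced.comp₂ htame fun p c => (if p then 1 else 0) * c).admissible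
  refine ⟨hadm, ?_⟩
  have hπ : ∀ g : ℕ → Equiv.Perm (Fin D.N), ∃ π : Equiv.Perm J, D.IsRowPerm g →
      (∀ j, ¬ D.inLev j → π j = j) ∧ ∀ j (hj : D.inLev j), D.inLev (π j) ∧
      D.row (π j) = D.row j ∧ D.slot (π j) = g (D.row j) ⟨D.slot j, D.slot_lt j hj⟩ := by
    intro g
    by_cases hg : D.IsRowPerm g
    · obtain ⟨π, hπ⟩ := hg.exists_perm
      exact ⟨π, fun _ => hπ⟩
    · exact ⟨1, fun h => absurd h hg⟩
  choose π hπ using hπ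
  set Γ := D.finite_isRowPerm.toFinset with hΓ
  have hmem : ∀ g ∈ Γ, D.IsRowPerm g := fun g hg => by simpa [hΓ] using hg
  -- Symmetrization replaces the indicator of interlacing by the product of determinants; `rest`
  -- does not see the permuted variables.
  have hsum : (∑ g ∈ Γ, fun U => S (U ∘ π g)) = ∑ σ, fun U => D.detTerm σ U * rest U := by
    funext U
    rw [Finset.sum_apply, Finset.sum_apply, ← Finset.sum_mul, ← detProd_eq_sum,
      ← D.sum_interlaced_perm U π fun g hg => (hπ g hg).2, Finset.sum_mul]
    refine Finset.sum_congr rfl fun g hg => ?_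
    simp only [hS]
    congr 1
    refine hrest _ _ fun j hj => ?_
    rw [Function.comp_apply, (hπ g (hmem g hg)).1 j hj]
  -- Each determinant term is periodic under the shift of all variables off the path through `base`,
  -- and `rest` is unaffected by this shift.
  have hzero : numerator w (∑ σ, fun U => D.detTerm σ U * rest U) = 0 := by
    rw [numerator_sum _ fun σ _ => ((D.tame_detTerm σ).comp₂ htame (· * ·)).admissible]
    refine Finset.sum_eq_zero fun σ _ => ?_
    set σ' : ℕ → Equiv.Perm (Fin D.N) := fun r => if h : r < D.R then σ ⟨r, h⟩ else 1
    refine numerator_eq_zero_of_periodic (D.offPath_nonempty σ' hj hj' hne hrow) fun U => ?_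
    rw [D.detTerm_sub_chi σ σ' (fun r => by simp [σ']) U]
    congr 1
    refine hrest _ _ fun j hj => ?_
    simp [chi, mem_offPath, hj]
  rw [← hsum, numerator_sum _ fun g _ => hadm.perm (π g)] at hzero
  -- Variables in one row have the same weight, so every summand of the symmetrization has the same
  -- numerator; the vanishing sum is `Γ.card` times it.
  have hconst : ∀ g ∈ Γ, numerator w (fun U => S (U ∘ π g)) = numerator w S := fun g hg =>
    numerator_perm (hw (π g) (hπ g (hmem g hg)).1 fun j hj =>
      ⟨((hπ g (hmem g hg)).2 j hj).1, ((hπ g (hmem g hg)).2 j hj).2.1⟩) S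
  rw [Finset.sum_congr rfl hconst, Finset.sum_const] at hzero
  have hΓ0 : (Γ.card : ℂ) ≠ 0 := by
    have h1 : (fun _ => 1) ∈ Γ := by simp [hΓ, IsRowPerm]
    exact_mod_cast (Finset.card_pos.mpr ⟨_, h1⟩).ne'
  ext x
  have := congrArg (fun p => p.coeff x) hzero
  rw [← Nat.cast_smul_eq_nsmul ℂ] at this
  simpa [hΓ0] using this

end RowSystem

/-! ### Facet functionals -/

/-- The sum of the first `j` terms. -/
def psum (x : RSeq) (j : ℕ) : ℝ := ∑ i ∈ Finset.range j, x i

/-- The sum of the first `j` terms of an integer sequence. -/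
def psumZ (x : ZSeq) (j : ℕ) : ℤ := ∑ i ∈ Finset.range j, x i

lemma psum_zero (x : RSeq) : psum x 0 = 0 := rfl

lemma psum_succ (x : RSeq) (j : ℕ) : psum x (j + 1) = psum x j + x j := Finset.sum_range_succ _ _

lemma psumZ_succ (x : ZSeq) (j : ℕ) : psumZ x (j + 1) = psumZ x j + x j :=
  Finset.sum_range_succ _ _

@[simp] lemma toReal_apply (x : ZSeq) (i : ℕ) : toReal x i = x i := rfl

lemma psum_toReal (x : ZSeq) (j : ℕ) : psum (toReal x) j = psumZ x j := by
  simp [psum, psumZ]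

lemma psi_eq_psum {n : ℕ} (i : ℕ) (x : RSeq) :
    psi n i x = psum x (i + 1) - psum x (i + 1 - n) := by
  rw [psi, psum, psum, eq_sub_iff_add_eq', Finset.range_eq_Ico, Finset.range_eq_Ico,
    ← Finset.sum_Ico_consecutive _ (Nat.zero_le (i + 1 - n)) (Nat.sub_le _ _)]
  rfl

lemma exists_psum_eventually_const (x : RSeq) : ∃ M, ∀ j ≥ M, x j = 0 := by
  obtain ⟨M, hM⟩ := x.support.bddAbove
  refine ⟨M + 1, fun j hj => ?_⟩
  by_contra h
  have := hM (Finsupp.mem_support_iff.mpr h)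
  omega

lemma psum_eq_of_ge {x : RSeq} {M : ℕ} (hM : ∀ j ≥ M, x j = 0) {j : ℕ} (hj : M ≤ j) :
    psum x j = psum x M := by
  induction j, hj using Nat.le_induction with
  | base => rfl
  | succ j hj ih => rw [psum_succ, hM j hj, add_zero, ih]

lemma RSeq.ext_psum {x y : RSeq} (h : ∀ j, psum x j = psum y j) : x = y := by
  ext i
  have h1 := h (i + 1)
  rw [psum_succ, psum_succ, h i] at h1
  linarith

lemma ZSeq.ext_psumZ {x y : ZSeq} (h : ∀ j, psumZ x j = psumZ y j) : x = y := by
  ext i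
  have h1 := h (i + 1)
  rw [psumZ_succ, psumZ_succ, h i] at h1
  linarith

lemma toReal_injective : Function.Injective toReal := by
  intro x y h
  ext i
  have := DFunLike.congr_fun h i
  simpa using this

/-- An integer sequence with prescribed sums of initial segments. -/
lemma exists_psumZ_eq {f : ℕ → ℤ} (h0 : f 0 = 0) {M : ℕ} (hM : ∀ j ≥ M, f (j + 1) = f j) :
    ∃ z : ZSeq, ∀ j, psumZ z j = f j := by
  refine ⟨Finsupp.onFinset (Finset.range M) (fun i => f (i + 1) - f i) fun i hi => ?_, fun j => ?_⟩
  · by_contra h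
    exact hi (by rw [hM i (by simpa using h), sub_self])
  · simp only [psumZ, Finsupp.onFinset_apply]
    rw [Finset.sum_range_sub, h0, sub_zero]

/-- The functional that is nonnegative on the polytope and vanishes on the facet. -/
def slack (n : ℕ) (a : Fin n → ℕ) : FacetName → RSeq → ℝ
  | FacetName.Gam i, x => bound n a i - psi n i x
  | FacetName.Del i, x => x i

/-- The linear part of `slack`. -/
def lin (n : ℕ) : FacetName → RSeq → ℝ
  | FacetName.Gam i, x => -psi n i x
  | FacetName.Del i, x => x i

section Lin

variable {n : ℕ} {a : Fin n → ℕ}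

lemma psi_add (i : ℕ) (x y : RSeq) : psi n i (x + y) = psi n i x + psi n i y := by
  simp [psi, Finset.sum_add_distrib]

lemma psi_smul (i : ℕ) (c : ℝ) (x : RSeq) : psi n i (c • x) = c * psi n i x := by
  simp [psi, Finset.mul_sum]

lemma slack_add (F : FacetName) (x y : RSeq) : slack n a F (x + y) = slack n a F x + lin n F y := by
  cases F with
  | Gam i => simp only [slack, lin, psi_add]; ring
  | Del i => rfl

lemma lin_add (F : FacetName) (x y : RSeq) : lin n F (x + y) = lin n F x + lin n F y := by
  cases F with
  | Gam i => simp only [lin, psi_add]; ring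
  | Del i => rfl

lemma lin_smul (F : FacetName) (c : ℝ) (x : RSeq) : lin n F (c • x) = c * lin n F x := by
  cases F with
  | Gam i => simp only [lin, psi_smul]; ring
  | Del i => rfl

variable (n) in
/-- `lin` as a linear map. -/
def linHom (F : FacetName) : RSeq →ₗ[ℝ] ℝ where
  toFun := lin n F
  map_add' := lin_add F
  map_smul' := lin_smul F

lemma lin_zero (F : FacetName) : lin n F 0 = 0 := (linHom n F).map_zero

lemma lin_sub (F : FacetName) (x y : RSeq) : lin n F (x - y) = lin n F x - lin n F y :=
  (linHom n F).map_sub x y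

lemma slack_sub_slack (F : FacetName) (x y : RSeq) :
    slack n a F x - slack n a F y = lin n F (x - y) := by
  rw [sub_eq_iff_eq_add', ← slack_add]; congr 1; abel

lemma mem_polytope_iff {x : RSeq} : x ∈ polytope n a ↔ ∀ F, 0 ≤ slack n a F x := by
  constructor
  · rintro ⟨h1, h2⟩ (i | i)
    · exact sub_nonneg.mpr (h2 i)
    · exact h1 i
  · intro h
    exact ⟨fun i => h (FacetName.Del i), fun i => sub_nonneg.mp (h (FacetName.Gam i))⟩

lemma mem_facet_iff {x : RSeq} {F : FacetName} :
    x ∈ facet n a F ↔ x ∈ polytope n a ∧ slack n a F x = 0 := by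
  cases F with
  | Gam i => exact and_congr_right fun _ => by rw [slack, sub_eq_zero, eq_comm]
  | Del i => exact Iff.rfl

lemma lin_Gam (i : ℕ) (x : RSeq) :
    lin n (FacetName.Gam i) x = psum x (i + 1 - n) - psum x (i + 1) := by
  rw [lin, psi_eq_psum]; ring

lemma lin_Del (i : ℕ) (x : RSeq) : lin n (FacetName.Del i) x = psum x (i + 1) - psum x i := by
  rw [psum_succ, lin]; ring

lemma finite_lin_ne_zero (y : RSeq) : {F | lin n F y ≠ 0}.Finite := by
  obtain ⟨M, hM⟩ := exists_psum_eventually_const y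
  refine (((Set.finite_lt_nat (M + n)).image FacetName.Gam).union
    ((Set.finite_lt_nat M).image FacetName.Del)).subset ?_
  rintro (i | i) hi
  · refine Or.inl ⟨i, ?_, rfl⟩
    by_contra h
    have h' : M + n ≤ i := by simpa using h
    apply hi
    rw [lin_Gam, psum_eq_of_ge hM (show M ≤ i + 1 by omega),
      psum_eq_of_ge hM (show M ≤ i + 1 - n by omega), sub_self]
  · refine Or.inr ⟨i, ?_, rfl⟩
    by_contra h
    exact hi (hM i (by simpa using h))

/-- The set of facets containing `u`. -/
lemma mem_facetsOf_singleton {u : RSeq} (hu : u ∈ polytope n a) {F : FacetName} :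
    F ∈ facetsOf n a {u} ↔ slack n a F u = 0 := by
  change {u} ⊆ facet n a F ↔ _
  rw [Set.singleton_subset_iff, mem_facet_iff]
  exact and_iff_right hu

/-- A nonzero vector decreases some facet functional. -/
lemma exists_lin_neg (hn : 0 < n) {y : RSeq} (hy : y ≠ 0) : ∃ F, lin n F y < 0 := by
  by_contra hcon
  push Not at hcon
  obtain ⟨i, hi⟩ : ∃ i, y i ≠ 0 := by
    by_contra h
    push Not at h
    exact hy (Finsupp.ext h)
  have h0 : ∀ j, 0 ≤ y j := fun j => hcon (FacetName.Del j)
  have h1 : 0 ≤ -psi n i y := hcon (FacetName.Gam i)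
  have h2 : y i ≤ psi n i y :=
    Finset.single_le_sum (f := fun j => y j) (fun j _ => h0 j) (by simp; omega)
  exact hi (le_antisymm (by linarith) (h0 i))

/-- A vector along which no facet functional vanishing at the vertex changes is zero. -/
lemma IsVertex.eq_zero_of_lin (hn : 0 < n) {u : RSeq} (hu : IsVertex n a u) {y : RSeq}
    (h : ∀ F, slack n a F u = 0 → lin n F y = 0) : y = 0 := by
  by_contra hy
  have hu0 := mem_polytope_iff.mp hu.1
  set B : Set FacetName := {F | lin n F y < 0} with hB
  have hBfin : B.Finite := (finite_lin_ne_zero y).subset fun F hF => ne_of_lt hF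
  -- `F₁` is the first facet met on moving from `u` along `y`. The point reached lies on it and on
  -- all facets through `u`, so maximality puts `F₁` through `u`, although `y` changes it.
  obtain ⟨F₁, hF₁, hmin⟩ := Set.exists_min_image B (fun F => slack n a F u / (-lin n F y)) hBfin
    (exists_lin_neg hn hy)
  have hF₁' : lin n F₁ y < 0 := hF₁
  set c := slack n a F₁ u / (-lin n F₁ y) with hc
  have hc0 : 0 ≤ c := div_nonneg (hu0 F₁) (by linarith)
  have hv : u + c • y ∈ polytope n a := by
    refine mem_polytope_iff.mpr fun F => ?_
    rw [slack_add, lin_smul]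
    rcases lt_or_ge (lin n F y) 0 with hF | hF
    · have := (le_div_iff₀ (by linarith)).mp (hmin F hF)
      linarith
    · exact add_nonneg (hu0 F) (mul_nonneg hc0 hF)
  have hsub : facetsOf n a {u} ⊆ facetsOf n a {u + c • y} := by
    intro F hF
    rw [mem_facetsOf_singleton hu.1] at hF
    rw [mem_facetsOf_singleton hv, slack_add, lin_smul, hF, h F hF]
    simp
  have hF₁v : F₁ ∈ facetsOf n a {u + c • y} := by
    rw [mem_facetsOf_singleton hv, slack_add, lin_smul, hc]
    field_simp [hF₁'.ne]
    ring
  have := hu.2 _ hv hsub hF₁v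
  rw [mem_facetsOf_singleton hu.1] at this
  exact hF₁'.ne (h F₁ this)

end Lin

/-! ### The bounds as an increasing sequence -/

section Bounds

variable {n : ℕ} (a : Fin n → ℕ)

/-- The level `k = a 0 + ⋯ + a (n - 1)`. -/
def total : ℤ := ∑ j, (a j : ℤ)

/-- The sequence `a 1 + ⋯ + a j` for `0 ≤ j < n`, extended so as to increase by `total a` under
a shift of the index by `n`. -/
def bseq (j : ℤ) : ℤ :=
  ∑ t : Fin n with 1 ≤ t.val ∧ (t.val : ℤ) ≤ j % n, (a t : ℤ) + total a * (j / n)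

lemma bseq_add (hn : 0 < n) (j : ℤ) : bseq a (j + n) = bseq a j + total a := by
  have hn' : (n : ℤ) ≠ 0 := by exact_mod_cast hn.ne'
  rw [bseq, bseq, Int.add_emod_right, Int.add_ediv_of_dvd_right (dvd_refl _), Int.ediv_self hn']
  ring

lemma bseq_add_mul (hn : 0 < n) (j q : ℤ) : bseq a (j + n * q) = bseq a j + total a * q := by
  have hn' : (n : ℤ) ≠ 0 := by exact_mod_cast hn.ne'
  rw [bseq, bseq, Int.add_mul_emod_self_left, Int.add_mul_ediv_left _ _ hn']
  ring

lemma bseq_zero : bseq a 0 = 0 := by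
  rw [bseq, Finset.sum_eq_zero]
  · simp
  · intro t ht
    simp at ht
    omega

variable {a}

lemma bseq_strictMono (hn : 0 < n) (ha : ∀ i, 0 < a i) : StrictMono (bseq a) := by
  refine strictMono_int_of_lt_succ fun j => ?_
  have hn' : (0 : ℤ) < n := by exact_mod_cast hn
  have hmod := Int.emod_nonneg j hn'.ne'
  have hmod' := Int.emod_lt_of_pos j hn'
  have hdiv := Int.emod_add_mul_ediv j n
  by_cases h : j % n + 1 < n
  · have h1 : (j + 1) % n = j % n + 1 := by
      rw [Int.add_emod, Int.emod_eq_of_lt (a := 1) (by omega) (by omega)]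
      exact Int.emod_eq_of_lt (by omega) (by omega)
    have h2 : (j + 1) / n = j / n := by
      rw [Int.ediv_eq_iff_of_pos hn']
      constructor <;> nlinarith
    rw [bseq, bseq, h1, h2]
    refine add_lt_add_of_lt_of_le (Finset.sum_lt_sum_of_subset (i := ⟨(j % n + 1).toNat, by omega⟩)
      ?_ ?_ ?_ ?_ ?_) le_rfl
    · intro t ht
      simp at ht ⊢
      omega
    · simp
      omega
    · simp
    · exact_mod_cast ha _
    · intros; positivity
  · have h0 : j % n + 1 = n := by omega
    have h1 : (j + 1) % n = 0 := by
      apply Int.emod_eq_zero_of_dvd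
      exact ⟨j / n + 1, by linarith⟩
    have h2 : (j + 1) / n = j / n + 1 := by
      rw [Int.ediv_eq_iff_of_pos hn']
      constructor <;> nlinarith
    rw [bseq, bseq, h1, h2]
    have h3 : ∑ t : Fin n with 1 ≤ t.val ∧ (t.val : ℤ) ≤ j % n, (a t : ℤ) < total a := by
      refine Finset.sum_lt_sum_of_subset (i := ⟨0, hn⟩) (Finset.filter_subset _ _) (by simp)
        (by simp) (by exact_mod_cast ha _) (by intros; positivity)
    have h4 : (0 : ℤ) ≤ ∑ t : Fin n with 1 ≤ t.val ∧ (t.val : ℤ) ≤ 0, (a t : ℤ) := by positivity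
    linarith

lemma total_pos (hn : 0 < n) (ha : ∀ i, 0 < a i) : 0 < total a :=
  Finset.sum_pos (fun i _ => by exact_mod_cast ha i) ⟨⟨0, hn⟩, by simp⟩

lemma bound_eq_bseq {i : ℕ} (hi : i + 1 < n) : (bound n a i : ℤ) = bseq a (i + 1) := by
  have h1 : ((i : ℤ) + 1) % n = i + 1 := Int.emod_eq_of_lt (by omega) (by omega)
  have h2 : ((i : ℤ) + 1) / n = 0 := Int.ediv_eq_zero_of_lt (by omega) (by omega)
  rw [bound, if_pos hi, bseq, h1, h2]
  push_cast
  rw [mul_zero, add_zero]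
  congr 1
  ext t
  simp
  omega

lemma bound_eq_total {i : ℕ} (hi : n ≤ i + 1) : (bound n a i : ℤ) = total a := by
  rw [bound, if_neg (by omega), total]; push_cast; rfl

/-- Every sum of an initial segment of a vertex is among the values of `bseq`. -/
lemma IsVertex.exists_psum_eq_bseq (hn : 0 < n) {u : RSeq} (hu : IsVertex n a u) (j : ℕ) :
    ∃ p : ℤ, psum u j = bseq a p := by
  by_contra hcon
  push Not at hcon
  have hne : ∀ (p q : ℤ), psum u j + total a * q ≠ bseq a p := by
    intro p q h
    apply hcon (p + n * (-q))
    rw [bseq_add_mul a hn]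
    push_cast
    linarith
  classical
  -- Moving all partial sums congruent to `psum u j` modulo `total a` by the same amount respects
  -- every facet through `u`. The constants, being values of `bseq`, are not in this class, so index
  -- 0 stays fixed.
  let A : Set ℕ := {i | ∃ q : ℤ, psum u i = psum u j + total a * q}
  have h0 : 0 ∉ A := by
    rintro ⟨q, hq⟩
    exact hne 0 q (by rw [← hq, bseq_zero, psum_zero]; simp)
  obtain ⟨M, hM⟩ := exists_psum_eventually_const u
  obtain ⟨z, hz⟩ := exists_psumZ_eq (f := fun i => if i ∈ A then 1 else 0) (M := M)
    (by simp [h0]) (fun i hi => by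
      have : i + 1 ∈ A ↔ i ∈ A := by
        simp only [A, Set.mem_ofPred_eq, psum_succ, hM i hi, add_zero]
      simp [this])
  have hz0 : toReal z = 0 := by
    refine hu.eq_zero_of_lin hn fun F hF => ?_
    cases F with
    | Del i =>
      have hui : u i = 0 := hF
      have : i + 1 ∈ A ↔ i ∈ A := by
        simp only [A, Set.mem_ofPred_eq, psum_succ, hui, add_zero]
      rw [lin_Del, psum_toReal, psum_toReal, hz, hz]
      simp [this]
    | Gam i =>
      have hi : (bound n a i : ℝ) = psum u (i + 1) - psum u (i + 1 - n) := by
        rw [← psi_eq_psum]; exact sub_eq_zero.mp hF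
      rw [lin_Gam, psum_toReal, psum_toReal, hz, hz]
      rcases Nat.lt_or_ge (i + 1) n with h | h
      · have hb : (bound n a i : ℝ) = bseq a (i + 1) := by exact_mod_cast bound_eq_bseq (a := a) h
        have h1 : i + 1 ∉ A := by
          rintro ⟨q, hq⟩
          refine hne (i + 1) q ?_
          rw [← hq, ← hb, hi, show i + 1 - n = 0 by omega, psum_zero, sub_zero]
        simp [h1, show i + 1 - n = 0 by omega, h0]
      · have hb : (bound n a i : ℝ) = total a := by exact_mod_cast bound_eq_total (a := a) h
        have : i + 1 ∈ A ↔ i + 1 - n ∈ A := by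
          constructor
          · rintro ⟨q, hq⟩
            exact ⟨q - 1, by push_cast; linarith⟩
          · rintro ⟨q, hq⟩
            exact ⟨q + 1, by push_cast; linarith⟩
        simp [this]
  have h1 := hz j
  have h2 := psum_toReal z j
  rw [hz0, h1, if_pos ⟨0, by simp⟩] at h2
  simp [psum] at h2

lemma IsVertex.exists_toReal_eq (hn : 0 < n) {u : RSeq} (hu : IsVertex n a u) :
    ∃ v : ZSeq, toReal v = u := by
  choose p hp using hu.exists_psum_eq_bseq hn
  obtain ⟨M, hM⟩ := exists_psum_eventually_const u
  obtain ⟨v, hv⟩ := exists_psumZ_eq (f := fun j => bseq a (p j)) (M := M)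
    (by have := hp 0; rw [psum_zero] at this; exact_mod_cast this.symm)
    (fun j hj => by
      have h1 := hp (j + 1)
      rw [psum_succ, hM j hj, add_zero, hp j] at h1
      exact_mod_cast h1.symm)
  exact ⟨v, RSeq.ext_psum fun j => by rw [psum_toReal, hv, hp]⟩

end Bounds

/-! ### The vertex cone -/

section Cone

variable {n : ℕ} {a : Fin n → ℕ}

/-- The vectors along which no facet functional vanishing at `u` decreases. -/
def InCone (n : ℕ) (a : Fin n → ℕ) (u y : RSeq) : Prop := ∀ F, slack n a F u = 0 → 0 ≤ lin n F y

/-- The facet functionals vanishing at `u` that change along `y`. -/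
def changing (n : ℕ) (a : Fin n → ℕ) (u y : RSeq) : Set FacetName :=
  {F | slack n a F u = 0 ∧ lin n F y ≠ 0}

lemma finite_changing (u y : RSeq) : (changing n a u y).Finite :=
  (finite_lin_ne_zero y).subset fun _ hF => hF.2

lemma IsVertex.changing_nonempty (hn : 0 < n) {u : RSeq} (hu : IsVertex n a u) {y : RSeq}
    (hy : y ≠ 0) : (changing n a u y).Nonempty := by
  by_contra hcon
  rw [Set.not_nonempty_iff_eq_empty, Set.eq_empty_iff_forall_notMem] at hcon
  refine hy (hu.eq_zero_of_lin hn fun F hF => ?_)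
  by_contra h
  exact hcon F ⟨hF, h⟩

lemma inCone_sub {u w : RSeq} (hw : w ∈ polytope n a) : InCone n a u (w - u) := by
  intro F hF
  rw [← slack_sub_slack (a := a), hF, sub_zero]
  exact mem_polytope_iff.mp hw F

lemma InCone.pos_of_mem_changing {u y : RSeq} (hy : InCone n a u y) {F : FacetName}
    (hF : F ∈ changing n a u y) : 0 < lin n F y := lt_of_le_of_ne (hy F hF.1) (Ne.symm hF.2)

/-- Subtracting the largest possible multiple of a vector of the cone. -/
lemma InCone.exists_sub_smul {u y z : RSeq} (hy : InCone n a u y) (hz : InCone n a u z)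
    (hne : (changing n a u z).Nonempty) (hsub : changing n a u z ⊆ changing n a u y) :
    ∃ c : ℝ, 0 ≤ c ∧ InCone n a u (y - c • z) ∧
      ∃ F ∈ changing n a u z, changing n a u (y - c • z) ⊆ changing n a u y \ {F} := by
  obtain ⟨F₁, hF₁, hmin⟩ := Set.exists_min_image _ (fun F => lin n F y / lin n F z)
    (finite_changing u z) hne
  have hpos := hz.pos_of_mem_changing hF₁
  refine ⟨lin n F₁ y / lin n F₁ z, div_nonneg (hy F₁ hF₁.1) hpos.le, fun F hF => ?_,
    F₁, hF₁, fun F hF => ⟨⟨hF.1, fun h0 => hF.2 ?_⟩, ?_⟩⟩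
  · rw [lin_sub, lin_smul, sub_nonneg]
    by_cases hFz : lin n F z = 0
    · rw [hFz, mul_zero]; exact hy F hF
    · exact (le_div_iff₀ (hz.pos_of_mem_changing ⟨hF, hFz⟩)).mp (hmin F ⟨hF, hFz⟩)
  · have hFz : lin n F z = 0 := by
      by_contra h
      exact (hsub ⟨hF.1, h⟩).2 h0
    rw [lin_sub, lin_smul, h0, hFz]; simp
  · rintro rfl
    apply hF.2
    rw [lin_sub, lin_smul, div_mul_cancel₀ _ hpos.ne', sub_self]

lemma InCone.exists_add_smul_mem {u y : RSeq} (hu : u ∈ polytope n a) (hy : InCone n a u y) :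
    ∃ c : ℝ, 0 < c ∧ u + c • y ∈ polytope n a := by
  have hu0 := mem_polytope_iff.mp hu
  set B : Set FacetName := {F | lin n F y < 0} with hB
  have hBfin : B.Finite := (finite_lin_ne_zero y).subset fun F hF => ne_of_lt hF
  rcases Set.eq_empty_or_nonempty B with h | h
  · refine ⟨1, one_pos, mem_polytope_iff.mpr fun F => ?_⟩
    rw [slack_add, lin_smul, one_mul]
    refine add_nonneg (hu0 F) ?_
    by_contra hF
    exact Set.eq_empty_iff_forall_notMem.mp h F (not_le.mp hF)
  · obtain ⟨F₁, hF₁, hmin⟩ := Set.exists_min_image B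
      (fun F => slack n a F u / (-lin n F y)) hBfin h
    have hF₁' : lin n F₁ y < 0 := hF₁
    have hpos : 0 < slack n a F₁ u := by
      refine lt_of_le_of_ne (hu0 F₁) fun h => ?_
      have := hy F₁ h.symm
      linarith
    refine ⟨slack n a F₁ u / (-lin n F₁ y), div_pos hpos (by linarith),
      mem_polytope_iff.mpr fun F => ?_⟩
    rw [slack_add, lin_smul]
    rcases lt_or_ge (lin n F y) 0 with hF | hF
    · have := (le_div_iff₀ (by linarith)).mp (hmin F hF)
      linarith
    · exact add_nonneg (hu0 F) (mul_nonneg (div_nonneg hpos.le (by linarith)) hF)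

lemma exists_slack_toReal (v : ZSeq) (F : FacetName) : ∃ c : ℤ, slack n a F (toReal v) = c := by
  cases F with
  | Gam i =>
    refine ⟨bound n a i - (psumZ v (i + 1) - psumZ v (i + 1 - n)), ?_⟩
    rw [slack, psi_eq_psum, psum_toReal, psum_toReal]; push_cast; ring
  | Del i => exact ⟨v i, rfl⟩

/-- An integer vector whose partial sums jump by at most one along each facet functional. -/
lemma InCone.exists_cut {u y : RSeq} (hy : InCone n a u y) (hy0 : y ≠ 0) :
    ∃ z : ZSeq, z ≠ 0 ∧ (∀ F, -1 ≤ lin n F (toReal z) ∧ lin n F (toReal z) ≤ 1) ∧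
      InCone n a u (toReal z) ∧ changing n a u (toReal z) ⊆ changing n a u y := by
  classical
  obtain ⟨j₀, hj₀⟩ : ∃ j, psum y j ≠ 0 := by
    by_contra hcon
    push Not at hcon
    exact hy0 (RSeq.ext_psum fun j => by rw [hcon]; simp [psum])
  -- `φ` is a unit jump between zero and the nonzero value `psum y j₀`. Applied to all partial sums
  -- it preserves their weak order and their equalities, hence membership in the cone and the
  -- functionals that do not change.
  obtain ⟨φ, hφ0, hφmono, hφb, hφj⟩ : ∃ φ : ℝ → ℤ, φ 0 = 0 ∧ Monotone φ ∧
      (∀ s t, φ s - φ t ≤ 1) ∧ φ (psum y j₀) ≠ 0 := by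
    rcases lt_or_gt_of_ne hj₀ with h | h
    · refine ⟨fun t => if t ≤ psum y j₀ then -1 else 0, by simp [h], ?_, ?_, by simp⟩
      · intro s t hst
        dsimp only
        split_ifs with h1 h2
        · exact le_rfl
        · norm_num
        · exact absurd (hst.trans ‹_›) h1
        · exact le_rfl
      · intro s t; dsimp only; split_ifs <;> norm_num
    · refine ⟨fun t => if psum y j₀ ≤ t then 1 else 0, by simp [h], ?_, ?_, by simp⟩
      · intro s t hst
        dsimp only
        split_ifs with h1 h2
        · exact le_rfl
        · exact absurd (h1.trans hst) h2
        · norm_num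
        · exact le_rfl
      · intro s t; dsimp only; split_ifs <;> norm_num
  obtain ⟨M, hM⟩ := exists_psum_eventually_const y
  obtain ⟨z, hz⟩ := exists_psumZ_eq (f := fun j => φ (psum y j)) (M := M) (by simp [psum_zero, hφ0])
    (fun j hj => by simp only [psum_succ, hM j hj, add_zero])
  have hlin : ∀ F, ∃ s t, lin n F y = s - t ∧ lin n F (toReal z) = ((φ s - φ t : ℤ) : ℝ) := by
    intro F
    cases F with
    | Gam i =>
      refine ⟨_, _, lin_Gam i y, ?_⟩
      rw [lin_Gam, psum_toReal, psum_toReal, hz, hz]; push_cast; rfl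
    | Del i =>
      refine ⟨_, _, lin_Del i y, ?_⟩
      rw [lin_Del, psum_toReal, psum_toReal, hz, hz]; push_cast; rfl
  refine ⟨z, ?_, fun F => ?_, fun F hF => ?_, fun F hF => ⟨hF.1, fun h0 => hF.2 ?_⟩⟩
  · rintro rfl
    exact hφj (by rw [← hz j₀]; simp [psumZ])
  · obtain ⟨s, t, -, h⟩ := hlin F
    rw [h]
    have h1 := hφb s t
    have h2 := hφb t s
    constructor
    · exact_mod_cast (show -1 ≤ φ s - φ t by omega)
    · exact_mod_cast h1
  · obtain ⟨s, t, h1, h⟩ := hlin F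
    have := hy F hF
    rw [h1] at this
    rw [h]
    exact_mod_cast sub_nonneg.mpr (hφmono (sub_nonneg.mp this))
  · obtain ⟨s, t, h1, h⟩ := hlin F
    rw [h1, sub_eq_zero] at h0
    rw [h, h0]; simp

lemma primitive_of_abs_le_one {z : ZSeq} (hz : z ≠ 0) (h : ∀ i, -1 ≤ z i ∧ z i ≤ 1) (d : ℕ)
    (z' : ZSeq) (hd : z = d • z') : d = 1 := by
  obtain ⟨i, hi⟩ : ∃ i, z i ≠ 0 := by
    by_contra hcon
    push Not at hcon
    exact hz (Finsupp.ext hcon)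
  have h1 : z i = d * z' i := by rw [hd]; simp
  have h2 : IsUnit (z i) := by
    rw [Int.isUnit_iff]
    have := h i
    omega
  rw [h1] at h2
  have := isUnit_of_mul_isUnit_left h2
  rw [Int.isUnit_iff] at this
  omega

/-- Every nonzero vector of the cone dominates a direction vector. -/
lemma IsVertex.exists_direction (hn : 0 < n) {u : RSeq} (hu : IsVertex n a u) {y : RSeq}
    (hy : InCone n a u y) (hy0 : y ≠ 0) :
    ∃ ε ∈ directions n a u, toReal ε ≠ 0 ∧ changing n a u (toReal ε) ⊆ changing n a u y := by
  classical
  -- Among the integer cut vectors below `y`, one with the fewest changing functionals is chosen; it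
  -- will span an edge.
  have hex : ∃ k, ∃ z : ZSeq, (z ≠ 0 ∧ (∀ F, -1 ≤ lin n F (toReal z) ∧ lin n F (toReal z) ≤ 1) ∧
      InCone n a u (toReal z) ∧ changing n a u (toReal z) ⊆ changing n a u y) ∧
      (changing n a u (toReal z)).ncard = k := by
    obtain ⟨z, hz⟩ := hy.exists_cut hy0
    exact ⟨_, z, hz, rfl⟩
  obtain ⟨z, ⟨hz0, hzb, hzc, hzy⟩, hcard⟩ := Nat.find_spec hex
  -- Minimality extends to all real vectors of the cone, because each of them can be cut again to an
  -- integer vector.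
  have hmin : ∀ y₁, InCone n a u y₁ → y₁ ≠ 0 →
      changing n a u y₁ ⊆ changing n a u (toReal z) →
      changing n a u y₁ = changing n a u (toReal z) := by
    intro y₁ h1 h2 h3
    obtain ⟨z', hz'⟩ := h1.exists_cut h2
    have h4 := Nat.find_min' hex ⟨z', ⟨hz'.1, hz'.2.1, hz'.2.2.1,
      hz'.2.2.2.trans (h3.trans hzy)⟩, rfl⟩
    rw [← hcard] at h4
    have h5 := Set.eq_of_subset_of_ncard_le (hz'.2.2.2.trans h3) h4 (finite_changing _ _)
    exact h3.antisymm (h5 ▸ hz'.2.2.2)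
  have hzr0 : toReal z ≠ 0 := by
    intro h
    exact hz0 (toReal_injective (h.trans (by ext; simp)))
  -- Integrality of `u` makes every positive slack at least one, and `z` lowers no functional by
  -- more than one.
  have huz : u + toReal z ∈ polytope n a := by
    obtain ⟨v, rfl⟩ := hu.exists_toReal_eq hn
    refine mem_polytope_iff.mpr fun F => ?_
    rw [slack_add]
    by_cases hF : slack n a F (toReal v) = 0
    · rw [hF, zero_add]; exact hzc F hF
    · have h1 := mem_polytope_iff.mp hu.1 F
      obtain ⟨c, hc⟩ := exists_slack_toReal (a := a) v F
      rw [hc] at h1 hF ⊢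
      have h2 : (0 : ℤ) ≤ c := by exact_mod_cast h1
      have h3 : c ≠ 0 := by exact_mod_cast hF
      have h4 : (1 : ℝ) ≤ c := by exact_mod_cast (show (1 : ℤ) ≤ c by omega)
      linarith [(hzb F).1]
  refine ⟨z, ⟨primitive_of_abs_le_one hz0 fun i => ?_, ?_⟩, hzr0, hzy⟩
  · have := hzb (FacetName.Del i)
    simp only [lin, toReal_apply] at this
    exact ⟨by exact_mod_cast this.1, by exact_mod_cast this.2⟩
  -- The smallest face through `u` and `u + z`.
  set e : Set RSeq := {x | x ∈ polytope n a ∧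
    ∀ F, slack n a F u = 0 → lin n F (toReal z) = 0 → slack n a F x = 0} with he
  have hue : u ∈ e := ⟨hu.1, fun F hF _ => hF⟩
  have huze : u + toReal z ∈ e := ⟨huz, fun F hF hFz => by rw [slack_add, hF, hFz, add_zero]⟩
  have hfac : ∀ F, F ∈ facetsOf n a e ↔ slack n a F u = 0 ∧ lin n F (toReal z) = 0 := by
    intro F
    constructor
    · intro hF
      have h1 := (mem_facet_iff.mp (hF hue)).2
      have h2 := (mem_facet_iff.mp (hF huze)).2
      rw [slack_add, h1, zero_add] at h2
      exact ⟨h1, h2⟩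
    · intro hF x hx
      exact mem_facet_iff.mpr ⟨hx.1, hx.2 F hF.1 hF.2⟩
  refine ⟨e, ⟨⟨u, hue, _, huze, fun h => hzr0 (by simpa using h)⟩, ?_, ?_⟩, hue, huze⟩
  · ext x
    constructor
    · intro hx
      exact ⟨hx.1, fun F hF => hF hx⟩
    · rintro ⟨hx, hF⟩
      exact ⟨hx, fun F h1 h2 => (mem_facet_iff.mp (hF F ((hfac F).mpr ⟨h1, h2⟩))).2⟩
  · intro e' he' hnt hsub F hF
    have hslack : ∀ G ∈ facetsOf n a e', ∀ w ∈ e', slack n a G w = 0 := fun G hG w hw =>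
      (mem_facet_iff.mp (hG hw)).2
    have hch : ∀ w ∈ e', w ≠ u → changing n a u (w - u) = changing n a u (toReal z) := by
      intro w hw hwu
      refine hmin _ (inCone_sub (he' hw)) (sub_ne_zero.mpr hwu) fun G hG => ⟨hG.1, fun hGz => ?_⟩
      apply hG.2
      rw [← slack_sub_slack (a := a), hG.1, hslack G (hsub ((hfac G).mpr ⟨hG.1, hGz⟩)) w hw,
        sub_zero]
    obtain ⟨w₁, hw₁, w₂, hw₂, hne⟩ := hnt
    have hFu : slack n a F u = 0 := by
      by_cases h1 : w₁ = u
      · rw [← h1]; exact hslack F hF _ hw₁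
      by_cases h2 : w₂ = u
      · rw [← h2]; exact hslack F hF _ hw₂
      have hc1 := hch w₁ hw₁ h1
      have hc2 := hch w₂ hw₂ h2
      -- Subtracting the right multiple of one vector from the other loses a changing functional, so
      -- by minimality the difference is zero and the two points are collinear with `u`. As they are
      -- distinct, a functional vanishing at both vanishes at `u`.
      obtain ⟨c, -, hcone, F₁, hF₁, hF₁s⟩ := (inCone_sub (u := u) (he' hw₁)).exists_sub_smul
        (inCone_sub (he' hw₂)) (hu.changing_nonempty hn (sub_ne_zero.mpr h2)) (by rw [hc1, hc2])
      have hzero : w₁ - u - c • (w₂ - u) = 0 := by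
        by_contra h0
        have h3 := hmin _ hcone h0 (hF₁s.trans (Set.sdiff_subset.trans hc1.subset))
        rw [hc2, ← h3] at hF₁
        exact (hF₁s hF₁).2 rfl
      have h3 := congrArg (lin n F) hzero
      rw [lin_sub, lin_smul, ← slack_sub_slack (a := a), ← slack_sub_slack (a := a),
        hslack F hF _ hw₁, hslack F hF _ hw₂, lin_zero] at h3
      have h4 : (c - 1) * slack n a F u = 0 := by linarith
      rcases mul_eq_zero.mp h4 with h5 | h5
      · rw [sub_eq_zero.mp h5, one_smul, sub_sub_sub_cancel_right] at hzero
        exact absurd (sub_eq_zero.mp hzero) hne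
      · exact h5
    refine (hfac F).mpr ⟨hFu, ?_⟩
    obtain ⟨w, hw, hwu⟩ : ∃ w ∈ e', w ≠ u := by
      by_cases h1 : w₁ = u
      · exact ⟨w₂, hw₂, fun h2 => hne (h1.trans h2.symm)⟩
      · exact ⟨w₁, hw₁, h1⟩
    by_contra hFz
    have : F ∈ changing n a u (w - u) := by rw [hch w hw hwu]; exact ⟨hFu, hFz⟩
    apply this.2
    rw [← slack_sub_slack (a := a), hFu, hslack F hF w hw, sub_zero]

lemma inCone_of_mem_directions {u : RSeq} {ε : ZSeq} (hε : ε ∈ directions n a u) :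
    InCone n a u (toReal ε) := by
  obtain ⟨-, e, he, hu, hue⟩ := hε
  rw [he.2.1] at hue
  have := inCone_sub (u := u) hue.1
  rwa [add_sub_cancel_left] at this

/-- Induction on the number of changing functionals: subtracting the largest possible multiple of a
dominated direction vector makes one of them stop changing. -/
lemma IsVertex.exists_finsupp_sum (hn : 0 < n) {u : RSeq} (hu : IsVertex n a u) (k : ℕ) :
    ∀ y : RSeq, InCone n a u y → (changing n a u y).ncard ≤ k →
      ∃ c : directions n a u →₀ ℝ, (∀ ε, 0 ≤ c ε) ∧
        y = c.sum fun ε r => r • toReal (ε : ZSeq) := by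
  classical
  induction k with
  | zero =>
    intro y hy hk
    refine ⟨0, fun _ => le_rfl, ?_⟩
    rw [Finsupp.sum_zero_index]
    by_contra hy0
    have h1 := hu.changing_nonempty hn hy0
    rw [← Set.ncard_pos (finite_changing u y)] at h1
    omega
  | succ k ih =>
    intro y hy hk
    by_cases hy0 : y = 0
    · exact ⟨0, fun _ => le_rfl, by rw [Finsupp.sum_zero_index, hy0]⟩
    obtain ⟨ε, hε, hε0, hsub⟩ := hu.exists_direction hn hy hy0
    obtain ⟨c₀, hc₀, hcone, F, hF, hFs⟩ := hy.exists_sub_smul (inCone_of_mem_directions hε)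
      (hu.changing_nonempty hn hε0) hsub
    have hcard : (changing n a u (y - c₀ • toReal ε)).ncard ≤ k := by
      have h1 := Set.ncard_le_ncard hFs ((finite_changing u y).subset Set.sdiff_subset)
      have h2 := Set.ncard_sdiff_singleton_add_one (hsub hF) (finite_changing u y)
      omega
    obtain ⟨c, hc, hsum⟩ := ih _ hcone hcard
    refine ⟨c + Finsupp.single ⟨ε, hε⟩ c₀, fun δ => ?_, ?_⟩
    · rw [Finsupp.add_apply]
      refine add_nonneg (hc δ) ?_
      rw [Finsupp.single_apply]
      split_ifs
      · exact hc₀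
      · exact le_rfl
    · rw [Finsupp.sum_add_index' (by simp) (by intros; rw [add_smul]), ← hsum,
        Finsupp.sum_single_index (by simp)]
      simp

/-- The vertex cone is cut out by the inequalities of the facets that contain the vertex. -/
theorem IsVertex.mem_vertexCone_iff (hn : 0 < n) {u : RSeq} (hu : IsVertex n a u) {x : RSeq} :
    x ∈ vertexCone n a u ↔ ∀ F, slack n a F u = 0 → 0 ≤ slack n a F x := by
  constructor
  · rintro ⟨c, hc, rfl⟩ F hF
    rw [slack_add, hF, zero_add]
    change 0 ≤ linHom n F _
    rw [map_finsuppSum]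
    refine Finset.sum_nonneg fun ε _ => ?_
    dsimp only
    rw [map_smul]
    exact mul_nonneg (hc ε) (inCone_of_mem_directions ε.2 F hF)
  · intro h
    have hy : InCone n a u (x - u) := fun F hF => by
      rw [← slack_sub_slack (a := a), hF, sub_zero]; exact h F hF
    obtain ⟨c, hc, hsum⟩ := hu.exists_finsupp_sum hn _ _ hy le_rfl
    exact ⟨c, hc, by rw [← hsum]; abel⟩

/-- If the facet functionals vanishing at a vertex have a dual system of integer vectors, then the
vertex is simple. -/
theorem IsVertex.isSimpleVertex_of_dual (hn : 0 < n) {u : RSeq} (hu : IsVertex n a u)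
    (h : ∀ F, slack n a F u = 0 → ∃ z : ZSeq, lin n F (toReal z) = 1 ∧
      ∀ F', slack n a F' u = 0 → F' ≠ F → lin n F' (toReal z) = 0) :
    IsSimpleVertex n a u := by
  classical
  have key : ∀ ε : directions n a u, ∃ F, slack n a F u = 0 ∧ lin n F (toReal ε) = 1 ∧
      ∀ F', slack n a F' u = 0 → F' ≠ F → lin n F' (toReal ε) = 0 := by
    rintro ⟨ε, hε⟩
    have hcone := inCone_of_mem_directions hε
    obtain ⟨hprim, e, he, hue, huεe⟩ := hε
    have hε0 : toReal ε ≠ 0 := by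
      intro h0
      have : ε = 0 := toReal_injective (h0.trans (by ext; simp))
      have := hprim 0 0 (by rw [this]; simp)
      omega
    obtain ⟨F, hF⟩ := hu.changing_nonempty hn hε0
    -- If `ε` also changed `F'`, a segment from `u` along the dual vector of `F'` would lie in all
    -- facets containing the edge and in `F` besides, against the maximality in the definition of an
    -- edge.
    have huniq : ∀ F', slack n a F' u = 0 → F' ≠ F → lin n F' (toReal ε) = 0 := by
      intro F' hF' hne
      by_contra h0
      obtain ⟨z, hz1, hz⟩ := h F' hF'
      have hzcone : InCone n a u (toReal z) := fun G hG => by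
        by_cases hGF : G = F'
        · rw [hGF, hz1]; exact zero_le_one
        · rw [hz G hG hGF]
      obtain ⟨c, hc, hmem⟩ := hzcone.exists_add_smul_mem hu.1
      have hz0 : toReal z ≠ 0 := fun h => by rw [h, lin_zero] at hz1; exact zero_ne_one hz1
      have hle : ∀ G, slack n a G u = 0 → lin n G (toReal z) = 0 →
          G ∈ facetsOf n a {u, u + c • toReal z} := by
        rintro G hG hGz x (rfl | rfl)
        · exact mem_facet_iff.mpr ⟨hu.1, hG⟩
        · exact mem_facet_iff.mpr ⟨hmem, by rw [slack_add, lin_smul, hG, hGz]; simp⟩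
      have hsub := he.2.2 {u, u + c • toReal z} (by rintro x (rfl | rfl); exacts [hu.1, hmem])
        ⟨u, by simp, u + c • toReal z, by simp, by simp [hc.ne', hz0]⟩ (by
          intro G hG
          have h1 := (mem_facet_iff.mp (hG hue)).2
          have h2 := (mem_facet_iff.mp (hG huεe)).2
          rw [slack_add, h1, zero_add] at h2
          refine hle G h1 (hz G h1 ?_)
          rintro rfl
          exact h0 h2)
      have h3 := hsub (hle F hF.1 (hz F hF.1 (Ne.symm hne)))
      have h4 := (mem_facet_iff.mp (h3 huεe)).2
      rw [slack_add, hF.1, zero_add] at h4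
      exact hF.2 h4
    obtain ⟨z, hz1, hz⟩ := h F hF.1
    have hεz : toReal ε = lin n F (toReal ε) • toReal z := by
      rw [← sub_eq_zero]
      refine hu.eq_zero_of_lin hn fun G hG => ?_
      rw [lin_sub, lin_smul]
      by_cases hGF : G = F
      · rw [hGF, hz1, mul_one, sub_self]
      · rw [huniq G hG hGF, hz G hG hGF, mul_zero, sub_zero]
    obtain ⟨v, rfl⟩ := hu.exists_toReal_eq hn
    obtain ⟨c₁, hc₁⟩ := exists_slack_toReal (a := a) (v + ε) F
    have hadd : toReal (v + ε) = toReal v + toReal ε := by ext; simp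
    rw [hadd, slack_add, hF.1, zero_add] at hc₁
    have hpos := hcone.pos_of_mem_changing hF
    have hc₁0 : 0 < c₁ := by rw [hc₁] at hpos; exact_mod_cast hpos
    -- The direction vector is an integral multiple of the dual vector, and primitivity makes the
    -- factor one.
    have hd := hprim c₁.toNat z (by
      apply toReal_injective
      rw [hεz, hc₁]
      ext i
      have h5 : ((c₁.toNat : ℤ) : ℝ) = c₁ := by rw [Int.toNat_of_nonneg hc₁0.le]
      simp only [Finsupp.smul_apply, toReal_apply, smul_eq_mul, nsmul_eq_mul]
      push_cast at h5 ⊢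
      rw [h5])
    refine ⟨F, hF.1, ?_, huniq⟩
    rw [hc₁, show c₁ = 1 by omega]; simp
  choose Φ hΦ0 hΦ1 hΦ using key
  have hinj : Function.Injective Φ := by
    intro ε ε' heq
    apply Subtype.ext
    apply toReal_injective
    rw [← sub_eq_zero]
    refine hu.eq_zero_of_lin hn fun G hG => ?_
    rw [lin_sub]
    by_cases hGF : G = Φ ε
    · rw [hGF, hΦ1, heq, hΦ1, sub_self]
    · rw [hΦ ε G hG hGF, hΦ ε' G hG (heq ▸ hGF), sub_self]
  rw [IsSimpleVertex, linearIndependent_iff']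
  intro s g hg ε hε
  have h1 := congrArg (linHom n (Φ ε)) hg
  rw [map_sum, map_zero, Finset.sum_eq_single_of_mem ε hε] at h1
  · rw [map_smul] at h1
    change g ε * lin n (Φ ε) (toReal ε) = 0 at h1
    rwa [hΦ1, mul_one] at h1
  · intro ε' _ hne
    rw [map_smul]
    change g ε' * lin n (Φ ε) (toReal ε') = 0
    rw [hΦ ε' (Φ ε) (hΦ0 ε) fun h => hne (hinj h).symm, mul_zero]

end Cone

/-! ### The grid of partial sums -/

section Grid

variable {n : ℕ} (a : Fin n → ℕ)

/-- The partial sums of a sequence, extended to negative indices by `bseq`. -/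
def extSum (x : ZSeq) (j : ℤ) : ℤ := if j ≤ 0 then bseq a j else psumZ x j.toNat

lemma extSum_of_nonpos (x : ZSeq) {j : ℤ} (hj : j ≤ 0) : extSum a x j = bseq a j := if_pos hj

lemma extSum_natCast (x : ZSeq) (j : ℕ) : extSum a x j = psumZ x j := by
  rcases Nat.eq_zero_or_pos j with rfl | hj
  · rw [Nat.cast_zero, extSum_of_nonpos a x le_rfl, bseq_zero]; rfl
  · rw [extSum, if_neg (by omega), Int.toNat_natCast]

lemma slack_Del_toReal (x : ZSeq) (i : ℕ) :
    slack n a (FacetName.Del i) (toReal x) =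
      ((extSum a x (i + 1) - extSum a x i : ℤ) : ℝ) := by
  have h := extSum_natCast a x (i + 1)
  rw [Nat.cast_succ] at h
  rw [h, extSum_natCast, psumZ_succ, add_sub_cancel_left]; rfl

lemma slack_Gam_toReal (hn : 0 < n) (x : ZSeq) (i : ℕ) :
    slack n a (FacetName.Gam i) (toReal x) =
      ((extSum a x (i + 1 - n) + total a - extSum a x (i + 1) : ℤ) : ℝ) := by
  have h := extSum_natCast a x (i + 1)
  rw [Nat.cast_succ] at h
  rw [slack, psi_eq_psum, psum_toReal, psum_toReal, h]
  rcases Nat.lt_or_ge (i + 1) n with hi | hi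
  · have hb : (bound n a i : ℝ) = bseq a (i + 1) := by exact_mod_cast bound_eq_bseq (a := a) hi
    rw [extSum_of_nonpos a x (by omega), ← bseq_add a hn, sub_add_cancel, hb,
      show i + 1 - n = 0 by omega]
    simp [psumZ]
  · have hb : (bound n a i : ℝ) = total a := by exact_mod_cast bound_eq_total (a := a) hi
    have h2 := extSum_natCast a x (i + 1 - n)
    rw [Nat.cast_sub hi, Nat.cast_succ] at h2
    rw [h2, hb]; push_cast; ring

/-- The extended partial sums, unrolled along the plane. -/
def gridSum (x : ZSeq) (p q : ℤ) : ℤ := extSum a x (p - n * q) + total a * q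

variable {a}

lemma extSum_le_succ {v : ZSeq} (hn : 0 < n) (ha : ∀ i, 0 < a i)
    (hv : toReal v ∈ polytope n a) (j : ℤ) : extSum a v j ≤ extSum a v (j + 1) := by
  rcases lt_or_ge j 0 with hj | hj
  · rw [extSum_of_nonpos a v hj.le, extSum_of_nonpos a v (by omega)]
    exact (bseq_strictMono hn ha (by omega)).le
  · lift j to ℕ using hj
    have := mem_polytope_iff.mp hv (FacetName.Del j)
    rw [slack_Del_toReal] at this
    exact sub_nonneg.mp (by exact_mod_cast this)

lemma extSum_le_sub {v : ZSeq} (hn : 0 < n)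
    (hv : toReal v ∈ polytope n a) (j : ℤ) : extSum a v j ≤ extSum a v (j - n) + total a := by
  rcases le_or_gt j 0 with hj | hj
  · rw [extSum_of_nonpos a v hj, extSum_of_nonpos a v (by omega), ← bseq_add a hn,
      sub_add_cancel]
  · obtain ⟨i, rfl⟩ : ∃ i : ℕ, j = i + 1 := ⟨(j - 1).toNat, by omega⟩
    have := mem_polytope_iff.mp hv (FacetName.Gam i)
    rw [slack_Gam_toReal a hn] at this
    exact sub_nonneg.mp (by exact_mod_cast this)

lemma gridSum_le_left {v : ZSeq} (hn : 0 < n) (ha : ∀ i, 0 < a i)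
    (hv : toReal v ∈ polytope n a) (p q : ℤ) : gridSum a v p q ≤ gridSum a v (p + 1) q := by
  have := extSum_le_succ hn ha hv (p - n * q)
  rw [gridSum, gridSum, show p + 1 - n * q = p - n * q + 1 by ring]
  omega

lemma gridSum_le_right {v : ZSeq} (hn : 0 < n)
    (hv : toReal v ∈ polytope n a) (p q : ℤ) : gridSum a v p q ≤ gridSum a v p (q + 1) := by
  have := extSum_le_sub hn hv (p - n * q)
  rw [gridSum, gridSum, show p - n * (q + 1) = p - n * q - n by ring, mul_add]
  omega

lemma gridSum_mono {v : ZSeq} (hn : 0 < n) (ha : ∀ i, 0 < a i)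
    (hv : toReal v ∈ polytope n a) {p p' q q' : ℤ} (hp : p ≤ p') (hq : q ≤ q') :
    gridSum a v p q ≤ gridSum a v p' q' :=
  (monotone_int_of_le_succ (fun p => gridSum_le_left hn ha hv p q) hp).trans
    (monotone_int_of_le_succ (fun q => gridSum_le_right hn hv p' q) hq)

lemma gridSum_of_nonpos (hn : 0 < n) (v : ZSeq) {p q : ℤ} (h : p - n * q ≤ 0) :
    gridSum a v p q = bseq a p := by
  rw [gridSum, extSum_of_nonpos a v h, ← bseq_add_mul a hn]
  congr 1; ring

/-- A point of the grid: `(j, q)` lies in the row `j + (n - 1) q` and has the value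
`extSum j + total q`. -/
def AtLevel (a : Fin n → ℕ) (v : ZSeq) (c : ℤ) (j q : ℤ) : Prop :=
  extSum a v j + total a * q = bseq a c

lemma atLevel_iff_gridSum (v : ZSeq) (c j q : ℤ) :
    AtLevel a v c j q ↔ gridSum a v (j + n * q) q = bseq a c := by
  rw [AtLevel, gridSum, add_sub_cancel_right]

lemma AtLevel.right_unique (hn : 0 < n) (ha : ∀ i, 0 < a i) {v : ZSeq} {c j q q' : ℤ}
    (h : AtLevel a v c j q) (h' : AtLevel a v c j q') : q = q' := by
  rw [AtLevel] at h h'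
  have := total_pos hn ha
  exact mul_left_cancel₀ this.ne' (by omega)

lemma AtLevel.eq_of_nonpos (hn : 0 < n) (ha : ∀ i, 0 < a i) {v : ZSeq} {c j q : ℤ}
    (h : AtLevel a v c j q) (hj : j ≤ 0) : j + n * q = c := by
  rw [atLevel_iff_gridSum, gridSum_of_nonpos hn v (by omega)] at h
  exact (bseq_strictMono hn ha).injective h

/-- Constants of the level satisfy `j + n * q = c`, so their row is `c - q`; the bound on `c` forces
`q ≥ 0`. -/
lemma AtLevel.row_le_of_nonpos (hn : 0 < n) (ha : ∀ i, 0 < a i) {v : ZSeq} {c j q : ℤ}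
    (hc : -n < c) (h : AtLevel a v c j q) (hj : j ≤ 0) : j + (n - 1) * q ≤ c := by
  have h1 := h.eq_of_nonpos hn ha hj
  have hq : 0 ≤ q := by
    by_contra hq
    have : (n : ℤ) * q ≤ n * (-1) := by
      apply mul_le_mul_of_nonneg_left (by omega) (by omega)
    omega
  linarith

/-- In a row at most `c`, an entry with positive index would lie weakly below the grid point `(c -
1, 0)`, whose value `bseq a (c - 1)` is too small. Hence the constant `(c, 0)` separates the
variables of a level, which lie above its row, from the other constants, which lie below it. -/
lemma AtLevel.lt_row_of_pos (hn : 0 < n) (ha : ∀ i, 0 < a i) {v : ZSeq}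
    (hv : toReal v ∈ polytope n a) {c j q : ℤ}
    (hc : c ≤ 0) (h : AtLevel a v c j q) (hj : 0 < j) : c < j + (n - 1) * q := by
  by_contra hcon
  push Not at hcon
  rcases lt_or_ge 0 q with hq | hq
  · have : 0 ≤ ((n : ℤ) - 1) * q := mul_nonneg (by omega) hq.le
    omega
  · rw [atLevel_iff_gridSum] at h
    have h1 : j + n * q = j + (n - 1) * q + q := by ring
    rcases lt_or_ge (j + n * q) c with hp | hp
    · have h2 := gridSum_mono hn ha hv (show j + n * q ≤ c - 1 by omega) hq
      rw [gridSum_of_nonpos hn v (p := c - 1) (q := 0) (by omega), h] at h2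
      exact absurd (bseq_strictMono hn ha (show c - 1 < c by omega)) (not_lt.mpr h2)
    · obtain rfl : q = 0 := by omega
      omega

/-- Two level points in the same row agree unless both have positive index. -/
lemma AtLevel.unique_of_nonpos (hn : 0 < n) (ha : ∀ i, 0 < a i) {v : ZSeq}
    (hv : toReal v ∈ polytope n a) {c j q j' q' : ℤ} (hc : -n < c) (hc' : c ≤ 0)
    (h : AtLevel a v c j q) (h' : AtLevel a v c j' q')
    (hrow : j + (n - 1) * q = j' + (n - 1) * q') (hge : c ≤ j + (n - 1) * q) (hj : j ≤ 0) :
    j = j' ∧ q = q' ∧ q = 0 := by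
  have h1 := h.row_le_of_nonpos hn ha hc hj
  have hj' : j' ≤ 0 := by
    by_contra hj'
    have := h'.lt_row_of_pos hn ha hv hc' (by omega)
    omega
  have h2 := h.eq_of_nonpos hn ha hj
  have h3 := h'.eq_of_nonpos hn ha hj'
  have h4 : q = q' := by linarith
  have h5 : q = 0 := by linarith
  subst h4 h5
  simp at hrow
  exact ⟨hrow, rfl, rfl⟩

/-- The end of a facet functional in the lower row. -/
def leftEnd (n : ℕ) : FacetName → ℤ × ℤ
  | FacetName.Gam i => (i + 1 - n, 1)
  | FacetName.Del i => (i, 0)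

/-- The end of a facet functional in the upper row. -/
def rightEnd : FacetName → ℤ
  | FacetName.Gam i => i + 1
  | FacetName.Del i => i + 1

/-- The sign of a facet functional. -/
def facetSign : FacetName → ℤ
  | FacetName.Gam _ => -1
  | FacetName.Del _ => 1

lemma rightEnd_pos (F : FacetName) : 0 < rightEnd F := by
  cases F <;> simp only [rightEnd] <;> omega

/-- The reason for the choice of rows: both kinds of facets join neighbouring rows. -/
lemma row_leftEnd (F : FacetName) :
    (leftEnd n F).1 + (n - 1) * (leftEnd n F).2 + 1 = rightEnd F := by
  cases F <;> simp only [leftEnd, rightEnd] <;> ring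

/-- For `n = 1` the facets `Γ_i` and `Δ_i` would have the same end indices. -/
lemma facetName_ext (hn : 2 ≤ n) {F F' : FacetName} (h1 : (leftEnd n F).1 = (leftEnd n F').1)
    (h2 : rightEnd F = rightEnd F') : F = F' := by
  cases F <;> cases F' <;> simp only [leftEnd, rightEnd] at h1 h2 <;> first | omega | congr; omega

lemma slack_toReal_eq (hn : 0 < n) (x : ZSeq) (F : FacetName) :
    slack n a F (toReal x) = ((facetSign F * (extSum a x (rightEnd F) -
      (extSum a x (leftEnd n F).1 + total a * (leftEnd n F).2)) : ℤ) : ℝ) := by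
  cases F with
  | Gam i =>
    rw [slack_Gam_toReal a hn]
    simp only [leftEnd, rightEnd, facetSign]; push_cast; ring
  | Del i =>
    rw [slack_Del_toReal]
    simp only [leftEnd, rightEnd, facetSign]; push_cast; ring

/-- The two ends of a facet functional vanishing at a point lie on the same levels. -/
lemma atLevel_leftEnd_iff (hn : 0 < n) {v : ZSeq} {F : FacetName}
    (hF : slack n a F (toReal v) = 0) (c q : ℤ) :
    AtLevel a v c (rightEnd F) q ↔ AtLevel a v c (leftEnd n F).1 ((leftEnd n F).2 + q) := by
  rw [slack_toReal_eq hn] at hF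
  have h1 : extSum a v (rightEnd F) = extSum a v (leftEnd n F).1 + total a * (leftEnd n F).2 := by
    have h2 : facetSign F * (extSum a v (rightEnd F) -
      (extSum a v (leftEnd n F).1 + total a * (leftEnd n F).2)) = 0 := by exact_mod_cast hF
    rcases mul_eq_zero.mp h2 with h3 | h3
    · cases F <;> simp [facetSign] at h3
    · omega
  rw [AtLevel, AtLevel, h1, mul_add, add_assoc]

lemma lin_toReal_eq (z : ZSeq) {f : ℤ → ℤ} (hf : ∀ j : ℕ, psumZ z j = f j)
    (hf0 : ∀ j ≤ 0, f j = 0) (F : FacetName) :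
    lin n F (toReal z) = ((facetSign F * (f (rightEnd F) - f (leftEnd n F).1) : ℤ) : ℝ) := by
  cases F with
  | Gam i =>
    rw [lin_Gam, psum_toReal, psum_toReal, hf, hf]
    simp only [leftEnd, rightEnd, facetSign]
    have h : f ((i + 1 - n : ℕ) : ℤ) = f (i + 1 - n) := by
      rcases Nat.lt_or_ge (i + 1) n with hi | hi
      · rw [hf0 _ (by omega), hf0 _ (by omega)]
      · rw [Nat.cast_sub hi, Nat.cast_succ]
    rw [h]; push_cast; ring
  | Del i =>
    rw [lin_Del, psum_toReal, psum_toReal, hf, hf]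
    simp only [leftEnd, rightEnd, facetSign]
    push_cast; ring

/-- Every value of the extended partial sums of a vertex has a level in the fundamental range. -/
lemma exists_atLevel (hn : 0 < n) {v : ZSeq} (hu : IsVertex n a (toReal v)) (j : ℕ) :
    ∃ c q : ℤ, -n < c ∧ c ≤ 0 ∧ AtLevel a v c j q := by
  obtain ⟨p, hp⟩ := hu.exists_psum_eq_bseq hn j
  rw [psum_toReal] at hp
  have hp' : psumZ v j = bseq a p := by exact_mod_cast hp
  have hn' : (0 : ℤ) < n := by exact_mod_cast hn
  have h1 := Int.emod_nonneg (-p) hn'.ne'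
  have h2 := Int.emod_lt_of_pos (-p) hn'
  have h3 := Int.emod_add_mul_ediv (-p) n
  refine ⟨-((-p) % n), (-p) / n, by omega, by omega, ?_⟩
  rw [AtLevel, extSum_natCast, hp', ← bseq_add_mul a hn]
  congr 1; linarith

/-- At a vertex that is not simple some row contains two entries of the same level. -/
theorem IsVertex.exists_same_row (hn : 2 ≤ n) (ha : ∀ i, 0 < a i) {v : ZSeq}
    (hu : IsVertex n a (toReal v)) (hns : ¬ IsSimpleVertex n a (toReal v)) :
    ∃ c j q j' q' : ℤ, -n < c ∧ c ≤ 0 ∧ 0 < j ∧ 0 < j' ∧ AtLevel a v c j q ∧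
      AtLevel a v c j' q' ∧ j + (n - 1) * q = j' + (n - 1) * q' ∧ j ≠ j' := by
  classical
  by_contra hcon
  push Not at hcon
  have hn0 : 0 < n := by omega
  have hv := hu.1
  refine hns (hu.isSimpleVertex_of_dual hn0 fun F hF => ?_)
  have htight := fun G hG => atLevel_leftEnd_iff (v := v) (a := a) hn0 (F := G) hG
  obtain ⟨c, q₀, hc, hc', hlev⟩ := exists_atLevel hn0 hu (rightEnd F).toNat
  rw [Int.toNat_of_nonneg (rightEnd_pos F).le] at hlev
  set ρ := rightEnd F + (n - 1) * q₀ with hρ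
  have hρc : c < ρ := hlev.lt_row_of_pos hn0 ha hv hc' (rightEnd_pos F)
  have huniq : ∀ j q j' q', AtLevel a v c j q → AtLevel a v c j' q' →
      j + (n - 1) * q = j' + (n - 1) * q' → c ≤ j + (n - 1) * q → j = j' ∧ q = q' := by
    intro j q j' q' h h' hrow hge
    rcases le_or_gt j 0 with hj | hj
    · have := h.unique_of_nonpos hn0 ha hv hc hc' h' hrow hge hj
      exact ⟨this.1, this.2.1⟩
    rcases le_or_gt j' 0 with hj' | hj'
    · have := h'.unique_of_nonpos hn0 ha hv hc hc' h hrow.symm (hrow ▸ hge) hj'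
      exact ⟨this.1.symm, this.2.1.symm⟩
    have hjj := hcon c j q j' q' hc hc' hj hj' h h' hrow
    subst hjj
    exact ⟨rfl, h.right_unique hn0 ha h'⟩
  -- The dual vector raises the partial sums of level `c` in the rows from `ρ` on. A tight
  -- functional sees this only if it passes from the row `ρ - 1` to the row `ρ` within the level,
  -- and when rows have no repetitions `F` is the only one.
  let A : Set ℤ := {j | ∃ q, AtLevel a v c j q ∧ ρ ≤ j + (n - 1) * q}
  have hA0 : ∀ j ≤ 0, j ∉ A := by
    rintro j hj ⟨q, hq, hge⟩
    have := hq.row_le_of_nonpos hn0 ha hc hj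
    omega
  have hAiff : ∀ j q, AtLevel a v c j q → (j ∈ A ↔ ρ ≤ j + (n - 1) * q) := by
    intro j q h
    constructor
    · rintro ⟨q', h', hge⟩
      rwa [h.right_unique hn0 ha h']
    · exact fun hge => ⟨q, h, hge⟩
  let f : ℤ → ℤ := fun j => if j ∈ A then 1 else 0
  have hf0 : ∀ j ≤ 0, f j = 0 := fun j hj => if_neg (hA0 j hj)
  obtain ⟨M, hM⟩ := exists_psum_eventually_const (toReal v)
  have hext : ∀ j : ℕ, M ≤ j → extSum a v j = extSum a v M := by
    intro j hj
    rw [extSum_natCast, extSum_natCast]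
    have := psum_eq_of_ge hM hj
    rw [psum_toReal, psum_toReal] at this
    exact_mod_cast this
  -- Finite support of the dual vector: the partial sums of `v` are constant beyond `M`, so all
  -- sufficiently large indices belong to `A`, or none does.
  obtain ⟨M', hM'⟩ : ∃ M' : ℕ, ∀ j ≥ M', f ((j + 1 : ℕ) : ℤ) = f (j : ℤ) := by
    by_cases hex : ∃ q, AtLevel a v c M q
    · obtain ⟨q, hq⟩ := hex
      have hmem : ∀ j : ℕ, M + (ρ - (n - 1) * q).toNat ≤ j → (j : ℤ) ∈ A := by
        intro j hj
        refine ⟨q, ?_, by omega⟩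
        rw [AtLevel, hext j (by omega)]; exact hq
      refine ⟨M + (ρ - (n - 1) * q).toNat, fun j hj => ?_⟩
      simp only [f, if_pos (hmem j hj), if_pos (hmem (j + 1) (by omega))]
    · have hmem : ∀ j : ℕ, M ≤ j → (j : ℤ) ∉ A := by
        rintro j hj ⟨q, hq, -⟩
        refine hex ⟨q, ?_⟩
        rw [AtLevel, ← hext j hj]; exact hq
      exact ⟨M, fun j hj => by simp only [f, if_neg (hmem j hj), if_neg (hmem (j + 1) (by omega))]⟩
  obtain ⟨z, hz⟩ := exists_psumZ_eq (f := fun j : ℕ => f j) (M := M') (hf0 0 le_rfl) hM'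
  have hlin := lin_toReal_eq (n := n) z hz hf0
  have hFright : f (rightEnd F) = 1 := if_pos ((hAiff _ _ hlev).mpr le_rfl)
  have hFleft : f (leftEnd n F).1 = 0 := by
    refine if_neg fun h => ?_
    rw [hAiff _ _ ((htight F hF c q₀).mp hlev)] at h
    have := row_leftEnd (n := n) F
    linarith
  have hother : ∀ G, slack n a G (toReal v) = 0 → G ≠ F →
      f (rightEnd G) = f (leftEnd n G).1 := by
    intro G hG hne
    have hrow := row_leftEnd (n := n) G
    by_cases hex : ∃ q, AtLevel a v c (rightEnd G) q
    · obtain ⟨q, hq⟩ := hex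
      have hq' := (htight G hG c q).mp hq
      have hiff : rightEnd G ∈ A ↔ (leftEnd n G).1 ∈ A := by
        rw [hAiff _ _ hq, hAiff _ _ hq']
        constructor
        · intro hge
          by_contra hlt
          have heq : rightEnd G + (n - 1) * q = ρ := by linarith
          obtain ⟨h1, h2⟩ := huniq _ _ _ _ hq hlev heq (by omega)
          have hrowF := row_leftEnd (n := n) F
          have h3 := huniq _ _ _ _ hq' ((htight F hF c q₀).mp hlev) (by linarith) (by linarith)
          exact hne (facetName_ext hn h3.1 h1)
        · intro hge
          linarith
      simp only [f, hiff]
    · have h1 : rightEnd G ∉ A := fun ⟨q, hq, _⟩ => hex ⟨q, hq⟩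
      have h2 : (leftEnd n G).1 ∉ A := fun ⟨q, hq, _⟩ => hex ⟨q - (leftEnd n G).2, by
        rw [htight G hG]; convert hq using 1; ring⟩
      simp only [f, if_neg h1, if_neg h2]
  -- The functional of `Γ_i` is the upper end subtracted from the lower one, so the vector is
  -- negated in that case.
  refine ⟨facetSign F • z, ?_, fun G hG hne => ?_⟩
  · have hsmul : toReal (facetSign F • z) = (facetSign F : ℝ) • toReal z := by ext; simp
    rw [hsmul, lin_smul, hlin, hFright, hFleft]
    cases F <;> simp [facetSign]
  · have hsmul : toReal (facetSign F • z) = (facetSign F : ℝ) • toReal z := by ext; simp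
    rw [hsmul, lin_smul, hlin, hother G hG hne]
    simp

end Grid

/-! ### Coordinates by partial sums -/

section Iota

variable {m : ℕ}

/-- The sequence whose partial sums are `1` at `j + 1` and `0` at the other indices up to `m`. -/
def stepVec (m : ℕ) (j : Fin m) : ZSeq :=
  Finsupp.single (j : ℕ) 1 - if (j : ℕ) + 1 < m then Finsupp.single ((j : ℕ) + 1) 1 else 0

variable (m) in
/-- The sequence with prescribed partial sums whose terms vanish from the index `m` on. -/
def ofPartialSums : (Fin m → ℤ) →+ ZSeq where
  toFun T := ∑ j, T j • stepVec m j
  map_zero' := by simp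
  map_add' T T' := by simp [add_smul, Finset.sum_add_distrib]

lemma ofPartialSums_eq_sum (T : Fin m → ℤ) : ofPartialSums m T = ∑ j, T j • stepVec m j := rfl

lemma stepVec_apply (j : Fin m) (i : ℕ) : stepVec m j i =
    (if i = j then 1 else 0) - if (j : ℕ) + 1 < m ∧ i = j + 1 then 1 else 0 := by
  rw [stepVec, Finsupp.sub_apply, Finsupp.single_apply]
  by_cases h : (j : ℕ) + 1 < m
  · simp [h, Finsupp.single_apply, eq_comm]
  · simp [h, eq_comm]

lemma psumZ_stepVec (j i : Fin m) : psumZ (stepVec m j) (i + 1) = if j = i then 1 else 0 := by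
  have h1 : ∀ (k l : ℕ), ∑ t ∈ Finset.range k, (if t = l then (1 : ℤ) else 0) =
      if l < k then 1 else 0 := fun k l => by
    rw [Finset.sum_ite_eq']; simp
  simp only [psumZ, stepVec_apply, Finset.sum_sub_distrib, h1]
  have hi := i.2
  by_cases h : (j : ℕ) + 1 < m
  · simp only [h, true_and, h1, Fin.ext_iff]
    split_ifs <;> omega
  · simp only [h, false_and, if_false, Finset.sum_const_zero, Fin.ext_iff]
    have hj := j.2
    split_ifs <;> omega

lemma psumZ_ofPartialSums (T : Fin m → ℤ) (i : Fin m) :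
    psumZ (ofPartialSums m T) (i + 1) = T i := by
  have h : psumZ (ofPartialSums m T) (i + 1) = ∑ j, T j * psumZ (stepVec m j) (i + 1) := by
    simp only [psumZ, ofPartialSums_eq_sum, Finsupp.coe_finsetSum, Finset.sum_apply,
      Finsupp.smul_apply, smul_eq_mul, Finset.mul_sum]
    exact Finset.sum_comm
  rw [h]
  simp [psumZ_stepVec]

lemma ofPartialSums_apply_of_ge (T : Fin m → ℤ) {i : ℕ} (hi : m ≤ i) :
    ofPartialSums m T i = 0 := by
  rw [ofPartialSums_eq_sum, Finsupp.coe_finsetSum, Finset.sum_apply]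
  refine Finset.sum_eq_zero fun j _ => ?_
  have hj := j.2
  rw [Finsupp.smul_apply, stepVec_apply, if_neg (by omega), if_neg (by omega)]
  simp

variable (m) in
lemma ofPartialSums_injective : Function.Injective (ofPartialSums m) := by
  intro T T' h
  funext i
  rw [← psumZ_ofPartialSums T, h, psumZ_ofPartialSums]

lemma mem_range_ofPartialSums {x : ZSeq} (hx : ∀ i, m ≤ i → x i = 0) :
    x ∈ Set.range (ofPartialSums m) := by
  set T : Fin m → ℤ := fun j => psumZ x (j + 1) with hT
  have key : ∀ j ≤ m, psumZ (ofPartialSums m T) j = psumZ x j := by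
    intro j hj
    rcases Nat.eq_zero_or_pos j with rfl | hj0
    · rfl
    · obtain ⟨i, rfl⟩ : ∃ i, j = i + 1 := ⟨j - 1, by omega⟩
      exact psumZ_ofPartialSums T ⟨i, hj⟩
  refine ⟨T, ZSeq.ext_psumZ fun j => ?_⟩
  rcases le_total j m with hj | hj
  · exact key j hj
  · induction j, hj using Nat.le_induction with
    | base => exact key m le_rfl
    | succ j hj ih => rw [psumZ_succ, psumZ_succ, ih, ofPartialSums_apply_of_ge T hj, hx j hj]

end Iota

/-! ### Weights of the partial sum coordinates. -/

section Weight

variable {n m : ℕ}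

lemma weight_single (i : ℕ) (c : ℤ) : weight n (Finsupp.single i c) = c • gamma n i := by
  change Finsupp.sum _ (fun i c => c • gamma n i) = _
  exact Finsupp.sum_single_index (zero_smul ℤ (gamma n i))

/-- The weight of a coordinate direction. -/
def stepWeight (n : ℕ) {m : ℕ} (j : Fin m) : RootLattice n :=
  gamma n j - if (j : ℕ) + 1 < m then gamma n (j + 1) else 0

lemma weight_ofPartialSums (T : Fin m → ℤ) :
    weight n (ofPartialSums m T) = ∑ j, T j • stepWeight n j := by
  rw [ofPartialSums_eq_sum, map_sum]
  refine Finset.sum_congr rfl fun j _ => ?_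
  rw [map_zsmul, stepVec, map_sub, weight_single, one_smul, stepWeight]
  split_ifs
  · rw [weight_single, one_smul]
  · rw [map_zero]

lemma gamma_add_mul (hn : 2 ≤ n) (i t : ℕ) :
    gamma n (i + (n - 1) * t) = gamma n i - (t : ℤ) • delta n := by
  funext l
  simp only [gamma, delta, Pi.sub_apply, Pi.smul_apply, smul_eq_mul, mul_one]
  rw [Nat.add_mul_mod_self_left, Nat.add_mul_div_left _ _ (by omega)]
  push_cast; ring

/-- `gamma` changes by `-δ` over a period of `n - 1` indices, so its consecutive differences are
periodic. Entries of one row have indices congruent modulo `n - 1`, hence equal weights; the last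
coordinate, whose weight is not a difference, is excluded. -/
lemma stepWeight_eq (hn : 2 ≤ n) {j j' : Fin m} (hj : (j : ℕ) + 1 < m) (hj' : (j' : ℕ) + 1 < m)
    {q : ℤ} (h : (j' : ℤ) = j + (n - 1) * q) : stepWeight n j' = stepWeight n j := by
  have key : ∀ (i i' t : ℕ), i' = i + (n - 1) * t →
      gamma n i' - gamma n (i' + 1) = gamma n i - gamma n (i + 1) := by
    rintro i _ t rfl
    rw [add_right_comm, gamma_add_mul hn, gamma_add_mul hn]
    abel
  have hn1 : ((n - 1 : ℕ) : ℤ) = n - 1 := by rw [Nat.cast_sub (by omega)]; rfl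
  rw [stepWeight, stepWeight, if_pos hj, if_pos hj']
  rcases le_total 0 q with hq | hq
  · lift q to ℕ using hq
    exact key _ _ q (by zify; rw [hn1]; exact h)
  · obtain ⟨t, rfl⟩ : ∃ t : ℕ, q = -t := ⟨(-q).toNat, by omega⟩
    exact (key _ _ t (by zify; rw [hn1, h]; ring)).symm

/-- The difference of the coefficients of `α_1` and `α_0`. -/
def headForm (hn : 2 ≤ n) : RootLattice n →+ ℤ where
  toFun β := β ⟨1, by omega⟩ - β ⟨0, by omega⟩
  map_zero' := by simp
  map_add' β β' := by simp only [Pi.add_apply]; ring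

lemma headForm_gamma (hn : 2 ≤ n) (i : ℕ) : headForm hn (gamma n i) = 1 := by
  simp [headForm, gamma]

/-- A linear form with the value `i + 1` on `gamma n i`. -/
def indexForm (hn : 2 ≤ n) : RootLattice n →+ ℤ where
  -- The coefficient gives `-δ` the value `n - 1`, the corresponding shift of the index.
  toFun β := ∑ l, β l - (2 * n - 1) * β ⟨0, by omega⟩
  map_zero' := by simp
  map_add' β β' := by simp only [Pi.add_apply, Finset.sum_add_distrib]; ring

lemma indexForm_gamma (hn : 2 ≤ n) (i : ℕ) : indexForm hn (gamma n i) = i + 1 := by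
  have h1 : ∑ l : Fin n, (if 1 ≤ l.val ∧ l.val ≤ i % (n - 1) + 1 then (1 : ℤ) else 0) =
      (i % (n - 1) : ℕ) + 1 := by
    have hlt := Nat.mod_lt i (show 0 < n - 1 by omega)
    rw [Fin.sum_univ_eq_sum_range
      (fun l => if 1 ≤ l ∧ l ≤ i % (n - 1) + 1 then (1 : ℤ) else 0) n, ← Finset.sum_filter]
    have h2 : (Finset.range n).filter (fun l => 1 ≤ l ∧ l ≤ i % (n - 1) + 1) =
        Finset.Icc 1 (i % (n - 1) + 1) := by
      ext l; simp; omega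
    rw [h2]; simp
  have h2 : ((i % (n - 1) : ℕ) : ℤ) + (n - 1) * (i / (n - 1) : ℕ) = i := by
    have := congrArg (Nat.cast : ℕ → ℤ) (Nat.mod_add_div i (n - 1))
    rwa [Nat.cast_add, Nat.cast_mul, Nat.cast_sub (by omega), Nat.cast_one] at this
  simp only [indexForm, AddMonoidHom.coe_mk, ZeroHom.coe_mk, gamma, Finset.sum_sub_distrib, h1]
  simp only [Finset.sum_const, Finset.card_univ, Fintype.card_fin, nsmul_eq_mul]
  simp only [show ¬ (1 ≤ 0) by omega, false_and, if_false]
  linarith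

/-- The weights of the indicator vectors do not vanish. -/
lemma weight_chi_ne_zero (hn : 2 ≤ n) {A : Finset (Fin m)} (hA : A.Nonempty) :
    weight n (ofPartialSums m (chi A)) ≠ 0 := by
  have hw : weight n (ofPartialSums m (chi A)) = ∑ j ∈ A, stepWeight n j := by
    rw [weight_ofPartialSums]
    simp [chi, ite_smul]
  rw [hw]
  intro h0
  -- Only the last coordinate has a weight `gamma` instead of a difference: `headForm` detects it.
  -- Without it every summand has the value `-1` under `indexForm`.
  by_cases hlast : ∃ j ∈ A, (j : ℕ) + 1 = m
  · obtain ⟨j, hj, hjm⟩ := hlast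
    have h1 := congrArg (headForm hn) h0
    rw [map_sum, map_zero, Finset.sum_eq_single_of_mem j hj] at h1
    · rw [stepWeight, if_neg (by omega), sub_zero, headForm_gamma] at h1
      exact one_ne_zero h1
    · intro i _ hne
      have : (i : ℕ) + 1 < m := by
        have := i.2
        have := fun h => hne (Fin.ext h)
        omega
      rw [stepWeight, if_pos this, map_sub, headForm_gamma, headForm_gamma, sub_self]
  · push Not at hlast
    have h1 := congrArg (indexForm hn) h0
    rw [map_sum, map_zero, Finset.sum_congr rfl (g := fun _ => -1)] at h1
    · simp at h1
      exact hA.ne_empty h1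
    · intro i hi
      have : (i : ℕ) + 1 < m := by
        have := i.2
        have := hlast i hi
        omega
      rw [stepWeight, if_pos this, map_sub, indexForm_gamma, indexForm_gamma]
      push_cast; ring

end Weight

/-! ### The row system of a level -/

section Level

variable {n m : ℕ} {a : Fin n → ℕ}

/-- The entries of a level up to the index `m`, arranged in rows. -/
def levelSystem (hn : 2 ≤ n) (ha : ∀ i, 0 < a i) {v : ZSeq} (hv : toReal v ∈ polytope n a) {c : ℤ}
    (hc : -n < c) (hc' : c ≤ 0) (qf : Fin m → ℤ) (Q R : ℕ) (hQ : ∀ e, -Q ≤ qf e ∧ qf e ≤ Q)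
    (hqf : ∀ (e : Fin m) (q : ℤ), AtLevel a v c (e + 1) q → qf e = q) (hR : 1 ≤ R)
    (hRle : ∀ j q : ℤ, 0 < j → j ≤ m → AtLevel a v c j q → j + (n - 1) * q ≤ c + R)
    (hRm : ∀ j q : ℤ, AtLevel a v c j q → j + (n - 1) * q ≤ c + R → j ≤ m)
    (hRlast : ∀ j q j' q' : ℤ, AtLevel a v c j q → AtLevel a v c j' q' → j + (n - 1) * q = c + R →
      j' + (n - 1) * q' = c + R → q = q') : RowSystem (Fin m) where
  N := 2 * Q + 1
  R := R
  -- Row `r` stands for the grid row `c + r` and slot `i` for `q = i - Q`, so the grid point has the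
  -- index `c + r - (n - 1) * q`. Its value is taken relative to the level.
  lev r i := extSum a v (c + r - (n - 1) * (i - Q)) + total a * (i - Q) - bseq a c
  inLev e := AtLevel a v c (e + 1) (qf e)
  row e := (e + 1 + (n - 1) * qf e - c).toNat
  slot e := (qf e + Q).toNat
  -- The grid point `(c, 0)`, a constant because `c ≤ 0`.
  base := Q
  const := bseq a c
  R_pos := hR
  lev_le r i := by
    have := extSum_le_succ (by omega) ha hv (c + r - (n - 1) * (i - Q))
    rw [show c + r - ((n : ℤ) - 1) * (i - Q) + 1 = c + (r + 1 : ℕ) - (n - 1) * (i - Q) by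
      push_cast; ring] at this
    omega
  lev_le_succ r i := by
    have := extSum_le_sub (by omega) hv (c + (r + 1 : ℕ) - (n - 1) * (i - Q))
    rw [show c + (r + 1 : ℕ) - ((n : ℤ) - 1) * (i - Q) - n =
      c + r - (n - 1) * ((i + 1 : ℕ) - Q) by push_cast; ring] at this
    have h2 : total a * (((i + 1 : ℕ) : ℤ) - Q) = total a * (i - Q) + total a := by
      push_cast; ring
    rw [h2]
    omega
  lev_elem e he := by
    have h1 := he.lt_row_of_pos (by omega) ha hv hc' (by omega)
    have h2 := hQ e
    rw [Int.toNat_of_nonneg (by omega), Int.toNat_of_nonneg (by omega), add_sub_cancel_right,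
      show c + (e + 1 + ((n : ℤ) - 1) * qf e - c) - (n - 1) * qf e = e + 1 by ring]
    exact sub_eq_zero.mpr he
  row_pos e he := by
    have h1 := he.lt_row_of_pos (by omega) ha hv hc' (by omega)
    omega
  row_le e he := by
    have h1 := hRle (e + 1) (qf e) (by omega) (by have := e.2; omega) he
    omega
  slot_lt e he := by
    have := hQ e
    omega
  inj e e' he he' hrow hslot := by
    have h1 := he.lt_row_of_pos (by omega) ha hv hc' (by omega)
    have h2 := he'.lt_row_of_pos (by omega) ha hv hc' (by omega)
    have h3 := hQ e
    have h4 := hQ e'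
    have h5 : qf e = qf e' := by omega
    rw [h5] at hrow h1
    apply Fin.ext
    omega
  base_lt := by omega
  lev_base := by
    rw [show c + (0 : ℕ) - ((n : ℤ) - 1) * (Q - Q) = c by push_cast; ring,
      extSum_of_nonpos a v hc']
    ring
  base_unique i hi h := by
    have h1 : AtLevel a v c (c + (0 : ℕ) - (n - 1) * (i - Q)) (i - Q) := sub_eq_zero.mp h
    rcases le_or_gt (c + (0 : ℕ) - ((n : ℤ) - 1) * (i - Q)) 0 with hj | hj
    · have h2 := h1.eq_of_nonpos (by omega) ha hj
      have h3 : ((i : ℤ) - Q) = 0 := by push_cast at h2; linarith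
      omega
    · have h2 := h1.lt_row_of_pos (by omega) ha hv hc' hj
      push_cast at h2
      linarith
  surj r i hr hrR hi h := by
    have h1 : AtLevel a v c (c + r - (n - 1) * (i - Q)) (i - Q) := sub_eq_zero.mp h
    have hrow : c + r - ((n : ℤ) - 1) * (i - Q) + (n - 1) * (i - Q) = c + r := by ring
    obtain ⟨j, hj⟩ : ∃ j, j = c + r - ((n : ℤ) - 1) * (i - Q) := ⟨_, rfl⟩
    rw [← hj] at h1 hrow
    have hj0 : 0 < j := by
      by_contra hcon
      have := h1.row_le_of_nonpos (by omega) ha hc (not_lt.mp hcon)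
      omega
    have hjm := hRm _ _ h1 (by omega)
    have hje : ((⟨(j - 1).toNat, by omega⟩ : Fin m) : ℤ) + 1 = j := by
      simp only []
      omega
    rw [← hje] at h1 hrow
    have hq := hqf _ _ h1
    refine ⟨⟨(j - 1).toNat, by omega⟩, ?_, ?_, ?_⟩
    · rw [hq]; exact h1
    · rw [hq, hrow]; omega
    · rw [hq]; omega
  last_unique i i' hi hi' h h' := by
    have h1 : AtLevel a v c (c + R - (n - 1) * (i - Q)) (i - Q) := sub_eq_zero.mp h
    have h2 : AtLevel a v c (c + R - (n - 1) * (i' - Q)) (i' - Q) := sub_eq_zero.mp h'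
    have := hRlast _ _ _ _ h1 h2 (by ring) (by ring)
    omega

lemma extSum_ofPartialSums (T : Fin m → ℤ) (e : Fin m) :
    extSum a (ofPartialSums m T) (e + 1) = T e := by
  have := extSum_natCast a (ofPartialSums m T) (e + 1)
  rw [Nat.cast_succ] at this
  rw [this, psumZ_ofPartialSums]

/-- Up to the index `m` an extended partial sum is a coordinate or a constant. -/
lemma extSum_ofPartialSums_cases (a : Fin n → ℕ) {j : ℤ} (hj : j ≤ m) :
    (∃ e : Fin m, (e : ℤ) + 1 = j ∧ ∀ T, extSum a (ofPartialSums m T) j = T e) ∨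
      j ≤ 0 ∧ ∀ T, extSum a (ofPartialSums m T) j = bseq a j := by
  rcases le_or_gt j 0 with h | h
  · exact Or.inr ⟨h, fun T => extSum_of_nonpos a _ h⟩
  · left
    obtain ⟨i, rfl⟩ : ∃ i : ℕ, j = i + 1 := ⟨(j - 1).toNat, by omega⟩
    exact ⟨⟨i, by omega⟩, rfl, fun T => extSum_ofPartialSums T ⟨i, by omega⟩⟩

lemma tame_extSum_le (a : Fin n → ℕ) (off : Fin m → ℤ) {j j' : ℤ} (hj : j ≤ m) (hj' : j' ≤ m)
    (d : ℤ) : Tame fun U => extSum a (ofPartialSums m (U - off)) j ≤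
      extSum a (ofPartialSums m (U - off)) j' + d := by
  rcases extSum_ofPartialSums_cases a hj with ⟨e, -, he⟩ | ⟨-, he⟩ <;>
    rcases extSum_ofPartialSums_cases a hj' with ⟨e', -, he'⟩ | ⟨-, he'⟩ <;>
    simp only [he, he', Pi.sub_apply]
  · refine (congrArg Tame ?_).mp (tame_sub_le e e' (off e - off e' + d))
    funext U
    exact propext (by constructor <;> intro h <;> linarith)
  · refine (congrArg Tame ?_).mp (tame_le_const e (bseq a j' + d + off e))
    funext U
    exact propext (by constructor <;> intro h <;> linarith)
  · refine (congrArg Tame ?_).mp (tame_const_le e' (bseq a j - d + off e'))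
    funext U
    exact propext (by constructor <;> intro h <;> linarith)
  · exact tame_const _

lemma slack_nonneg_iff_Del (x : ZSeq) (i : ℕ) : 0 ≤ slack n a (FacetName.Del i) (toReal x) ↔
    extSum a x i ≤ extSum a x (i + 1) := by
  rw [slack_Del_toReal, Int.cast_nonneg_iff, sub_nonneg]

lemma slack_nonneg_iff_Gam (hn : 0 < n) (x : ZSeq) (i : ℕ) :
    0 ≤ slack n a (FacetName.Gam i) (toReal x) ↔
      extSum a x (i + 1) ≤ extSum a x (i + 1 - n) + total a := by
  rw [slack_Gam_toReal a hn, Int.cast_nonneg_iff, sub_nonneg]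

lemma slack_eq_zero_iff_Del (x : ZSeq) (i : ℕ) : slack n a (FacetName.Del i) (toReal x) = 0 ↔
    extSum a x i = extSum a x (i + 1) := by
  rw [slack_Del_toReal, Int.cast_eq_zero, sub_eq_zero, eq_comm]

lemma slack_eq_zero_iff_Gam (hn : 0 < n) (x : ZSeq) (i : ℕ) :
    slack n a (FacetName.Gam i) (toReal x) = 0 ↔
      extSum a x (i + 1) = extSum a x (i + 1 - n) + total a := by
  rw [slack_Gam_toReal a hn, Int.cast_eq_zero, sub_eq_zero, eq_comm]

lemma tame_slack_nonneg (hn : 0 < n) (off : Fin m → ℤ) {F : FacetName} (hF : rightEnd F ≤ m) :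
    Tame fun U => 0 ≤ slack n a F (toReal (ofPartialSums m (U - off))) := by
  cases F with
  | Gam i =>
    simp only [slack_nonneg_iff_Gam hn]
    simp only [rightEnd] at hF
    exact tame_extSum_le a off hF (by omega) _
  | Del i =>
    simp only [slack_nonneg_iff_Del]
    simp only [rightEnd] at hF
    simpa only [add_zero] using tame_extSum_le a off (j := i) (by omega) hF 0

lemma slack_congr (hn : 0 < n) {F : FacetName} {x y : ZSeq}
    (h1 : extSum a x (rightEnd F) = extSum a y (rightEnd F))
    (h2 : extSum a x (leftEnd n F).1 = extSum a y (leftEnd n F).1) :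
    slack n a F (toReal x) = slack n a F (toReal y) := by
  rw [slack_toReal_eq hn, slack_toReal_eq hn, h1, h2]

/-! ### Interlacing of a level in terms of facet inequalities. -/

section System

variable (hn : 2 ≤ n) (ha : ∀ i, 0 < a i) {v : ZSeq} (hv : toReal v ∈ polytope n a) {c : ℤ}
    (hc : -n < c) (hc' : c ≤ 0) (qf : Fin m → ℤ) (Q R : ℕ) (hQ : ∀ e, -Q ≤ qf e ∧ qf e ≤ Q)
    (hqf : ∀ (e : Fin m) (q : ℤ), AtLevel a v c (e + 1) q → qf e = q) (hR : 1 ≤ R)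
    (hRle : ∀ j q : ℤ, 0 < j → j ≤ m → AtLevel a v c j q → j + (n - 1) * q ≤ c + R)
    (hRm : ∀ j q : ℤ, AtLevel a v c j q → j + (n - 1) * q ≤ c + R → j ≤ m)
    (hRlast : ∀ j q j' q' : ℤ, AtLevel a v c j q → AtLevel a v c j' q' → j + (n - 1) * q = c + R →
      j' + (n - 1) * q' = c + R → q = q')

open Classical in
/-- The shifts that turn the weak inequalities along the columns into strict ones. -/
def levelShift (a : Fin n → ℕ) (v : ZSeq) (c : ℤ) (qf : Fin m → ℤ) (e : Fin m) : ℤ :=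
  if AtLevel a v c (e + 1) (qf e) then (total a + 1) * qf e else 0

lemma val_levelSystem (U : Fin m → ℤ) {r i : ℕ} {q j : ℤ} (hr : r ≤ R) (hi : i < 2 * Q + 1)
    (hq : (i : ℤ) = q + Q) (hj : j + (n - 1) * q = c + r)
    (h : (levelSystem hn ha hv hc hc' qf Q R hQ hqf hR hRle hRm hRlast).lev r i = 0) :
    (levelSystem hn ha hv hc hc' qf Q R hQ hqf hR hRle hRm hRlast).val U r i =
      extSum a (ofPartialSums m (U - levelShift a v c qf)) j + (total a + 1) * q := by
  set D := levelSystem hn ha hv hc hc' qf Q R hQ hqf hR hRle hRm hRlast with hD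
  rcases Nat.eq_zero_or_pos r with rfl | hr0
  · have hb := D.base_unique i hi h
    have hb' : i = Q := hb
    have hq0 : q = 0 := by omega
    subst hq0
    obtain rfl : j = c := by simpa using hj
    rw [hb, D.val_base, extSum_of_nonpos a _ hc']
    simp [hD, levelSystem]
  · obtain ⟨e, he, h1, h2⟩ := D.surj r i hr0 hr hi h
    have he' : AtLevel a v c (e + 1) (qf e) := he
    have hrow : (e + 1 + (n - 1) * qf e - c).toNat = r := h1
    have hslot : (qf e + Q).toNat = i := h2
    have h3 := he'.lt_row_of_pos (by omega) ha hv hc' (by omega)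
    have h4 := hQ e
    have hqe : qf e = q := by omega
    rw [hqe] at hrow h3
    have hje : j = e + 1 := by omega
    rw [← h1, ← h2, D.val_elem he, hje, extSum_ofPartialSums, Pi.sub_apply, levelShift,
      if_pos he', hqe]
    ring

lemma lev_levelSystem {r i : ℕ} {q j : ℤ} (hq : (i : ℤ) = q + Q) (hj : j + (n - 1) * q = c + r) :
    (levelSystem hn ha hv hc hc' qf Q R hQ hqf hR hRle hRm hRlast).lev r i =
      extSum a v j + total a * q - bseq a c := by
  change extSum a v (c + r - (n - 1) * (i - Q)) + total a * (i - Q) - bseq a c = _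
  rw [hq, add_sub_cancel_right, ← hj, add_sub_cancel_right]

/-- Neighbouring slots of equal level zero are the two ends of a tight facet functional, and
`levelShift` turns the comparison of their values into its inequality. Unequal levels are already in
the right order, and equal nonzero levels are compared by slot numbers, so neither gives a
condition. -/
lemma interlaced_levelSystem_iff (U : Fin m → ℤ) (hGm : ∀ i, slack n a (FacetName.Gam i) (toReal v) = 0 → i < m) :
    (levelSystem hn ha hv hc hc' qf Q R hQ hqf hR hRle hRm hRlast).Interlaced U ↔
      ∀ F, slack n a F (toReal v) = 0 → (∃ q, AtLevel a v c (rightEnd F) q) →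
        0 ≤ slack n a F (toReal (ofPartialSums m (U - levelShift a v c qf))) := by
  have hn0 : 0 < n := by omega
  have hlev := fun r i q j => lev_levelSystem hn ha hv hc hc' qf Q R hQ hqf hR hRle hRm hRlast
    (r := r) (i := i) (q := q) (j := j)
  have hval := fun r i q j => val_levelSystem hn ha hv hc hc' qf Q R hQ hqf hR hRle hRm hRlast U
    (r := r) (i := i) (q := q) (j := j)
  set D := levelSystem hn ha hv hc hc' qf Q R hQ hqf hR hRle hRm hRlast with hD
  set x := ofPartialSums m (U - levelShift a v c qf) with hx
  have hDN : D.N = 2 * Q + 1 := rfl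
  have hDR : D.R = R := rfl
  have hslot : ∀ j q, AtLevel a v c j q → c ≤ j + (n - 1) * q → j ≤ m → -Q ≤ q ∧ q ≤ Q := by
    intro j q h hrow hjm
    rcases le_or_gt j 0 with hj | hj
    · have h1 := h.row_le_of_nonpos hn0 ha hc hj
      have h2 := h.eq_of_nonpos hn0 ha hj
      have h3 : q = 0 := by linarith
      omega
    · obtain ⟨i, rfl⟩ : ∃ i : ℕ, j = i + 1 := ⟨(j - 1).toNat, by omega⟩
      rw [← hqf ⟨i, by omega⟩ q h]
      exact hQ _
  constructor
  · rintro hil F hF ⟨q, hq⟩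
    have hrow := hq.lt_row_of_pos hn0 ha hv hc' (rightEnd_pos F)
    have hqL := (atLevel_leftEnd_iff hn0 hF c q).mp hq
    have hrowL := row_leftEnd (n := n) F
    have hrowL' : (leftEnd n F).1 + (n - 1) * ((leftEnd n F).2 + q) + 1 =
        rightEnd F + (n - 1) * q := by linarith
    -- Beyond `m` only facets `Del` are tight, and there the coordinate is identically zero.
    rcases lt_or_ge (m : ℤ) (rightEnd F) with hFm | hFm
    · cases F with
      | Gam i =>
        have := hGm i hF
        simp only [rightEnd] at hFm
        omega
      | Del i =>
        simp only [rightEnd] at hFm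
        change (0 : ℝ) ≤ ((x i : ℤ) : ℝ)
        rw [hx, ofPartialSums_apply_of_ge _ (by omega)]
        simp
    have hLm : (leftEnd n F).1 ≤ m := by
      cases F <;> simp only [leftEnd, rightEnd] at hFm ⊢ <;> omega
    have hrowR := hRle _ _ (rightEnd_pos F) hFm hq
    have hs := hslot _ _ hq hrow.le hFm
    have hsL := hslot _ _ hqL (by omega) hLm
    obtain ⟨r, hr⟩ : ∃ r : ℕ, rightEnd F + (n - 1) * q = c + (r + 1 : ℕ) :=
      ⟨(rightEnd F + (n - 1) * q - c - 1).toNat, by omega⟩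
    have hrR : r < R := by omega
    obtain ⟨i, hi⟩ : ∃ i : ℕ, (i : ℤ) = q + Q := ⟨(q + Q).toNat, by omega⟩
    obtain ⟨h1, h2⟩ := hil r hrR
    have hlevR : D.lev (r + 1) i = 0 := by
      rw [hlev (r + 1) i q _ hi hr]; exact sub_eq_zero.mpr hq
    have hvalR := hval (r + 1) i q _ hrR (by omega) hi hr hlevR
    cases F with
    | Del l =>
      simp only [leftEnd, rightEnd, zero_add] at *
      have hlevL : D.lev r i = 0 := by
        rw [hlev r i q l hi (by omega)]; exact sub_eq_zero.mpr hqL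
      have hvalL := hval r i q l hrR.le (by omega) hi (by omega) hlevL
      have h3 := h1 ⟨i, by omega⟩
      simp only [D.key_le_iff, hlevL, hlevR, lt_irrefl, false_or, true_and, hvalL, hvalR] at h3
      rw [slack_nonneg_iff_Del]
      linarith
    | Gam l =>
      simp only [leftEnd, rightEnd] at *
      have hlevL : D.lev r (i + 1) = 0 := by
        rw [hlev r (i + 1) (1 + q) (l + 1 - n) (by push_cast; omega) (by omega)]
        exact sub_eq_zero.mpr hqL
      have hvalL := hval r (i + 1) (1 + q) (l + 1 - n) hrR.le (by omega) (by push_cast; omega)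
        (by omega) hlevL
      have h3 := h2 ⟨i, by omega⟩ ⟨i + 1, by omega⟩ (Fin.mk_lt_mk.mpr (by omega))
      simp only [D.key_lt_iff, hlevL, hlevR, lt_irrefl, false_or, true_and, hvalL, hvalR] at h3
      rw [slack_nonneg_iff_Gam hn0]
      have h4 : (total a + 1) * (1 + q) = (total a + 1) * q + total a + 1 := by ring
      omega
  · intro h r hr
    have hpos : ∀ i q j : ℤ, j + (n - 1) * q = c + (r + 1 : ℕ) → AtLevel a v c j q → 0 < j := by
      intro i q j hj hq
      by_contra hcon
      have := hq.row_le_of_nonpos hn0 ha hc (not_lt.mp hcon)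
      omega
    refine interlace_of_succ (x := D.key U r) (y := D.key U (r + 1)) (fun i hi => ?_)
      fun i hi => ?_
    · obtain ⟨q, hq⟩ : ∃ q : ℤ, (i : ℤ) = q + Q := ⟨i - Q, by omega⟩
      obtain ⟨j, hj⟩ : ∃ j : ℤ, j + (n - 1) * q = c + (r + 1 : ℕ) := ⟨_, sub_add_cancel _ _⟩
      rw [D.key_le_iff]
      rcases (D.lev_le r i).lt_or_eq with hlt | heq
      · exact Or.inl hlt
      refine Or.inr ⟨heq, ?_⟩
      by_cases h0 : D.lev r i = 0
      · have h0' := heq ▸ h0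
        have hlevel : AtLevel a v c j q := by
          rw [hlev (r + 1) i q j hq hj] at h0'; exact sub_eq_zero.mp h0'
        obtain ⟨l, rfl⟩ : ∃ l : ℕ, j = l + 1 := ⟨(j - 1).toNat, by
          have := hpos i q j hj hlevel; omega⟩
        have hj' : (l : ℤ) + (n - 1) * q = c + r := by push_cast at hj; omega
        rw [hval r i q l hr.le (by omega) hq hj' h0, hval (r + 1) i q (l + 1) hr (by omega) hq hj h0']
        rw [hlev r i q l hq hj', hlev (r + 1) i q (l + 1) hq hj] at heq
        have := (slack_nonneg_iff_Del x l).mp (h (FacetName.Del l)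
          ((slack_eq_zero_iff_Del v l).mpr (by omega)) ⟨q, hlevel⟩)
        omega
      · rw [D.val_of_lev_ne h0, D.val_of_lev_ne (heq ▸ h0)]
    · obtain ⟨q, hq⟩ : ∃ q : ℤ, (i : ℤ) = q + Q := ⟨i - Q, by omega⟩
      obtain ⟨j, hj⟩ : ∃ j : ℤ, j + (n - 1) * q = c + (r + 1 : ℕ) := ⟨_, sub_add_cancel _ _⟩
      have hj' : j - n + (n - 1) * (q + 1) = c + r := by
        push_cast at hj; linarith
      have hq' : ((i + 1 : ℕ) : ℤ) = q + 1 + Q := by push_cast; omega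
      rw [D.key_lt_iff]
      rcases (D.lev_le_succ r i).lt_or_eq with hlt | heq
      · exact Or.inl hlt
      refine Or.inr ⟨heq, ?_⟩
      by_cases h0 : D.lev (r + 1) i = 0
      · have h0' := heq ▸ h0
        have hlevel : AtLevel a v c j q := by
          rw [hlev (r + 1) i q j hq hj] at h0; exact sub_eq_zero.mp h0
        obtain ⟨l, rfl⟩ : ∃ l : ℕ, j = l + 1 := ⟨(j - 1).toNat, by
          have := hpos i q j hj hlevel; omega⟩
        rw [hval r (i + 1) (q + 1) _ hr.le (by omega) hq' hj' h0',
          hval (r + 1) i q _ hr (by omega) hq hj h0]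
        rw [hlev r (i + 1) (q + 1) _ hq' hj', hlev (r + 1) i q _ hq hj] at heq
        have h5 : total a * (q + 1) = total a * q + total a := by ring
        have := (slack_nonneg_iff_Gam hn0 x l).mp (h (FacetName.Gam l)
          ((slack_eq_zero_iff_Gam hn0 v l).mpr (by omega)) ⟨q, hlevel⟩)
        have h4 : (total a + 1) * (q + 1) = (total a + 1) * q + total a + 1 := by ring
        omega
      · rw [D.val_of_lev_ne h0, D.val_of_lev_ne (heq ▸ h0)]
        push_cast; omega

end System

end Level

/-! ### Sections of the vertex cones -/

section Sections

variable {n m : ℕ} {a : Fin n → ℕ} {v : ZSeq}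

/-- The facets `Γ_i` containing a point have indices bounded by `lastGamma`. -/
lemma lt_of_slack_Gam_eq_zero (hn : 0 < n) (ha : ∀ i, 0 < a i) {u : RSeq} (hu : u ∈ polytope n a)
    (hm : lastGamma n a u ≤ m) {i : ℕ} (hi : slack n a (FacetName.Gam i) u = 0) : i < m := by
  refine lt_of_lt_of_le (Nat.lt_of_succ_le (le_csSup ?_ ?_)) hm
  · obtain ⟨M, hM⟩ := exists_psum_eventually_const u
    refine ⟨M + n, ?_⟩
    rintro _ ⟨l, hl, rfl⟩
    by_contra hcon
    have h1 := (mem_facet_iff.mp hl).2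
    rw [slack, psi_eq_psum, psum_eq_of_ge hM (show M ≤ l + 1 by omega),
      psum_eq_of_ge hM (show M ≤ l + 1 - n by omega), sub_self,
      sub_zero] at h1
    have h2 : (bound n a l : ℤ) = total a := bound_eq_total (by omega)
    have h3 := total_pos hn ha
    have h4 : (bound n a l : ℤ) = 0 := by exact_mod_cast h1
    omega
  · exact ⟨i, mem_facet_iff.mpr ⟨hu, hi⟩, rfl⟩

/-- Otherwise the unit vector at `i` would change no functional vanishing at `u`: the tight `Γ_l`
end before `i`, and `Δ_i` would not be tight. -/
lemma IsVertex.apply_eq_zero (hn : 0 < n) {u : RSeq} (hu : IsVertex n a u)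
    (hGm : ∀ i, slack n a (FacetName.Gam i) u = 0 → i < m) {i : ℕ} (hi : m ≤ i) : u i = 0 := by
  by_contra hne
  have h1 : (Finsupp.single i 1 : RSeq) = 0 := by
    refine hu.eq_zero_of_lin hn fun F hF => ?_
    cases F with
    | Gam l =>
      have := hGm l hF
      rw [lin, psi, Finset.sum_eq_zero, neg_zero]
      intro j hj
      rw [Finset.mem_Icc] at hj
      exact Finsupp.single_eq_of_ne (by omega)
    | Del l =>
      refine Finsupp.single_eq_of_ne ?_
      rintro rfl
      exact hne hF
  simp at h1

lemma extSum_eq_of_ge (hv : ∀ i, m ≤ i → v i = 0) {j : ℤ} (hj : m ≤ j) :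
    extSum a v j = extSum a v m := by
  lift j to ℕ using by omega
  rw [extSum_natCast, extSum_natCast]
  rw [Nat.cast_le] at hj
  induction j, hj using Nat.le_induction with
  | base => rfl
  | succ j hj ih => rw [psumZ_succ, hv j hj, add_zero, ih]

/-- The index `m` closes the last row of its level. -/
lemma AtLevel.eq_of_row_le (hn : 2 ≤ n) (ha : ∀ i, 0 < a i) (hv : toReal v ∈ polytope n a)
    (hm : extSum a v (m + 1) < extSum a v (m + 1 - n) + total a) {c j q p : ℤ}
    (h : AtLevel a v c m p) (h' : AtLevel a v c j q) (hj : j ≤ m)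
    (hrow : m + (n - 1) * p ≤ j + (n - 1) * q) : j = m ∧ q = p := by
  have hn' : (0 : ℤ) < n - 1 := by omega
  have hpq : p ≤ q := by
    by_contra hcon
    have := mul_lt_mul_of_pos_left (not_le.mp hcon) hn'
    omega
  rcases hpq.eq_or_lt with rfl | hlt
  · exact ⟨by omega, rfl⟩
  exfalso
  rw [atLevel_iff_gridSum] at h'
  have h1 := gridSum_mono (by omega) ha hv (show m + n * p + 1 ≤ j + n * q by linarith)
    (show p + 1 ≤ q from hlt)
  rw [h', gridSum, show m + n * p + 1 - n * (p + 1) = (m : ℤ) + 1 - n by ring, mul_add] at h1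
  have h2 := extSum_le_succ (by omega) ha hv m
  rw [AtLevel] at h
  omega

/-- The rows of a level up to the index `m`. -/
lemma exists_rowBound (hn : 2 ≤ n) (ha : ∀ i, 0 < a i) (hv : toReal v ∈ polytope n a)
    (hm0 : 0 < m) (hconst : ∀ i, m ≤ i → v i = 0)
    (hm : extSum a v (m + 1) < extSum a v (m + 1 - n) + total a) {c : ℤ} (hc : -n < c)
    (hc' : c ≤ 0) : ∃ R : ℕ, 1 ≤ R ∧
      (∀ j q : ℤ, 0 < j → j ≤ m → AtLevel a v c j q → j + (n - 1) * q ≤ c + R) ∧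
      (∀ j q : ℤ, AtLevel a v c j q → j + (n - 1) * q ≤ c + R → j ≤ m) ∧
      (∀ j q : ℤ, AtLevel a v c j q → j + (n - 1) * q = c + R → j = m) ∧
      ∀ q : ℤ, AtLevel a v c m q → m + (n - 1) * q = c + R := by
  have hn0 : 0 < n := by omega
  have hbeyond : ∀ j q : ℤ, AtLevel a v c j q → m < j → AtLevel a v c m q := by
    intro j q h hj
    rwa [AtLevel, ← extSum_eq_of_ge hconst hj.le]
  -- If the index `m` has the level, its row is the last one: later indices repeat its value in
  -- higher rows, and all earlier ones lie in lower rows because `Γ` does not close at `m`.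
  by_cases hex : ∃ p, AtLevel a v c m p
  · obtain ⟨p, hp⟩ := hex
    have h1 := hp.lt_row_of_pos hn0 ha hv hc' (by exact_mod_cast hm0)
    obtain ⟨R, hR⟩ : ∃ R : ℕ, m + (n - 1) * p = c + R := ⟨(m + (n - 1) * p - c).toNat, by omega⟩
    have hle : ∀ j q : ℤ, AtLevel a v c j q → j + (n - 1) * q ≤ c + R → j ≤ m := by
      intro j q h hrow
      by_contra hj
      have := hp.right_unique hn0 ha (hbeyond j q h (by omega))
      subst this
      omega
    refine ⟨R, by omega, fun j q _ hj h => ?_, hle, fun j q h hrow => ?_, fun q h => ?_⟩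
    · by_contra hcon
      obtain ⟨rfl, rfl⟩ := hp.eq_of_row_le hn ha hv hm h hj (by omega)
      omega
    · exact (hp.eq_of_row_le hn ha hv hm h (hle j q h hrow.le) (by omega)).1
    · rw [h.right_unique hn0 ha hp, hR]
  -- Otherwise no index from `m` on has the level, and any row above all entries can serve as an
  -- empty last row.
  · have hN : ∀ e : Fin m, ∃ N : ℕ, ∀ q : ℤ, AtLevel a v c (e + 1) q →
        e + 1 + (n - 1) * q ≤ c + N := by
      intro e
      by_cases he : ∃ q, AtLevel a v c (e + 1) q
      · obtain ⟨q, hq⟩ := he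
        refine ⟨(e + 1 + (n - 1) * q - c).toNat, fun q' hq' => ?_⟩
        rw [hq'.right_unique hn0 ha hq]
        omega
      · exact ⟨0, fun q hq => absurd ⟨q, hq⟩ he⟩
    choose N hN using hN
    have hlt : ∀ j q : ℤ, 0 < j → j ≤ m → AtLevel a v c j q →
        j + (n - 1) * q ≤ c + (∑ e, N e : ℕ) := by
      intro j q hj hjm h
      obtain ⟨i, rfl⟩ : ∃ i : ℕ, j = i + 1 := ⟨(j - 1).toNat, by omega⟩
      have h1 := hN ⟨i, by omega⟩ q h
      have h2 := Finset.single_le_sum (f := N) (fun _ _ => Nat.zero_le _)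
        (Finset.mem_univ (⟨i, by omega⟩ : Fin m))
      simp only [] at h1
      omega
    have hle : ∀ j q : ℤ, AtLevel a v c j q → j ≤ m := fun j q h => by
      by_contra hj
      exact hex ⟨q, hbeyond j q h (by omega)⟩
    refine ⟨∑ e, N e + 1, by omega, fun j q hj hjm h => ?_, fun j q h _ => hle j q h,
      fun j q h hrow => ?_, fun q h => absurd ⟨q, h⟩ hex⟩
    · have := hlt j q hj hjm h
      push_cast at this ⊢
      linarith
    · exfalso
      rcases le_or_gt j 0 with hj | hj
      · have := h.row_le_of_nonpos hn0 ha hc hj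
        push_cast at hrow
        linarith [Finset.sum_nonneg fun e (_ : e ∈ Finset.univ) => Int.natCast_nonneg (N e)]
      · have := hlt j q hj (hle j q h) h
        push_cast at this hrow
        linarith

/-- At a vertex that is not simple the generating function of a section of the vertex cone is
annihilated by the substitution. -/
theorem IsVertex.isSigmaStar_zero (hn : 2 ≤ n) (ha : ∀ i, 0 < a i)
    (hu : IsVertex n a (toReal v)) (hns : ¬ IsSimpleVertex n a (toReal v))
    (hm : lastGamma n a (toReal v) ≤ m) :
    IsSigmaStar n (coneSection n a (toReal v) m) 0 := by
  classical
  have hn0 : 0 < n := by omega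
  have hv := hu.1
  have hGm : ∀ i, slack n a (FacetName.Gam i) (toReal v) = 0 → i < m := fun i hi =>
    lt_of_slack_Gam_eq_zero hn0 ha hv hm hi
  have hconst : ∀ i, m ≤ i → v i = 0 := fun i hi => by
    have := hu.apply_eq_zero hn0 hGm hi
    rw [toReal_apply] at this
    exact_mod_cast this
  -- `Gam m` has the one-based index `m + 1 > l_u`, so it is not tight.
  have hopen : extSum a v (m + 1) < extSum a v (m + 1 - n) + total a := by
    refine lt_of_le_of_ne (extSum_le_sub hn0 hv _) fun h => ?_
    exact lt_irrefl m (hGm m ((slack_eq_zero_iff_Gam hn0 v m).mpr h))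
  obtain ⟨c, j, q, j', q', hc, hc', hj, hj', h, h', hrow, hne⟩ := hu.exists_same_row hn ha hns
  have hqq : q ≠ q' := by
    rintro rfl
    exact hne (by linarith)
  -- Beyond `m` the partial sums are constant, so an index there has the level and the multiplier of
  -- `m` itself. Sharing its row with another multiplier would contradict `AtLevel.eq_of_row_le` or
  -- uniqueness of the multiplier.
  have hclosed : ∀ j q j' q' : ℤ, AtLevel a v c j q → AtLevel a v c j' q' →
      j + (n - 1) * q = j' + (n - 1) * q' → q ≠ q' → j ≤ m := by
    intro j q j' q' h h' hrow hqq
    by_contra hjm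
    have h1 : AtLevel a v c m q := by rwa [AtLevel, ← extSum_eq_of_ge hconst (not_le.mp hjm).le]
    rcases le_or_gt j' m with hj' | hj'
    · exact hqq (h1.eq_of_row_le hn ha hv hopen h' hj' (by omega)).2.symm
    · have h2 : AtLevel a v c m q' := by rwa [AtLevel, ← extSum_eq_of_ge hconst hj'.le]
      exact hqq (h1.right_unique hn0 ha h2)
  have hjm := hclosed j q j' q' h h' hrow hqq
  have hjm' := hclosed j' q' j q h' h hrow.symm hqq.symm
  obtain ⟨R, hR, hRle, hRm, hRlast, hRend⟩ :=
    exists_rowBound hn ha hv (by omega) hconst hopen hc hc'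
  have hqf : ∀ e : Fin m, ∃ p : ℤ, ∀ q : ℤ, AtLevel a v c (e + 1) q → p = q := by
    intro e
    by_cases he : ∃ q, AtLevel a v c (e + 1) q
    · obtain ⟨p, hp⟩ := he
      exact ⟨p, fun q hq => hp.right_unique hn0 ha hq⟩
    · exact ⟨0, fun q hq => absurd ⟨q, hq⟩ he⟩
  choose qf hqf using hqf
  obtain ⟨Q, hQ⟩ : ∃ Q : ℕ, ∀ e, -Q ≤ qf e ∧ qf e ≤ Q := by
    refine ⟨∑ e, (qf e).natAbs, fun e => ?_⟩
    have := Finset.single_le_sum (f := fun e => (qf e).natAbs) (fun _ _ => Nat.zero_le _)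
      (Finset.mem_univ e)
    omega
  have hRlast' : ∀ j q j' q' : ℤ, AtLevel a v c j q → AtLevel a v c j' q' →
      j + (n - 1) * q = c + R → j' + (n - 1) * q' = c + R → q = q' := by
    intro j q j' q' h h' hr hr'
    obtain rfl := hRlast j q h hr
    obtain rfl := hRlast j' q' h' hr'
    exact h.right_unique hn0 ha h'
  set D := levelSystem hn ha hv hc hc' qf Q R hQ hqf hR hRle hRm hRlast' with hD
  set off := levelShift a v c qf with hoff
  have hrowD : ∀ e, D.inLev e → (D.row e : ℤ) = e + 1 + (n - 1) * qf e - c := by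
    intro e he
    have := AtLevel.lt_row_of_pos hn0 ha hv hc' (show AtLevel a v c (e + 1) (qf e) from he)
      (by omega)
    change ((e + 1 + (n - 1) * qf e - c).toNat : ℤ) = _
    omega
  have hperm : ∀ π : Equiv.Perm (Fin m), (∀ j, ¬ D.inLev j → π j = j) →
      (∀ j, D.inLev j → D.inLev (π j) ∧ D.row (π j) = D.row j) →
      ∀ T, ((weight n).comp (ofPartialSums m)) (T ∘ π) = ((weight n).comp (ofPartialSums m)) T := by
    intro π h1 h2 T
    have hstep : ∀ e, stepWeight n (π e) = stepWeight n e := by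
      intro e
      by_cases he : D.inLev e
      · obtain ⟨he', hr⟩ := h2 e he
        have hr' : ((π e : ℕ) : ℤ) + 1 + (n - 1) * qf (π e) = e + 1 + (n - 1) * qf e := by
          have h3 := hrowD e he
          have h4 := hrowD (π e) he'
          rw [hr] at h4
          omega
        have hl : AtLevel a v c (e + 1) (qf e) := he
        have hl' : AtLevel a v c ((π e : ℕ) + 1) (qf (π e)) := he'
        -- The last coordinate has an exceptional weight, so row permutations must fix it; they do,
        -- since its row contains no other index.
        have hlast : ((e : ℕ) + 1 = m ↔ (π e : ℕ) + 1 = m) := by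
          constructor
          · intro hem
            have hem' : ((e : ℕ) : ℤ) + 1 = m := by exact_mod_cast hem
            have h3 := hRend (qf e) (by rwa [← hem'])
            have := hRlast _ _ hl' (by rw [hr', hem', h3])
            exact_mod_cast this
          · intro hem
            have hem' : ((π e : ℕ) : ℤ) + 1 = m := by exact_mod_cast hem
            have h3 := hRend (qf (π e)) (by rwa [← hem'])
            have := hRlast _ _ hl (by rw [← hr', hem', h3])
            exact_mod_cast this
        by_cases hem : (e : ℕ) + 1 = m
        · have := hlast.mp hem
          congr 1
          exact Fin.ext (by omega)
        · have hem' := fun h => hem (hlast.mpr h)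
          have := e.2
          have := (π e).2
          refine stepWeight_eq hn (by omega) (by omega) (q := qf e - qf (π e)) ?_
          linarith
      · rw [h1 e he]
    rw [AddMonoidHom.comp_apply, AddMonoidHom.comp_apply, weight_ofPartialSums,
      weight_ofPartialSums, ← Equiv.sum_comp π fun e => T e • stepWeight n e]
    simp only [Function.comp_apply, hstep]
  -- The tight inequalities outside the chosen level. Both their ends lie outside it, so they do not
  -- involve its variables.
  set P : (Fin m → ℤ) → Prop := fun U => ∀ F, slack n a F (toReal v) = 0 →
    (¬ ∃ q, AtLevel a v c (rightEnd F) q) →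
    0 ≤ slack n a F (toReal (ofPartialSums m (U - off))) with hP
  have hPm : ∀ U F, slack n a F (toReal v) = 0 → (m : ℤ) < rightEnd F →
      0 ≤ slack n a F (toReal (ofPartialSums m (U - off))) := by
    intro U F hF hFm
    cases F with
    | Gam i =>
      have := hGm i hF
      simp only [rightEnd] at hFm
      omega
    | Del i =>
      simp only [rightEnd] at hFm
      rw [slack, toReal_apply, ofPartialSums_apply_of_ge _ (by omega), Int.cast_zero]
  have htame : Tame P := by
    have hfin : {F | rightEnd F ≤ m}.Finite := by
      refine (((Set.finite_lt_nat m).image FacetName.Gam).union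
        ((Set.finite_lt_nat m).image FacetName.Del)).subset ?_
      rintro (i | i) hi <;> simp only [Set.mem_ofPred_eq, rightEnd] at hi
      · exact Or.inl ⟨i, by simp only [Set.mem_ofPred_eq]; omega, rfl⟩
      · exact Or.inr ⟨i, by simp only [Set.mem_ofPred_eq]; omega, rfl⟩
    have := hfin.to_subtype
    have h1 := (tame_pi fun F : {F | rightEnd F ≤ m} => tame_slack_nonneg (a := a) hn0 off F.2).comp
      fun p => ∀ F, slack n a F.1 (toReal v) = 0 → (¬ ∃ q, AtLevel a v c (rightEnd F.1) q) → p F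
    refine (congrArg Tame ?_).mp h1
    funext U
    refine propext ⟨fun h2 F hF hF' => ?_, fun h2 F => h2 F.1⟩
    rcases lt_or_ge (m : ℤ) (rightEnd F) with hFm | hFm
    · exact hPm U F hF hFm
    · exact h2 ⟨F, hFm⟩ hF hF'
  have hPcongr : ∀ U U', (∀ e, ¬ D.inLev e → U e = U' e) → P U → P U' := by
    intro U U' hU hPU F hF hF'
    rcases lt_or_ge (m : ℤ) (rightEnd F) with hFm | hFm
    · exact hPm U' F hF hFm
    have hsame : ∀ j : ℤ, j ≤ m → (∀ q, ¬ AtLevel a v c j q) →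
        extSum a (ofPartialSums m (U' - off)) j = extSum a (ofPartialSums m (U - off)) j := by
      intro j hj hlev
      rcases extSum_ofPartialSums_cases a hj with ⟨e, rfl, he⟩ | ⟨-, he⟩
      · rw [he, he, Pi.sub_apply, Pi.sub_apply, hU e fun hin => hlev _ hin]
      · rw [he, he]
    have hleft : (leftEnd n F).1 ≤ m := by
      cases F <;> simp only [leftEnd, rightEnd] at hFm ⊢ <;> omega
    have hF'' : ∀ q, ¬ AtLevel a v c (leftEnd n F).1 q := fun q hq =>
      hF' ⟨q - (leftEnd n F).2, (atLevel_leftEnd_iff hn0 hF c _).mpr (by rwa [add_sub_cancel])⟩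
    rw [slack_congr hn0 (hsame _ hFm fun q hq => hF' ⟨q, hq⟩) (hsame _ hleft hF'')]
    exact hPU F hF hF'
  -- The indicator of the section factors into the chosen level and the rest. The translation by
  -- `-off` only multiplies the numerator by a monomial.
  have hmem : ∀ T : Fin m → ℤ, genFun (coneSection n a (toReal v) m) (ofPartialSums m T) =
      (if D.Interlaced (T - -off) then 1 else 0) * (if P (T - -off) then 1 else 0) := by
    intro T
    rw [genFun, ite_zero_mul_ite_zero, one_mul]
    refine if_congr ?_ rfl rfl
    rw [hD, interlaced_levelSystem_iff hn ha hv hc hc' qf Q R hQ hqf hR hRle hRm hRlast' _ hGm, hP,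
      ← hoff, sub_neg_eq_add]
    simp only [add_sub_cancel_right]
    constructor
    · rintro ⟨h1, -⟩
      rw [hu.mem_vertexCone_iff hn0] at h1
      exact ⟨fun F hF _ => h1 F hF, fun F hF _ => h1 F hF⟩
    · rintro ⟨h1, h2⟩
      refine ⟨(hu.mem_vertexCone_iff hn0).mpr fun F hF => ?_, fun i hi => ?_⟩
      · by_cases hex : ∃ q, AtLevel a v c (rightEnd F) q
        · exact h1 F hF hex
        · exact h2 F hF hex
      · rw [toReal_apply, ofPartialSums_apply_of_ge T hi, Int.cast_zero]
  obtain ⟨i, rfl⟩ : ∃ i : ℕ, j = i + 1 := ⟨(j - 1).toNat, by omega⟩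
  obtain ⟨i', rfl⟩ : ∃ i : ℕ, j' = i + 1 := ⟨(j' - 1).toNat, by omega⟩
  have he : qf ⟨i, by omega⟩ = q := hqf ⟨i, by omega⟩ q h
  have he' : qf ⟨i', by omega⟩ = q' := hqf ⟨i', by omega⟩ q' h'
  have hin : D.inLev ⟨i, by omega⟩ := by
    change AtLevel a v c (i + 1) _
    rwa [he]
  have hin' : D.inLev ⟨i', by omega⟩ := by
    change AtLevel a v c (i' + 1) _
    rwa [he']
  obtain ⟨hadm, hzero⟩ := D.numerator_interlaced_eq_zero hperm
    (htame.comp fun p => if p then (1 : ℂ) else 0)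
    (fun U U' hU => if_congr ⟨hPcongr U U' hU, hPcongr U' U fun e he => (hU e he).symm⟩ rfl rfl)
    hin hin' (fun heq => hne (by rw [Fin.mk.injEq] at heq; rw [heq])) (by
      have h1 := hrowD _ hin
      have h2 := hrowD _ hin'
      rw [he] at h1
      rw [he'] at h2
      simp only [] at h1 h2
      omega)
  refine isSigmaStar_zero_of_numerator (ofPartialSums m) (ofPartialSums_injective m) ?_ ?_
    (fun A hA => weight_chi_ne_zero hn hA) ?_
  · rintro x ⟨-, hx⟩
    refine mem_range_ofPartialSums fun i hi => ?_
    have := hx i hi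
    rw [toReal_apply] at this
    exact_mod_cast this
  · simp only [hmem]
    exact hadm.sub_const (-off)
  · simp only [hmem]
    rw [numerator_sub_const hadm (-off), hzero, mul_zero]

end Sections

end FSPolytope

end

theorem mainTheorem3 (n : ℕ) (hn : 2 ≤ n) (a : Fin n → ℕ) (ha : ∀ i, 0 < a i)
    (u : FSPolytope.RSeq) (hu : FSPolytope.IsVertex n a u)
    (hns : ¬ FSPolytope.IsSimpleVertex n a u) :
    ∀ τ : FSPolytope.RootLattice n → ℂ, FSPolytope.IsContribution n a u τ ↔ τ = 0 := by
  obtain ⟨v, rfl⟩ := hu.exists_toReal_eq (by omega)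
  exact FSPolytope.isContribution_iff_of_isSigmaStar_zero hn fun m hm =>
    hu.isSigmaStar_zero hn ha hns hm
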